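/- **Conventions.** Manifolds are smooth, Hausdorff, second countable, without boundary; Lie groups are real, finite-dimensional and second countable. A *lightlike metric* on a manifold $M$ is a smooth field $h$ of symmetric bilinear forms $h_x$ on $T_xM$, each of them positive semidefinite with a kernel of dimension exactly $1$. On $\mathbb R^{1+d}$ let $q(x)=-x_0^2+x_1^2+\dots+x_d^2$, let $O(1,d)$ be the group of linear automorphisms preserving $q$, and $SO_0(1,d)$ its identity component. For $d\ge 2$, $Co^d=\{x\in\mathbb R^{1+d}: q(x)=0,\ x_0>0\}$ carries the lightlike metric induced by $q$; $Co^1$ denotes the circle $S^1$ with the null metric. An action of $G$ is *locally faithful* if its kernel is a discrete subgroup of $G$. It is *non-proper* if there are $p_k\in M$ and $g_k\in G$ such that all $p_k$ and all $g_kp_k$ lie in one compact subset of $M$, while $(g_k)$ leaves every compact subset of $G$. An orbit with its manifold structure as a quotient of the acting group and with the tensor induced by $h$ is *homothetic* to $(C,c)$ if there are a diffeomorphism $\iota$ from $C$ onto the orbit and a real $r>0$ with $\iota^*h=r\,c$. **Proposition.** Let $(M,h)$ be a lightlike manifold and let $G=H\times H'$ act smoothly on $M$ by isometries of $h$, locally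 faithfully, transitively and non-properly. Here $H'$ is a semisimple Lie group, and $H$ is a Lie group isomorphic to $O(1,d)$, $d\ge2$, or more generally to a subgroup $K$ of finite index in $O(1,d)$. 1. Suppose that for some $p\in M$ the orbit $H\cdot p$ is homothetic to $Co^d$; if $d=2$, suppose also that $K$ is not contained in $SO_0(1,2)\cup(-SO_0(1,2))$ (which is automatic for $K=O(1,2)$). Then $(M,h)$ is isometric to a metric product $Co^d\times N$, where $N$ is an $H'$-homogeneous Riemannian manifold. 2. Suppose that $d=2$ and that for some $p\in M$ the orbit $H\cdot p$ is homothetic to $Co^1$. Then $(M,h)$ is isometric to a metric product $Co^1\times N$, where $N$ is an $H'$-homogeneous Riemannian manifold. Here a *metric product* $C\times N$ carries the tensor $c\oplus g_N$, and $N$ is *$H'$-homogeneous* if $H'$ acts on it smoothly, transitively and by isometries of its Riemannian metric $g_N$. -/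

import Mathlib

open Filter Topology Manifold
open scoped ContDiff

noncomputable section

/-- `ℝ^{1+d}`, the space underlying Minkowski space `Min_{1,d}`; the coordinate `0` is time. -/
abbrev MinkowskiSpace (d : ℕ) : Type := EuclideanSpace ℝ (Fin (d + 1))

/-- The Minkowski form `-x₀y₀ + x₁y₁ + ⋯ + x_dy_d`. -/
def minkowskiForm (d : ℕ) (x y : MinkowskiSpace d) : ℝ :=
  -(x 0 * y 0) + ∑ i : Fin d, x i.succ * y i.succ

/-- `O(1,d)`: all linear automorphisms of `ℝ^{1+d}` that preserve the Minkowski form. -/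
def lorentzGroup (d : ℕ) : Subgroup (MinkowskiSpace d ≃L[ℝ] MinkowskiSpace d) where
  carrier := {A | ∀ x y, minkowskiForm d (A x) (A y) = minkowskiForm d x y}
  mul_mem' {A B} hA hB x y := by
    have h := hA (B x) (B y)
    rw [hB] at h
    exact h
  one_mem' _ _ := rfl
  inv_mem' {A} hA x y := by
    have h := hA (A.symm x) (A.symm y)
    simp only [ContinuousLinearEquiv.apply_symm_apply] at h
    exact h.symm

/-- The time unit vector `e₀`. -/
def timeVector (d : ℕ) : MinkowskiSpace d := EuclideanSpace.single 0 1

/-- The lightcone `Co^d = {q(x) = 0, x₀ > 0}` in Minkowski space. -/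
@[ext]
structure LightCone (d : ℕ) where
  /-- The inclusion of the lightcone in Minkowski space. -/
  incl : MinkowskiSpace d
  isotropic : minkowskiForm d incl incl = 0
  pos : 0 < incl 0

namespace LightCone

variable {d : ℕ}

/-- The lightcone has the topology of a subset of Minkowski space. -/
instance : TopologicalSpace (LightCone d) := TopologicalSpace.induced incl inferInstance

/-- The space part `(x₁, …, x_d)` of a vector. -/
def spacePart (x : MinkowskiSpace d) : EuclideanSpace ℝ (Fin d) :=
  WithLp.toLp 2 fun i => x i.succ

/-- The map `y ↦ (‖y‖, y)`, of which the lightcone is the graph over `ℝ^d ∖ {0}`. -/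
def lift (y : EuclideanSpace ℝ (Fin d)) : MinkowskiSpace d :=
  WithLp.toLp 2 (Fin.cons ‖y‖ fun i => y i)

theorem continuous_incl : Continuous (incl (d := d)) := continuous_induced_dom

theorem continuous_spacePart : Continuous (spacePart (d := d)) := by
  unfold spacePart; fun_prop

theorem continuous_lift : Continuous (lift (d := d)) := by
  unfold lift
  refine (PiLp.continuous_toLp 2 _).comp (continuous_pi fun i => ?_)
  refine Fin.cases ?_ (fun j => ?_) i
  · simpa using continuous_norm
  · simp only [Fin.cons_succ]; fun_prop

theorem minkowskiForm_self (x : MinkowskiSpace d) :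
    minkowskiForm d x x = -(x 0) ^ 2 + ‖spacePart x‖ ^ 2 := by
  rw [EuclideanSpace.real_norm_sq_eq]
  simp [minkowskiForm, spacePart, sq]

theorem spacePart_lift (y : EuclideanSpace ℝ (Fin d)) : spacePart (lift y) = y := by
  ext i; simp [spacePart, lift]

theorem norm_spacePart (x : LightCone d) : ‖spacePart x.incl‖ = x.incl 0 := by
  have h := x.isotropic
  rw [minkowskiForm_self] at h
  have : ‖spacePart x.incl‖ ^ 2 = (x.incl 0) ^ 2 := by linarith
  exact (sq_eq_sq₀ (norm_nonneg _) x.pos.le).1 this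

theorem spacePart_ne_zero (x : LightCone d) : spacePart x.incl ≠ 0 := by
  rw [← norm_pos_iff, norm_spacePart]; exact x.pos

theorem lift_spacePart (x : LightCone d) : lift (spacePart x.incl) = x.incl := by
  ext i
  refine Fin.cases ?_ (fun j => ?_) i
  · simp [lift, norm_spacePart]
  · simp [lift, spacePart]

theorem lift_pos {y : EuclideanSpace ℝ (Fin d)} (hy : y ≠ 0) : 0 < lift y 0 := by
  simpa [lift] using hy

theorem lift_isotropic (y : EuclideanSpace ℝ (Fin d)) :
    minkowskiForm d (lift y) (lift y) = 0 := by
  rw [minkowskiForm_self, spacePart_lift]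
  simp [lift]

theorem continuousOn_of_incl {s : Set (EuclideanSpace ℝ (Fin d))}
    {f : EuclideanSpace ℝ (Fin d) → LightCone d} (hf : ContinuousOn (fun y => (f y).incl) s) :
    ContinuousOn f s :=
  (Topology.IsInducing.continuousOn_iff ⟨rfl⟩).2 hf

open Classical in
/-- The projection `(x₀, x₁, …, x_d) ↦ (x₁, …, x_d)` of the lightcone onto `ℝ^d ∖ {0}`, as a chart
defined on the whole lightcone. The point `p` only serves as the value of the inverse outside the
target. -/
def chart (p : LightCone d) : OpenPartialHomeomorph (LightCone d) (EuclideanSpace ℝ (Fin d)) where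
  toFun x := spacePart x.incl
  invFun y := if hy : y ≠ 0 then ⟨lift y, lift_isotropic y, lift_pos hy⟩ else p
  source := Set.univ
  target := {y | y ≠ 0}
  map_source' x _ := spacePart_ne_zero x
  map_target' _ _ := Set.mem_univ _
  left_inv' x _ := by
    rw [dif_pos (spacePart_ne_zero x)]
    exact LightCone.ext (lift_spacePart x)
  right_inv' y hy := by
    rw [dif_pos (show y ≠ 0 from hy)]
    exact spacePart_lift y
  open_source := isOpen_univ
  open_target := isOpen_ne
  continuousOn_toFun := (continuous_spacePart.comp continuous_incl).continuousOn
  continuousOn_invFun := by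
    refine continuousOn_of_incl (continuous_lift.continuousOn.congr fun y hy => ?_)
    rw [dif_pos (show y ≠ 0 from hy)]

theorem incl_chart_symm (p : LightCone d) {y : EuclideanSpace ℝ (Fin d)} (hy : y ≠ 0) :
    ((chart p).symm y).incl = lift y := by
  change (incl (if hy : y ≠ 0 then ⟨lift y, lift_isotropic y, lift_pos hy⟩ else p)) = _
  rw [dif_pos hy]

instance : ChartedSpace (EuclideanSpace ℝ (Fin d)) (LightCone d) where
  atlas := Set.range chart
  chartAt := chart
  mem_chart_source _ := Set.mem_univ _
  chart_mem_atlas p := ⟨p, rfl⟩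

instance : IsManifold (𝓡 d) ∞ (LightCone d) := by
  refine isManifold_of_contDiffOn _ _ _ ?_
  rintro _ _ ⟨p, rfl⟩ ⟨p', rfl⟩
  refine contDiff_id.contDiffOn.congr fun y hy => ?_
  have hy' : y ≠ 0 := by
    have := hy.1
    simp [chart] at this
    exact this
  change spacePart ((chart p).symm y).incl = y
  rw [incl_chart_symm p hy', spacePart_lift]

/-- The lightcone is a smooth submanifold of Minkowski space: the inclusion is smooth. -/
theorem contMDiff_incl : ContMDiff (𝓡 d) 𝓘(ℝ, MinkowskiSpace d) ∞ (incl (d := d)) := by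
  rw [contMDiff_iff]
  refine ⟨continuous_incl, fun p v => ?_⟩
  have key : ContDiffOn ℝ ∞ (lift (d := d)) {y | y ≠ 0} := by
    rw [contDiffOn_euclidean]
    intro i
    refine Fin.cases ?_ (fun j => ?_) i
    · simp only [lift, Fin.cons_zero]
      exact fun y hy => (contDiffAt_norm ℝ hy).contDiffWithinAt
    · simp only [lift, Fin.cons_succ]
      fun_prop
  refine (key.mono fun y hy => ?_).congr fun y hy => ?_
  · have := hy.1
    simp [chartAt, ChartedSpace.chartAt, chart] at this
    exact this
  · have hy' : y ≠ 0 := by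
      have := hy.1
      simp [chartAt, ChartedSpace.chartAt, chart] at this
      exact this
    exact incl_chart_symm p hy'

/-- The tensor that the Minkowski form induces on the lightcone. -/
def metric (d : ℕ) (x : LightCone d) (v w : TangentSpace (𝓡 d) x) : ℝ :=
  minkowskiForm d (mfderiv (𝓡 d) 𝓘(ℝ, MinkowskiSpace d) incl x v)
    (mfderiv (𝓡 d) 𝓘(ℝ, MinkowskiSpace d) incl x w)

end LightCone

/-- The lightcone `Co^1` is by convention the circle with the null metric. -/
def circleNullMetric (x : Circle) (_ _ : TangentSpace (𝓡 1) x) : ℝ := 0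

universe u

/-- A lightlike metric on a manifold: a smooth field of symmetric positive bilinear forms on the
tangent spaces, each of them with a kernel of dimension exactly one. -/
structure LightlikeMetric (E : Type*) [NormedAddCommGroup E] [NormedSpace ℝ E]
    (M : Type*) [TopologicalSpace M] [ChartedSpace E M] [IsManifold 𝓘(ℝ, E) ∞ M] where
  /-- The bilinear form on each tangent space. -/
  form (x : M) : TangentSpace 𝓘(ℝ, E) x →L[ℝ] TangentSpace 𝓘(ℝ, E) x →L[ℝ] ℝ
  symm (x : M) (v w : TangentSpace 𝓘(ℝ, E) x) : form x v w = form x w v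
  nonneg (x : M) (v : TangentSpace 𝓘(ℝ, E) x) : 0 ≤ form x v v
  finrank_ker (x : M) : Module.finrank ℝ (LinearMap.ker (form x).toLinearMap) = 1
  contMDiff : ContMDiff 𝓘(ℝ, E) (𝓘(ℝ, E).prod 𝓘(ℝ, E →L[ℝ] E →L[ℝ] ℝ)) ∞
    (fun x : M => Bundle.TotalSpace.mk' (E →L[ℝ] E →L[ℝ] ℝ)
      (E := fun x : M => TangentSpace 𝓘(ℝ, E) x →L[ℝ] TangentSpace 𝓘(ℝ, E) x →L[ℝ] ℝ) x (form x))

/-- `G` acts by isometries of the lightlike metric `h`. -/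
def LightlikeMetric.IsIsometricAction {E : Type*} [NormedAddCommGroup E] [NormedSpace ℝ E]
    {M : Type*} [TopologicalSpace M] [ChartedSpace E M] [IsManifold 𝓘(ℝ, E) ∞ M]
    (h : LightlikeMetric E M) (G : Type*) [Group G] [MulAction G M] : Prop :=
  ∀ (a : G) (x : M) (v w : TangentSpace 𝓘(ℝ, E) x),
    h.form (a • x) (mfderiv 𝓘(ℝ, E) 𝓘(ℝ, E) (fun y : M => a • y) x v)
      (mfderiv 𝓘(ℝ, E) 𝓘(ℝ, E) (fun y : M => a • y) x w) = h.form x v w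

/-- The kernel of the action is a discrete subgroup. -/
def IsLocallyFaithful (G M : Type*) [Group G] [TopologicalSpace G] [MulAction G M] : Prop :=
  DiscreteTopology (MulAction.toPermHom G M).ker

/-- The action is non-proper: there is a non-escaping sequence `(p_k)`, i.e. `(p_k)` and
`(g_k p_k)` stay in a compact subset of `M` for some sequence `(g_k)` in `G` that leaves every
compact subset of `G`. -/
def IsNonProper (G M : Type*) [Group G] [TopologicalSpace G] [TopologicalSpace M]
    [MulAction G M] : Prop :=
  ∃ (p : ℕ → M) (g : ℕ → G) (K : Set M), IsCompact K ∧ (∀ k, p k ∈ K ∧ g k • p k ∈ K) ∧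
    Tendsto g atTop (cocompact G)

/-- A Lie group whose Lie algebra is semisimple. -/
def IsSemisimpleLieGroup (E : Type*) [NormedAddCommGroup E] [NormedSpace ℝ E]
    [FiniteDimensional ℝ E] (G : Type*) [Group G] [TopologicalSpace G] [ChartedSpace E G]
    [LieGroup 𝓘(ℝ, E) ∞ G] : Prop :=
  haveI : CompleteSpace E := FiniteDimensional.complete ℝ E
  haveI : LieGroup 𝓘(ℝ, E) (minSmoothness ℝ 3) G :=
    LieGroup.of_le (n := ∞) (by rw [minSmoothness_of_isRCLikeNormedField]; exact ENat.LEInfty.out)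
  LieAlgebra.IsSemisimple ℝ (GroupLieAlgebra 𝓘(ℝ, E) G)

/-- `e` is an isomorphism of Lie groups of `H` onto the subgroup `K` of the linear group of `V`,
i.e. a group isomorphism such that `H → K ⊆ End V` is a smooth embedding. -/
def IsLieGroupIsoOnto {E : Type*} [NormedAddCommGroup E] [NormedSpace ℝ E]
    {H : Type*} [Group H] [TopologicalSpace H] [ChartedSpace E H]
    {V : Type*} [NormedAddCommGroup V] [NormedSpace ℝ V] {K : Subgroup (V ≃L[ℝ] V)}
    (e : H ≃* K) : Prop :=
  IsSmoothEmbedding 𝓘(ℝ, E) 𝓘(ℝ, V →L[ℝ] V) ∞ fun a : H => ((e a : V ≃L[ℝ] V) : V →L[ℝ] V)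

/-- The orbit of `p` under the Lie group `H`, with the tensor induced by `h` and with its manifold
structure (that of the quotient of `H` by the stabilizer of `p`), is homothetic to the manifold
`C` with the tensor `c`. The diffeomorphism of `C` onto the orbit is `ι`, seen as an injective
immersion in `M`; the map `π` is the orbit map `a ↦ a • p` read in `C`. -/
def OrbitHomotheticTo {E : Type*} [NormedAddCommGroup E] [NormedSpace ℝ E]
    {M : Type*} [TopologicalSpace M] [ChartedSpace E M] [IsManifold 𝓘(ℝ, E) ∞ M]
    (h : LightlikeMetric E M)
    (E₁ : Type*) [NormedAddCommGroup E₁] [NormedSpace ℝ E₁]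
    {H : Type*} [TopologicalSpace H] [ChartedSpace E₁ H] (act : H → M → M) (p : M)
    {E₀ : Type*} [NormedAddCommGroup E₀] [NormedSpace ℝ E₀]
    {C : Type*} [TopologicalSpace C] [ChartedSpace E₀ C]
    (c : ∀ x : C, TangentSpace 𝓘(ℝ, E₀) x → TangentSpace 𝓘(ℝ, E₀) x → ℝ) : Prop :=
  ∃ (ι : C → M) (π : H → C) (r : ℝ), 0 < r ∧
    ContMDiff 𝓘(ℝ, E₀) 𝓘(ℝ, E) ∞ ι ∧ Function.Injective ι ∧
    (∀ x, Function.Injective (mfderiv 𝓘(ℝ, E₀) 𝓘(ℝ, E) ι x)) ∧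
    ContMDiff 𝓘(ℝ, E₁) 𝓘(ℝ, E₀) ∞ π ∧ Function.Surjective π ∧ (∀ a, ι (π a) = act a p) ∧
    ∀ (x : C) (v w : TangentSpace 𝓘(ℝ, E₀) x),
      h.form (ι x) (mfderiv 𝓘(ℝ, E₀) 𝓘(ℝ, E) ι x v) (mfderiv 𝓘(ℝ, E₀) 𝓘(ℝ, E) ι x w) =
        r * c x v w

/-- `(M, h)` is isometric to a metric product `C × N`, where `C` carries the tensor `c` and `N` is
an `H'`-homogeneous Riemannian manifold: `H'` acts smoothly, transitively and isometrically
on `N`. -/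
def IsProductWithHomogeneous {E : Type*} [NormedAddCommGroup E] [NormedSpace ℝ E]
    {M : Type u} [TopologicalSpace M] [ChartedSpace E M] [IsManifold 𝓘(ℝ, E) ∞ M]
    (h : LightlikeMetric E M)
    {E₀ : Type*} [NormedAddCommGroup E₀] [NormedSpace ℝ E₀]
    {C : Type*} [TopologicalSpace C] [ChartedSpace E₀ C]
    (c : ∀ x : C, TangentSpace 𝓘(ℝ, E₀) x → TangentSpace 𝓘(ℝ, E₀) x → ℝ)
    (E₂ : Type*) [NormedAddCommGroup E₂] [NormedSpace ℝ E₂]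
    (H' : Type*) [Group H'] [TopologicalSpace H'] [ChartedSpace E₂ H'] : Prop :=
  ∃ (k : ℕ) (N : Type u) (_ : TopologicalSpace N) (_ : T2Space N) (_ : SecondCountableTopology N)
    (_ : ChartedSpace (EuclideanSpace ℝ (Fin k)) N) (_ : IsManifold (𝓡 k) ∞ N)
    (g : Bundle.ContMDiffRiemannianMetric (𝓡 k) ∞ (EuclideanSpace ℝ (Fin k))
      (fun y : N => TangentSpace (𝓡 k) y))
    (_ : MulAction H' N)
    (Φ : (C × N) ≃ₘ^∞⟮𝓘(ℝ, E₀).prod (𝓡 k), 𝓘(ℝ, E)⟯ M),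
    ContMDiffSMul 𝓘(ℝ, E₂) (𝓡 k) ∞ H' N ∧
    MulAction.IsPretransitive H' N ∧
    (∀ (a : H') (y : N) (v w : TangentSpace (𝓡 k) y),
      g.inner (a • y) (mfderiv (𝓡 k) (𝓡 k) (fun z : N => a • z) y v)
        (mfderiv (𝓡 k) (𝓡 k) (fun z : N => a • z) y w) = g.inner y v w) ∧
    ∀ (z : C × N) (v w : TangentSpace (𝓘(ℝ, E₀).prod (𝓡 k)) z),
      h.form (Φ z) (mfderiv (𝓘(ℝ, E₀).prod (𝓡 k)) 𝓘(ℝ, E) Φ z v)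
          (mfderiv (𝓘(ℝ, E₀).prod (𝓡 k)) 𝓘(ℝ, E) Φ z w) =
        c z.1 v.1 w.1 + g.inner z.2 v.2 w.2

end

/-!
The product decomposition comes from two facts about the stabilizer of `p` in `H × H'`:
if `(a, b)` fixes `p`, then already `(a, 1)` fixes `p`; and the `H`-orbit and the `H'`-orbit of `p`
are orthogonal at `p`.

*From these facts to the splitting* (`isProductWithHomogeneous_of_orbit`). By the first fact
`(a, b) • p ↦ (a, 1) • p` and `(a, b) • p ↦ (1, b) • p` are well-defined maps on `M`, and they are
smooth because the orbit map of a transitive action has constant rank and is therefore a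
submersion, with smooth local sections. The second map is a smooth idempotent of constant rank, so
its fixed-point set, the `H'`-orbit of `p`, is a submanifold `N` by Cartan's linearization
(`exists_chartedSpace_fixed`). The kernel of `h` has dimension one and is tangent to the
`H`-orbit, hence `h` restricts to a Riemannian metric on `N`. The map `C × N → M` taking
`((a, 1) • p, (1, b) • p)` to `(a, b) • p` is a diffeomorphism; orthogonality of the two orbits at
`p` and homogeneity make it an isometry.

*The stabilizer.* Pull `h` back to `𝔬(1,d)` by the infinitesimal action at `p`. When the orbit is a
lightcone, the null vectors of this form are a subspace `k` of codimension `d - 1` that contains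
the isotropy algebra with codimension one and is normalized by the group `S` of the `H`-components
of the stabilizer of `p`; in particular `k` is a subalgebra. When the orbit is a circle and `d = 2`,
the isotropy algebra itself has codimension `d - 1`. A subalgebra of codimension `d - 1` contains
an infinitesimal boost, hence is a sum of root spaces, and a dimension count shows that it is the
stabilizer of a null line `ℝ u` (`exists_eq_lineStabilizer`). So every `g ∈ S` satisfies
`g u = χ u` for some `χ`.

For a lightcone, `g` acts on `𝔬(1,d) / k` as a Euclidean isometry multiplied by `χ⁻¹`, and it
preserves the positive definite form induced by `h`, so `|χ| = 1` (`abs_eigenvalue_eq_one`). The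
isotropy algebra is therefore the annihilator of `u`. For a circle it contains a boost with the
eigenvalue `χ`, so that `χ = 1` may be assumed. Since a Lorentz transformation of positive
determinant that fixes `u` is a product of exponentials of elements annihilating `u`
(`mem_expStabilizer`), the elements of `S` in the group generated by exponentials fix `p`. This
group is transitive on the orbit, which is connected, so every element of `H` can be moved into it
by an element that fixes `p` (`smul_eq_of_stabilizer`).

*Orthogonality.* A vector `q` tangent to the `H'`-orbit is fixed by the stabilizer of `p` in `H`,
because `H` and `H'` commute. Hence `X ↦ h (q, X p)` is an invariant linear functional on
`𝔬(1,d) / k`. For `d ≥ 3` the rotations fixing `u` leave no nonzero functional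
(`linear_eq_zero_of_three_le`). For `d = 2` the space is a line, and an element of `K` whose
determinant and time orientation have opposite signs provides an element of the stabilizer that
acts on it by `-1` (`linear_eq_zero_of_two`). For a circle the orbit is tangent to the kernel of
`h`, and orthogonality is immediate.

The exponential map of `H` is obtained in `exists_lieExp`: a subgroup of finite index of `O(1,d)`
contains all exponentials, since these have roots of every order. The ratio of the homothety does
not matter, because the lightcone has homotheties of every ratio and the metric of the circle is
zero.
-/

local notation "η" => minkowskiForm _

noncomputable section Algebra

variable {d : ℕ}

/-! ### The Minkowski form -/

theorem minkowskiForm_add_left (x y z : MinkowskiSpace d) : η (x + y) z = η x z + η y z := by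
  simp only [minkowskiForm, PiLp.add_apply, add_mul, Finset.sum_add_distrib]; ring

theorem minkowskiForm_smul_left (c : ℝ) (x y : MinkowskiSpace d) : η (c • x) y = c * η x y := by
  simp only [minkowskiForm, PiLp.smul_apply, smul_eq_mul, mul_add, Finset.mul_sum, mul_assoc]; ring

theorem minkowskiForm_comm (x y : MinkowskiSpace d) : η x y = η y x := by
  simp only [minkowskiForm, mul_comm]

theorem minkowskiForm_add_right (x y z : MinkowskiSpace d) : η x (y + z) = η x y + η x z := by
  rw [minkowskiForm_comm, minkowskiForm_add_left, minkowskiForm_comm y, minkowskiForm_comm z]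

theorem minkowskiForm_smul_right (c : ℝ) (x y : MinkowskiSpace d) : η x (c • y) = c * η x y := by
  rw [minkowskiForm_comm, minkowskiForm_smul_left, minkowskiForm_comm y]

theorem minkowskiForm_neg_left (x y : MinkowskiSpace d) : η (-x) y = -η x y := by
  rw [← neg_one_smul ℝ x, minkowskiForm_smul_left]; ring

theorem minkowskiForm_neg_right (x y : MinkowskiSpace d) : η x (-y) = -η x y := by
  rw [minkowskiForm_comm, minkowskiForm_neg_left, minkowskiForm_comm y]

theorem minkowskiForm_sub_left (x y z : MinkowskiSpace d) : η (x - y) z = η x z - η y z := by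
  rw [sub_eq_add_neg, minkowskiForm_add_left, minkowskiForm_neg_left]; ring

theorem minkowskiForm_sub_right (x y z : MinkowskiSpace d) : η x (y - z) = η x y - η x z := by
  rw [sub_eq_add_neg, minkowskiForm_add_right, minkowskiForm_neg_right]; ring

theorem minkowskiForm_zero_left (x : MinkowskiSpace d) : η 0 x = 0 := by
  simp [minkowskiForm]

theorem minkowskiForm_zero_right (x : MinkowskiSpace d) : η x 0 = 0 := by
  simp [minkowskiForm]

attribute [local simp] minkowskiForm_add_left minkowskiForm_smul_left minkowskiForm_add_right
  minkowskiForm_smul_right minkowskiForm_neg_left minkowskiForm_neg_right minkowskiForm_sub_left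
  minkowskiForm_sub_right minkowskiForm_zero_left minkowskiForm_zero_right

-- The module axioms for endomorphisms, restated so that rewriting with them does not have to
-- unify module instances on a space of continuous linear maps.
theorem zero_smul_endomorphism (X : MinkowskiSpace d →L[ℝ] MinkowskiSpace d) :
    (0 : ℝ) • X = 0 := by
  ext1 x; rw [smul_apply, zero_smul, zero_apply]

theorem smul_zero_endomorphism (c : ℝ) :
    c • (0 : MinkowskiSpace d →L[ℝ] MinkowskiSpace d) = 0 := by
  ext1 x; rw [smul_apply, zero_apply, smul_zero]

theorem one_smul_endomorphism (X : MinkowskiSpace d →L[ℝ] MinkowskiSpace d) :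
    (1 : ℝ) • X = X := by
  ext1 x; rw [smul_apply, one_smul]

theorem smul_smul_endomorphism (a b : ℝ) (X : MinkowskiSpace d →L[ℝ] MinkowskiSpace d) :
    a • b • X = (a * b) • X := by
  ext1 x; simp only [smul_apply, smul_smul]

theorem neg_smul_endomorphism (a : ℝ) (X : MinkowskiSpace d →L[ℝ] MinkowskiSpace d) :
    -a • X = -(a • X) := by
  ext1 x; simp only [smul_apply, neg_apply, neg_smul]

/-- The linear functional `η x`. -/
def minkowskiFunctional (x : MinkowskiSpace d) : MinkowskiSpace d →ₗ[ℝ] ℝ where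
  toFun y := η x y
  map_add' := minkowskiForm_add_right x
  map_smul' c y := minkowskiForm_smul_right c x y

@[simp]
theorem minkowskiFunctional_apply (x y : MinkowskiSpace d) :
    minkowskiFunctional x y = η x y := rfl

theorem minkowskiForm_eq_inner (x y : MinkowskiSpace d) :
    η x y = -(x 0 * y 0) + inner ℝ (LightCone.spacePart x) (LightCone.spacePart y) := by
  simp [minkowskiForm, LightCone.spacePart, PiLp.inner_apply, mul_comm]

theorem minkowskiForm_single_left (i : Fin (d + 1)) (x : MinkowskiSpace d) :
    η (EuclideanSpace.single i 1) x = (if i = 0 then -1 else 1) * x i := by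
  refine Fin.cases ?_ (fun j => ?_) i
  · simp [minkowskiForm]
  · simp [minkowskiForm, Fin.succ_ne_zero]

theorem eq_zero_of_minkowskiForm {x : MinkowskiSpace d} (h : ∀ y, η x y = 0) : x = 0 := by
  ext i
  have := h (EuclideanSpace.single i 1)
  rw [minkowskiForm_comm, minkowskiForm_single_left] at this
  split_ifs at this <;> simpa using this

theorem minkowskiForm_self_of_zero {x : MinkowskiSpace d} (h : x 0 = 0) : η x x = ‖x‖ ^ 2 := by
  rw [EuclideanSpace.real_norm_sq_eq, Fin.sum_univ_succ, h]
  simp [minkowskiForm, h, sq]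

theorem null_zero_ne_zero {u : MinkowskiSpace d} (hu : u ≠ 0) (huu : η u u = 0) : u 0 ≠ 0 := by
  intro h
  rw [minkowskiForm_self_of_zero h] at huu
  exact hu (by simpa using huu)

/-- A vector orthogonal to a null vector `u` is equivalent modulo `u` to a purely spatial one, so
that `η` is positive semidefinite on the orthogonal complement of `u`. -/
theorem minkowskiForm_self_of_orthogonal {u x : MinkowskiSpace d} (hu : u ≠ 0)
    (huu : η u u = 0) (hux : η u x = 0) : η x x = ‖x - (x 0 / u 0) • u‖ ^ 2 := by
  have h0 := null_zero_ne_zero hu huu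
  have hux' : η x u = 0 := by rw [minkowskiForm_comm]; exact hux
  rw [← minkowskiForm_self_of_zero]
  · simp [huu, hux, hux']
  · simp [h0]

theorem eq_smul_of_orthogonal_of_null {u x : MinkowskiSpace d} (hu : u ≠ 0)
    (huu : η u u = 0) (hux : η u x = 0) (hxx : η x x = 0) : x = (x 0 / u 0) • u := by
  rw [minkowskiForm_self_of_orthogonal hu huu hux] at hxx
  exact sub_eq_zero.1 (by simpa using hxx)

/-! ### The Lorentz algebra -/

/-- The infinitesimal rotation `x ∧ y` in the plane spanned by `x` and `y`. -/
def wedge (x y : MinkowskiSpace d) : MinkowskiSpace d →L[ℝ] MinkowskiSpace d :=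
  LinearMap.toContinuousLinearMap
    { toFun := fun z => η y z • x - η x z • y
      map_add' := fun z w => by simp only [minkowskiForm_add_right]; module
      map_smul' := fun c z => by
        simp only [minkowskiForm_smul_right, RingHom.id_apply]; module }

theorem wedge_apply (x y z : MinkowskiSpace d) : wedge x y z = η y z • x - η x z • y := rfl

theorem wedge_add_right (x y z : MinkowskiSpace d) :
    wedge x (y + z) = wedge x y + wedge x z := by
  ext1 w; simp only [wedge_apply, minkowskiForm_add_left, add_apply]; module

theorem wedge_smul_right (c : ℝ) (x y : MinkowskiSpace d) :
    wedge x (c • y) = c • wedge x y := by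
  ext1 w
  simp only [wedge_apply, minkowskiForm_smul_left, smul_apply]; module

theorem wedge_swap (x y : MinkowskiSpace d) : wedge x y = -wedge y x := by
  ext1 w; simp only [wedge_apply, neg_apply]; module

theorem wedge_self (x : MinkowskiSpace d) : wedge x x = 0 := by
  ext1 w; simp [wedge_apply]

theorem wedge_add_left (x y z : MinkowskiSpace d) :
    wedge (x + y) z = wedge x z + wedge y z := by
  rw [wedge_swap, wedge_add_right, wedge_swap z x, wedge_swap z y]; abel

theorem wedge_smul_left (c : ℝ) (x y : MinkowskiSpace d) :
    wedge (c • x) y = c • wedge x y := by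
  rw [wedge_swap, wedge_smul_right, wedge_swap y x]; simp

/-- The Lie algebra `𝔬(1,d)`: endomorphisms that are antisymmetric for the Minkowski form. -/
def lorentzAlgebra (d : ℕ) : Submodule ℝ (MinkowskiSpace d →L[ℝ] MinkowskiSpace d) where
  carrier := {X | ∀ x y, η (X x) y + η x (X y) = 0}
  add_mem' {X Y} hX hY x y := by
    have h1 := hX x y
    have h2 := hY x y
    simp only [add_apply, minkowskiForm_add_left, minkowskiForm_add_right]
    linarith
  zero_mem' x y := by simp
  smul_mem' c X hX x y := by
    have h1 := hX x y
    simp only [smul_apply, minkowskiForm_smul_left, minkowskiForm_smul_right]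
    linear_combination c * h1

theorem lorentzAlgebra_apply_left {X : MinkowskiSpace d →L[ℝ] MinkowskiSpace d}
    (hX : X ∈ lorentzAlgebra d) (x y : MinkowskiSpace d) : η (X x) y = -η x (X y) := by
  linarith [hX x y]

theorem lorentzAlgebra_apply_self {X : MinkowskiSpace d →L[ℝ] MinkowskiSpace d}
    (hX : X ∈ lorentzAlgebra d) (x : MinkowskiSpace d) : η x (X x) = 0 := by
  have := hX x x
  rw [minkowskiForm_comm] at this
  linarith

theorem wedge_mem (x y : MinkowskiSpace d) : wedge x y ∈ lorentzAlgebra d := fun z w => by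
  simp only [wedge_apply, minkowskiForm_sub_left, minkowskiForm_smul_left, minkowskiForm_comm z]
  ring

theorem commutator_wedge {X : MinkowskiSpace d →L[ℝ] MinkowskiSpace d}
    (hX : X ∈ lorentzAlgebra d) (x y : MinkowskiSpace d) :
    X * wedge x y - wedge x y * X = wedge (X x) y + wedge x (X y) := by
  ext1 z
  simp only [sub_apply, mul_apply_eq_comp,
    add_apply, wedge_apply, map_sub, map_smul,
    lorentzAlgebra_apply_left hX]
  module

theorem conj_wedge {g : MinkowskiSpace d ≃L[ℝ] MinkowskiSpace d} (hg : g ∈ lorentzGroup d)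
    (x y z : MinkowskiSpace d) : g (wedge x y (g.symm z)) = wedge (g x) (g y) z := by
  have h : ∀ w, η w (g.symm z) = η (g w) z := fun w => by
    rw [← hg w (g.symm z), ContinuousLinearEquiv.apply_symm_apply]
  simp only [wedge_apply, map_sub, map_smul, h]

theorem eq_sum_minkowskiForm (x : MinkowskiSpace d) :
    x = ∑ i, ((if i = 0 then -1 else 1) * η (EuclideanSpace.single i 1) x) •
      (EuclideanSpace.single i 1 : MinkowskiSpace d) := by
  ext j
  simp only [minkowskiForm_single_left, WithLp.ofLp_sum, WithLp.ofLp_smul,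
    Finset.sum_apply, Pi.smul_apply]
  rw [Finset.sum_eq_single j]
  · simp; split_ifs <;> simp
  · intro i _ hij; simp [hij.symm]
  · simp

theorem lorentzAlgebra_eq_sum_wedge {X : MinkowskiSpace d →L[ℝ] MinkowskiSpace d}
    (hX : X ∈ lorentzAlgebra d) :
    X = (2⁻¹ : ℝ) • ∑ i, (if i = 0 then (-1 : ℝ) else 1) •
      wedge (X (EuclideanSpace.single i 1)) (EuclideanSpace.single i 1) := by
  ext1 z
  have h1 : ∑ i, (if i = 0 then (-1 : ℝ) else 1) •
      wedge (X (EuclideanSpace.single i 1)) (EuclideanSpace.single i 1) z = X z + X z := by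
    conv_rhs => rw [eq_sum_minkowskiForm (X z)]
    conv_rhs => enter [1]; rw [← eq_sum_minkowskiForm (X z), eq_sum_minkowskiForm z, map_sum]
    rw [← Finset.sum_add_distrib]
    refine Finset.sum_congr rfl fun i _ => ?_
    rw [wedge_apply, lorentzAlgebra_apply_left hX, map_smul]
    module
  simp only [smul_apply, sum_apply, h1]
  module

theorem lorentzAlgebra_le_of_wedge_mem
    {W : Submodule ℝ (MinkowskiSpace d →L[ℝ] MinkowskiSpace d)} (h : ∀ x y, wedge x y ∈ W) :
    lorentzAlgebra d ≤ W := fun X hX => by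
  rw [lorentzAlgebra_eq_sum_wedge hX]
  exact W.smul_mem _ (W.sum_mem fun i _ => W.smul_mem _ (h _ _))

attribute [local simp] zero_smul_endomorphism smul_zero_endomorphism one_smul_endomorphism
  smul_smul_endomorphism neg_smul_endomorphism

/-! ### Null pairs -/

/-- Two null vectors with product one; they span a Lorentzian plane. -/
structure IsNullPair (u v : MinkowskiSpace d) : Prop where
  left : η u u = 0
  right : η v v = 0
  prod : η u v = 1

namespace IsNullPair

variable {u v : MinkowskiSpace d}

theorem symm (h : IsNullPair u v) : IsNullPair v u :=
  ⟨h.right, h.left, by rw [minkowskiForm_comm, h.prod]⟩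

theorem prod' (h : IsNullPair u v) : η v u = 1 := h.symm.prod

theorem ne_zero (h : IsNullPair u v) : u ≠ 0 := by
  rintro rfl
  have := h.prod
  simp at this

theorem exists_right {u : MinkowskiSpace d} (hu : u ≠ 0) (huu : η u u = 0) :
    ∃ v, IsNullPair u v := by
  obtain ⟨x, hx⟩ : ∃ x, η u x ≠ 0 := by
    by_contra! h
    exact hu (eq_zero_of_minkowskiForm h)
  refine ⟨(η u x)⁻¹ • (x - (η x x / (2 * η u x)) • u), huu, ?_, ?_⟩
  · simp only [minkowskiForm_smul_left, minkowskiForm_smul_right, minkowskiForm_sub_left,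
      minkowskiForm_sub_right, huu, minkowskiForm_comm x u]
    field_simp
    ring
  · simp [huu, hx]

theorem exists_pair (hd : 2 ≤ d) : ∃ u v : MinkowskiSpace d, IsNullPair u v := by
  obtain ⟨n, rfl⟩ : ∃ n, d = n + 1 := ⟨d - 1, by omega⟩
  let u : MinkowskiSpace (n + 1) := EuclideanSpace.single 0 1 + EuclideanSpace.single 1 1
  have huu : η u u = 0 := by
    have h1 : ∀ i : Fin n, i.succ.succ ≠ 1 := fun i h => Fin.succ_ne_zero i (Fin.succ_inj.1 h)
    cases n with
    | zero => omega
    | succ n => simp [u, minkowskiForm, Fin.sum_univ_succ, Fin.succ_ne_zero, h1]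
  have hu : u ≠ 0 := fun h => by
    have := congrArg (fun x : MinkowskiSpace (n + 1) => x 0) h
    simp [u] at this
  exact ⟨u, exists_right hu huu⟩

/-- The space `{u, v}^⊥`. -/
def perp (u v : MinkowskiSpace d) : Submodule ℝ (MinkowskiSpace d) :=
  LinearMap.ker ((minkowskiFunctional u).prod (minkowskiFunctional v))

theorem mem_perp {u v w : MinkowskiSpace d} : w ∈ perp u v ↔ η u w = 0 ∧ η v w = 0 := by
  simp [perp]

theorem finrank_perp (h : IsNullPair u v) : Module.finrank ℝ (perp u v) + 1 = d := by
  have h1 := LinearMap.finrank_range_add_finrank_ker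
    ((minkowskiFunctional u).prod (minkowskiFunctional v))
  have h2 : LinearMap.range ((minkowskiFunctional u).prod (minkowskiFunctional v)) = ⊤ := by
    rw [LinearMap.range_eq_top]
    rintro ⟨a, b⟩
    exact ⟨a • v + b • u, by simp [h.left, h.right, h.prod, h.prod']⟩
  rw [h2, finrank_top] at h1
  simp only [Module.finrank_prod, Module.finrank_self, finrank_euclideanSpace,
    Fintype.card_fin] at h1
  unfold perp
  omega

theorem perp_decomp (h : IsNullPair u v) (x : MinkowskiSpace d) :
    x - η v x • u - η u x • v ∈ perp u v := by
  rw [mem_perp]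
  simp [h.left, h.right, h.prod, h.prod']

theorem self_pos (h : IsNullPair u v) {w : MinkowskiSpace d} (hw : w ∈ perp u v) (hw0 : w ≠ 0) :
    0 < η w w := by
  rw [mem_perp] at hw
  have h1 := minkowskiForm_self_of_orthogonal h.ne_zero h.left hw.1
  rw [h1]
  have : w - (w 0 / u 0) • u ≠ 0 := fun h2 => by
    have h3 := hw.2
    rw [sub_eq_zero] at h2
    rw [h2, minkowskiForm_smul_right, h.prod', mul_one] at h3
    rw [h3] at h2
    exact hw0 (by simpa using h2)
  positivity

end IsNullPair

/-- The isotropy algebra of the line spanned by `u`. -/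
def lineStabilizer (u : MinkowskiSpace d) :
    Submodule ℝ (MinkowskiSpace d →L[ℝ] MinkowskiSpace d) :=
  lorentzAlgebra d ⊓
    (Submodule.span ℝ {u}).comap (LinearMap.applyₗ u ∘ₗ ContinuousLinearMap.coeLM ℝ)

theorem mem_lineStabilizer {u : MinkowskiSpace d} {X : MinkowskiSpace d →L[ℝ] MinkowskiSpace d} :
    X ∈ lineStabilizer u ↔ X ∈ lorentzAlgebra d ∧ ∃ a : ℝ, X u = a • u := by
  simp [lineStabilizer, Submodule.mem_span_singleton, eq_comm]

/-- A subspace that is the injective image of a linear map and meets `W` trivially has dimension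
at most the codimension of `W`. -/
theorem finrank_add_le_of_disjoint {A F : Type*} [AddCommGroup A] [Module ℝ A]
    [FiniteDimensional ℝ A] [AddCommGroup F] [Module ℝ F] [FiniteDimensional ℝ F]
    {W L : Submodule ℝ A} (hWL : W ≤ L)
    (f : F →ₗ[ℝ] A) (hfL : ∀ z, f z ∈ L) (hf : ∀ z, f z ∈ W → z = 0) :
    Module.finrank ℝ W + Module.finrank ℝ F ≤ Module.finrank ℝ L := by
  have h1 := Submodule.finrank_sup_add_finrank_inf_eq W (LinearMap.range f)
  have h2 : W ⊓ LinearMap.range f = ⊥ := by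
    rw [eq_bot_iff]
    rintro _ ⟨hw, z, rfl⟩
    rw [hf z hw]; simp
  have h3 : Module.finrank ℝ (LinearMap.range f) = Module.finrank ℝ F := by
    apply LinearMap.finrank_range_of_inj
    rw [injective_iff_map_eq_zero]
    exact fun z hz => hf z (by rw [hz]; exact W.zero_mem)
  rw [h2, finrank_bot, h3] at h1
  have h4 : W ⊔ LinearMap.range f ≤ L := sup_le hWL (by rintro _ ⟨z, rfl⟩; exact hfL z)
  have := Submodule.finrank_mono h4
  omega

/-! ### Subalgebras of the Lorentz algebra of codimension `d - 1` -/

/-- The map `y ↦ x ∧ y`. -/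
def wedgeRight (x : MinkowskiSpace d) :
    MinkowskiSpace d →ₗ[ℝ] MinkowskiSpace d →L[ℝ] MinkowskiSpace d where
  toFun := wedge x
  map_add' := wedge_add_right x
  map_smul' c y := wedge_smul_right c x y

@[simp]
theorem wedgeRight_apply (x y : MinkowskiSpace d) : wedgeRight x y = wedge x y := rfl

section Subalgebra

variable {k : Submodule ℝ (MinkowskiSpace d →L[ℝ] MinkowskiSpace d)}

/-- A subalgebra of codimension less than `d` meets every `d`-dimensional space
`{u ∧ x}`, where `u` is null. -/
theorem exists_wedge_mem (hk : k ≤ lorentzAlgebra d)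
    (hdim : Module.finrank ℝ (lorentzAlgebra d) < Module.finrank ℝ k + d)
    {u : MinkowskiSpace d} (hu : u ≠ 0) (huu : η u u = 0) :
    ∃ x, wedge u x ∈ k ∧ ∀ c : ℝ, x ≠ c • u := by
  by_contra! h
  let F : Submodule ℝ (MinkowskiSpace d) :=
    LinearMap.ker (minkowskiFunctional (EuclideanSpace.single 0 1))
  have h0 := null_zero_ne_zero hu huu
  have hF : ∀ x ∈ F, x 0 = 0 := fun x hx => by
    have : η (EuclideanSpace.single 0 1) x = 0 := hx
    rw [minkowskiForm_single_left] at this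
    simpa using this
  have h1 := finrank_add_le_of_disjoint hk (wedgeRight u ∘ₗ F.subtype)
    (fun z => wedge_mem _ _) (fun z hz => by
      obtain ⟨c, hc⟩ := h z hz
      have h2 := hF z z.2
      rw [hc] at h2
      have : c = 0 := by simpa [h0] using h2
      ext1
      rw [hc, this]; simp)
  have h2 := LinearMap.finrank_range_add_finrank_ker
    (minkowskiFunctional (EuclideanSpace.single (0 : Fin (d + 1)) 1))
  have h3 := (LinearMap.range
    (minkowskiFunctional (EuclideanSpace.single (0 : Fin (d + 1)) 1))).finrank_le
  simp only [Module.finrank_self, finrank_euclideanSpace, Fintype.card_fin] at h2 h3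
  change Module.finrank ℝ k + Module.finrank ℝ F ≤ _ at h1
  change _ + Module.finrank ℝ F = _ at h2
  omega

/-- If a subalgebra contains `u ∧ x` and `v ∧ y`, where `u`, `v` is a null pair and `x ≠ 0` and `y`
are orthogonal to it, then it contains `u ∧ y`: this is, up to a multiple of `u ∧ x`, the bracket
`[[u ∧ x, v ∧ y], u ∧ x]`. -/
theorem wedge_left_mem (hbr : ∀ X ∈ k, ∀ Y ∈ k, X * Y - Y * X ∈ k)
    {u v x y : MinkowskiSpace d} (h : IsNullPair u v)
    (hx : x ∈ IsNullPair.perp u v) (hy : y ∈ IsNullPair.perp u v)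
    (hx0 : x ≠ 0) (hux : wedge u x ∈ k) (hvy : wedge v y ∈ k) : wedge u y ∈ k := by
  have hpos := h.self_pos hx hx0
  rw [IsNullPair.mem_perp] at hx hy
  have h1 := hbr _ hux _ hvy
  rw [commutator_wedge (wedge_mem _ _)] at h1
  have h2 := hbr _ h1 _ hux
  rw [commutator_wedge (Submodule.add_mem _ (wedge_mem _ _) (wedge_mem _ _))] at h2
  have h3 : wedge ((wedge (wedge u x v) y + wedge v (wedge u x y)) u) x +
      wedge u ((wedge (wedge u x v) y + wedge v (wedge u x y)) x) =
      η x x • wedge u y - (2 * η x y) • wedge u x := by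
    simp only [wedge_apply, add_apply, minkowskiForm_comm x v,
      minkowskiForm_comm x u, minkowskiForm_comm y u, minkowskiForm_comm y x,
      hx.1, hx.2, hy.1, h.left, h.prod, h.prod', minkowskiForm_sub_left,
      minkowskiForm_smul_left]
    simp only [sub_eq_add_neg, wedge_add_left, wedge_add_right, wedge_smul_left,
      wedge_smul_right, ← neg_smul, wedge_self]
    simp
    module
  rw [h3] at h2
  have h4 : wedge u y = (η x x)⁻¹ • ((η x x • wedge u y - (2 * η x y) • wedge u x) +
      (2 * η x y) • wedge u x) := by
    rw [sub_add_cancel, smul_smul_endomorphism, inv_mul_cancel₀ hpos.ne', one_smul_endomorphism]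
  rw [h4]
  exact k.smul_mem _ (k.add_mem h2 (k.smul_mem _ hux))

theorem commutator_opposite {u v x y : MinkowskiSpace d} (h : IsNullPair u v)
    (hx : x ∈ IsNullPair.perp u v) (hy : y ∈ IsNullPair.perp u v) :
    wedge u x * wedge v y - wedge v y * wedge u x = -wedge x y - η x y • wedge u v := by
  rw [IsNullPair.mem_perp] at hx hy
  rw [commutator_wedge (wedge_mem _ _)]
  simp only [wedge_apply, minkowskiForm_comm x v, hx.2, hy.1, h.prod]
  simp only [sub_eq_add_neg, wedge_add_left, wedge_add_right, wedge_smul_left,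
      wedge_smul_right, ← neg_smul, wedge_swap v u]
  simp

/-- A subalgebra of codimension less than `d` contains an infinitesimal boost. -/
theorem exists_boost_mem (hd : 2 ≤ d) (hk : k ≤ lorentzAlgebra d)
    (hbr : ∀ X ∈ k, ∀ Y ∈ k, X * Y - Y * X ∈ k)
    (hdim : Module.finrank ℝ (lorentzAlgebra d) < Module.finrank ℝ k + d) :
    ∃ u v : MinkowskiSpace d, IsNullPair u v ∧ wedge u v ∈ k := by
  -- either some `u ∧ x` with `u` null is a multiple of a boost, or it is an infinitesimal
  -- parabolic motion
  have key : ∀ u v : MinkowskiSpace d, IsNullPair u v →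
      (∃ v, IsNullPair u v ∧ wedge u v ∈ k) ∨
        ∃ x ∈ IsNullPair.perp u v, x ≠ 0 ∧ wedge u x ∈ k := by
    intro u v h
    obtain ⟨x, hx, hxu⟩ := exists_wedge_mem hk hdim h.ne_zero h.left
    by_cases hux : η u x = 0
    · right
      refine ⟨x - η v x • u, ?_, sub_ne_zero.2 (hxu _), ?_⟩
      · simpa [hux] using h.perp_decomp x
      · rw [sub_eq_add_neg, wedge_add_right, ← neg_smul, wedge_smul_right, wedge_self]
        simpa using hx
    · left
      refine ⟨(η u x)⁻¹ • (x - (η x x / (2 * η u x)) • u), ⟨h.left, ?_, ?_⟩, ?_⟩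
      · simp only [minkowskiForm_smul_left, minkowskiForm_smul_right, minkowskiForm_sub_left,
          minkowskiForm_sub_right, h.left, minkowskiForm_comm x u]
        field_simp
        ring
      · simp [h.left, hux]
      · rw [wedge_smul_right, sub_eq_add_neg, wedge_add_right, ← neg_smul, wedge_smul_right,
          wedge_self]
        simpa using k.smul_mem _ hx
  obtain ⟨u, v, h⟩ := IsNullPair.exists_pair hd
  rcases key u v h with ⟨w, hw⟩ | ⟨x, hx, hx0, hux⟩
  · exact ⟨u, w, hw⟩
  rcases key v u h.symm with ⟨w, hw⟩ | ⟨y, hy, hy0, hvy⟩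
  · exact ⟨v, w, hw⟩
  have hy' : y ∈ IsNullPair.perp u v := by
    rw [IsNullPair.mem_perp] at hy ⊢; exact hy.symm
  have huy := wedge_left_mem hbr h hx hy' hx0 hux hvy
  have h1 := hbr _ huy _ hvy
  rw [commutator_opposite h hy' hy', wedge_self] at h1
  refine ⟨u, v, h, ?_⟩
  have hpos := h.self_pos hy' hy0
  have h2 : wedge u v = (-(η y y)⁻¹) • (-0 - η y y • wedge u v) := by
    rw [neg_zero, zero_sub, neg_smul_endomorphism, smul_neg, neg_neg, smul_smul_endomorphism,
        inv_mul_cancel₀ hpos.ne',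
      one_smul_endomorphism]
  rw [h2]
  exact k.smul_mem _ h1

/-- The root space components of an element of a subalgebra containing the boost `u ∧ v`. -/
theorem root_components_mem (hk : k ≤ lorentzAlgebra d)
    (hbr : ∀ X ∈ k, ∀ Y ∈ k, X * Y - Y * X ∈ k) {u v : MinkowskiSpace d}
    (h : IsNullPair u v) (huv : wedge u v ∈ k)
    {X : MinkowskiSpace d →L[ℝ] MinkowskiSpace d} (hX : X ∈ k) :
    wedge u (-(η v (X u) • v) - X v) ∈ k ∧ wedge v (η v (X u) • u - X u) ∈ k := by
  obtain ⟨α, hα⟩ : ∃ α, η v (X u) = α := ⟨_, rfl⟩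
  rw [hα]
  set a := -(α • v) - X v with ha
  set b := α • u - X u with hb
  have hX' := hk hX
  have hXv : η u (X v) = -α := by
    rw [minkowskiForm_comm, lorentzAlgebra_apply_left hX', hα]
  have ha' : η u a = 0 ∧ η v a = 0 := by
    constructor
    · simp [ha, h.prod, hXv]
    · simp [ha, h.right, lorentzAlgebra_apply_self hX']
  have hb' : η u b = 0 ∧ η v b = 0 := by
    constructor
    · simp [hb, h.left, lorentzAlgebra_apply_self hX']
    · simp [hb, h.prod', hα]
  have hXu : X u = α • u - b := by rw [hb]; module
  have hXv' : X v = -(α • v) - a := by rw [ha]; module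
  have h1 : wedge u v * X - X * wedge u v = wedge u a - wedge v b := by
    rw [← neg_sub, commutator_wedge hX', hXv', hXu]
    simp only [sub_eq_add_neg, wedge_add_left, wedge_add_right, wedge_smul_left,
      wedge_smul_right, ← neg_smul, ← neg_one_smul ℝ a, ← neg_one_smul ℝ b, wedge_swap v b]
    module
  have h2 := hbr _ huv _ hX
  rw [h1] at h2
  have h3 := hbr _ huv _ h2
  have h4 : wedge u v * (wedge u a - wedge v b) - (wedge u a - wedge v b) * wedge u v =
      wedge u a + wedge v b := by
    rw [mul_sub, sub_mul, sub_sub_sub_comm, commutator_wedge (wedge_mem _ _),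
      commutator_wedge (wedge_mem _ _)]
    simp only [wedge_apply u v, ha'.1, ha'.2, hb'.1, hb'.2, h.left, h.right, h.prod, h.prod']
    simp only [sub_eq_add_neg, wedge_add_left, wedge_add_right, wedge_smul_left,
      wedge_smul_right, ← neg_smul]
    simp
  rw [h4] at h3
  constructor
  · have : wedge u a = (2⁻¹ : ℝ) • ((wedge u a - wedge v b) + (wedge u a + wedge v b)) := by
      module
    rw [this]; exact k.smul_mem _ (k.add_mem h2 h3)
  · have : wedge v b = (2⁻¹ : ℝ) • ((wedge u a + wedge v b) - (wedge u a - wedge v b)) := by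
      module
    rw [this]; exact k.smul_mem _ (k.sub_mem h3 h2)

end Subalgebra

theorem finrank_lineStabilizer_add_le {u v : MinkowskiSpace d} (h : IsNullPair u v) :
    Module.finrank ℝ (lineStabilizer u) + d ≤ Module.finrank ℝ (lorentzAlgebra d) + 1 := by
  have h1 := finrank_add_le_of_disjoint (W := lineStabilizer u) (L := lorentzAlgebra d)
    inf_le_left (wedgeRight v ∘ₗ (IsNullPair.perp u v).subtype) (fun z => wedge_mem _ _)
    (fun z hz => by
      obtain ⟨c, hc⟩ := (mem_lineStabilizer.1 hz).2
      have hz' := IsNullPair.mem_perp.1 z.2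
      have h2 : -(z : MinkowskiSpace d) = c • u := by
        rw [← hc]
        simp [wedge_apply, h.prod', minkowskiForm_comm (z : MinkowskiSpace d) u, hz'.1]
      have h3 : c = 0 := by
        have := congrArg (fun x => η v x) h2
        simpa [hz'.2, h.prod'] using this.symm
      ext1
      rw [h3, zero_smul, neg_eq_zero] at h2
      simpa using h2)
  have h2 := h.finrank_perp
  omega

section Subalgebra

variable {k : Submodule ℝ (MinkowskiSpace d →L[ℝ] MinkowskiSpace d)}

/-- If the root space `v ∧ {u, v}^⊥` of the boost `u ∧ v` does not meet the subalgebra, every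
element
of the subalgebra preserves the line of `u`, and equality follows by counting dimensions. -/
theorem eq_lineStabilizer_of_root_eq_zero (hk : k ≤ lorentzAlgebra d)
    (hbr : ∀ X ∈ k, ∀ Y ∈ k, X * Y - Y * X ∈ k)
    (hdim : Module.finrank ℝ k + d = Module.finrank ℝ (lorentzAlgebra d) + 1)
    {u v : MinkowskiSpace d} (h : IsNullPair u v) (huv : wedge u v ∈ k)
    (hv : ∀ b ∈ IsNullPair.perp u v, wedge v b ∈ k → b = 0) : k = lineStabilizer u := by
  refine Submodule.eq_of_le_of_finrank_le (fun X hX => ?_) ?_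
  · refine mem_lineStabilizer.2 ⟨hk hX, η v (X u), ?_⟩
    have h1 := (root_components_mem hk hbr h huv hX).2
    have h2 := hv _ (IsNullPair.mem_perp.2 ⟨?_, ?_⟩) h1
    · exact (sub_eq_zero.1 h2).symm
    · simp [h.left, lorentzAlgebra_apply_self (hk hX)]
    · simp [h.prod']
  · have := finrank_lineStabilizer_add_le h
    omega

/-- If both root spaces of the boost `u ∧ v` meet the subalgebra, its codimension is wrong. -/
theorem roots_not_both_ne_zero (hd : 2 ≤ d) (hk : k ≤ lorentzAlgebra d)
    (hbr : ∀ X ∈ k, ∀ Y ∈ k, X * Y - Y * X ∈ k)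
    (hdim : Module.finrank ℝ k + d = Module.finrank ℝ (lorentzAlgebra d) + 1)
    {u v : MinkowskiSpace d} (h : IsNullPair u v) (huv : wedge u v ∈ k)
    {a b : MinkowskiSpace d} (ha : a ∈ IsNullPair.perp u v) (ha0 : a ≠ 0) (hua : wedge u a ∈ k)
    (hb : b ∈ IsNullPair.perp u v) (hb0 : b ≠ 0) (hvb : wedge v b ∈ k) : False := by
  have hswap : ∀ {w}, w ∈ IsNullPair.perp u v → w ∈ IsNullPair.perp v u := fun hw => by
    rw [IsNullPair.mem_perp] at hw ⊢; exact hw.symm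
  -- the two root spaces correspond to the same subspace `U` of `{u, v}^⊥`
  have hvu : ∀ w ∈ IsNullPair.perp u v, wedge v w ∈ k → wedge u w ∈ k := fun w hw hvw =>
    wedge_left_mem hbr h ha hw ha0 hua hvw
  have huv' : ∀ w ∈ IsNullPair.perp u v, wedge u w ∈ k → wedge v w ∈ k := fun w hw huw =>
    wedge_left_mem hbr h.symm (hswap hb) (hswap hw) hb0 hvb huw
  have hww : ∀ x ∈ IsNullPair.perp u v, ∀ y ∈ IsNullPair.perp u v, wedge u x ∈ k →
      wedge u y ∈ k → wedge x y ∈ k := fun x hx y hy hux huy => by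
    have h1 := hbr _ hux _ (huv' y hy huy)
    rw [commutator_opposite h hx hy] at h1
    have h2 : wedge x y = -((-wedge x y - η x y • wedge u v) + η x y • wedge u v) := by abel
    rw [h2]
    exact k.neg_mem (k.add_mem h1 (k.smul_mem _ huv))
  let U : Submodule ℝ (MinkowskiSpace d) := IsNullPair.perp u v ⊓ k.comap (wedgeRight u)
  have hU : ∀ w, w ∈ U ↔ w ∈ IsNullPair.perp u v ∧ wedge u w ∈ k := fun w => Iff.rfl
  by_cases hUtop : U = IsNullPair.perp u v
  · -- then `k` is the whole algebra
    have hmem : ∀ w ∈ IsNullPair.perp u v, wedge u w ∈ k := fun w hw =>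
      ((hU w).1 (hUtop ▸ hw)).2
    have hall : lorentzAlgebra d ≤ k := by
      refine lorentzAlgebra_le_of_wedge_mem fun x y => ?_
      obtain ⟨x', hx', hx⟩ : ∃ x' ∈ IsNullPair.perp u v, x = x' + (η v x • u + η u x • v) :=
        ⟨_, h.perp_decomp x, by abel⟩
      obtain ⟨y', hy', hy⟩ : ∃ y' ∈ IsNullPair.perp u v, y = y' + (η v y • u + η u y • v) :=
        ⟨_, h.perp_decomp y, by abel⟩
      have h1 : wedge x y = wedge x' y' + (-(η v y)) • wedge u x' + (-(η u y)) • wedge v x' +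
          η v x • wedge u y' + η u x • wedge v y' +
          (η v x * η u y - η u x * η v y) • wedge u v := by
        obtain ⟨p, hp⟩ : ∃ p, η v x = p := ⟨_, rfl⟩
        obtain ⟨q, hq⟩ : ∃ q, η u x = q := ⟨_, rfl⟩
        obtain ⟨r, hr⟩ : ∃ r, η v y = r := ⟨_, rfl⟩
        obtain ⟨s, hs⟩ : ∃ s, η u y = s := ⟨_, rfl⟩
        simp only [hp, hq, hr, hs] at hx hy ⊢
        rw [hx, hy]
        simp only [wedge_add_left, wedge_add_right, wedge_smul_left, wedge_smul_right,
          wedge_self, wedge_swap x' u, wedge_swap x' v, wedge_swap v u]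
        simp
        module
      rw [h1]
      refine k.add_mem (k.add_mem (k.add_mem (k.add_mem (k.add_mem ?_ ?_) ?_) ?_) ?_) ?_
      · exact hww _ hx' _ hy' (hmem _ hx') (hmem _ hy')
      all_goals apply k.smul_mem
      · exact hmem _ hx'
      · exact huv' _ hx' (hmem _ hx')
      · exact hmem _ hy'
      · exact huv' _ hy' (hmem _ hy')
      · exact huv
    have := Submodule.finrank_mono hall
    omega
  · -- otherwise a space of dimension `d` meets `k` trivially
    obtain ⟨c₀, hc₀, hc₀U⟩ : ∃ c ∈ IsNullPair.perp u v, c ∉ U := by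
      by_contra! hcon
      exact hUtop (le_antisymm inf_le_left hcon)
    have hc₀' := IsNullPair.mem_perp.1 hc₀
    obtain ⟨C, hC⟩ := Submodule.exists_isCompl U
    have hdimC : Module.finrank ℝ (C ⊓ IsNullPair.perp u v : Submodule ℝ _) +
        Module.finrank ℝ U + 1 = d := by
      have h1 : U ⊔ (C ⊓ IsNullPair.perp u v) = IsNullPair.perp u v := by
        rw [← sup_inf_assoc_of_le C (show U ≤ IsNullPair.perp u v from inf_le_left), hC.sup_eq_top,
            top_inf_eq]
      have h2 : U ⊓ (C ⊓ IsNullPair.perp u v) = ⊥ := by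
        rw [← inf_assoc, hC.inf_eq_bot, bot_inf_eq]
      have h3 := Submodule.finrank_sup_add_finrank_inf_eq U (C ⊓ IsNullPair.perp u v)
      rw [h1, h2, finrank_bot] at h3
      have := h.finrank_perp
      omega
    let f : (C ⊓ IsNullPair.perp u v : Submodule ℝ _) × ℝ × U →ₗ[ℝ]
        MinkowskiSpace d →L[ℝ] MinkowskiSpace d :=
      (wedgeRight u ∘ₗ Submodule.subtype _).coprod
        ((LinearMap.toSpanSingleton ℝ _ (wedge v c₀)).coprod
          (-(wedgeRight c₀ ∘ₗ U.subtype)))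
    have hf : ∀ z, f z = wedge u z.1 + (z.2.1 • wedge v c₀ + wedge z.2.2 c₀) := fun z => by
      simp [f, wedge_swap _ c₀]
    have h1 := finrank_add_le_of_disjoint hk f (fun z => by
      rw [hf]
      exact Submodule.add_mem _ (wedge_mem _ _)
        (Submodule.add_mem _ (Submodule.smul_mem _ _ (wedge_mem _ _)) (wedge_mem _ _)))
      (fun z hz => by
        obtain ⟨⟨c, hc⟩, t, ⟨x, hx⟩⟩ := z
        have hxp := IsNullPair.mem_perp.1 hx.1
        have hcp := IsNullPair.mem_perp.1 hc.2
        rw [hf] at hz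
        simp only at hz
        have hXu : (wedge u c + (t • wedge v c₀ + wedge x c₀)) u = -(t • c₀) := by
          simp [wedge_apply, h.left, h.prod', minkowskiForm_comm _ u, hcp.1, hc₀'.1, hxp.1]
        have hXv : (wedge u c + (t • wedge v c₀ + wedge x c₀)) v = -c := by
          simp [wedge_apply, h.right, h.prod', minkowskiForm_comm _ v, hcp.2, hc₀'.2, hxp.2]
        have hroot := root_components_mem hk hbr h huv hz
        rw [hXu, hXv] at hroot
        simp only [minkowskiForm_neg_right, minkowskiForm_smul_right, hc₀'.2, mul_zero, neg_zero,
          zero_smul, zero_sub, neg_neg] at hroot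
        have hc0 : c = 0 := by
          have : c ∈ U ⊓ C := ⟨⟨hc.2, hroot.1⟩, hc.1⟩
          rwa [hC.inf_eq_bot, Submodule.mem_bot] at this
        have ht0 : t = 0 := by
          by_contra ht
          refine hc₀U ((hU _).2 ⟨hc₀, ?_⟩)
          have h2 := k.smul_mem t⁻¹ hroot.2
          rw [wedge_smul_right, smul_smul_endomorphism, inv_mul_cancel₀ ht,
            one_smul_endomorphism] at h2
          exact hvu _ hc₀ h2
        subst hc0 ht0
        have hx0 : x = 0 := by
          by_contra hx0
          have hxc : wedge x c₀ ∈ k := by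
            have h2 : wedge u (0 : MinkowskiSpace d) = 0 := by
              have := wedge_smul_right 0 u (0 : MinkowskiSpace d); simpa using this
            simpa [h2] using hz
          have h2 := hbr _ hxc _ ((hU _).1 hx).2
          have h3 : wedge x c₀ * wedge u x - wedge u x * wedge x c₀ =
              η c₀ x • wedge u x - η x x • wedge u c₀ := by
            rw [commutator_wedge (wedge_mem _ _)]
            simp only [wedge_apply, minkowskiForm_comm _ u, hxp.1, hc₀'.1]
            simp only [sub_eq_add_neg, wedge_add_left, wedge_add_right, wedge_smul_left,
              wedge_smul_right, ← neg_smul]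
            simp
          rw [h3] at h2
          have h4 := k.sub_mem (k.smul_mem (η c₀ x) ((hU _).1 hx).2) h2
          rw [sub_sub_cancel] at h4
          have h5 := k.smul_mem (η x x)⁻¹ h4
          rw [smul_smul_endomorphism, inv_mul_cancel₀ (h.self_pos hx.1 hx0).ne',
            one_smul_endomorphism] at h5
          exact hc₀U ((hU _).2 ⟨hc₀, h5⟩)
        subst hx0
        rfl)
    simp only [Module.finrank_prod, Module.finrank_self] at h1
    omega

/-- A subalgebra of `𝔬(1,d)` of codimension `d - 1` is the stabilizer of a null line. -/
theorem exists_eq_lineStabilizer (hd : 2 ≤ d) (hk : k ≤ lorentzAlgebra d)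
    (hbr : ∀ X ∈ k, ∀ Y ∈ k, X * Y - Y * X ∈ k)
    (hdim : Module.finrank ℝ k + d = Module.finrank ℝ (lorentzAlgebra d) + 1) :
    ∃ u : MinkowskiSpace d, u ≠ 0 ∧ η u u = 0 ∧ k = lineStabilizer u := by
  obtain ⟨u, v, h, huv⟩ := exists_boost_mem hd hk hbr (by omega)
  by_cases hv : ∀ b ∈ IsNullPair.perp u v, wedge v b ∈ k → b = 0
  · exact ⟨u, h.ne_zero, h.left, eq_lineStabilizer_of_root_eq_zero hk hbr hdim h huv hv⟩
  · push Not at hv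
    obtain ⟨b, hb, hvb, hb0⟩ := hv
    refine ⟨v, h.symm.ne_zero, h.right, eq_lineStabilizer_of_root_eq_zero hk hbr hdim h.symm
      (by rw [wedge_swap]; exact k.neg_mem huv) fun a ha hua => ?_⟩
    by_contra ha0
    refine roots_not_both_ne_zero hd hk hbr hdim h huv ?_ ha0 hua hb hb0 hvb
    rw [IsNullPair.mem_perp] at ha ⊢
    exact ha.symm

end Subalgebra

/-! ### Exponentials in the Lorentz group -/

/-- The exponential is characterized by its differential equation. -/
theorem exp_smul_eq_of_hasDerivAt {A : Type*} [NormedRing A] [NormedAlgebra ℝ A]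
    [CompleteSpace A] (J : A) (Y : ℝ → A) (hY : ∀ t, HasDerivAt Y (J * Y t) t) (h0 : Y 0 = 1)
    (t : ℝ) : NormedSpace.exp (t • J) = Y t := by
  have h1 : ∀ t, HasDerivAt (fun t : ℝ => NormedSpace.exp (t • -J) * Y t) 0 t := fun t => by
    refine ((hasDerivAt_exp_smul_const (-J) t).mul (hY t)).congr_deriv ?_
    rw [mul_assoc, neg_mul, mul_neg, neg_add_cancel]
  have h2 : NormedSpace.exp (t • -J) * Y t = NormedSpace.exp ((0 : ℝ) • -J) * Y 0 :=
    is_const_of_deriv_eq_zero (fun t => (h1 t).differentiableAt) (fun t => (h1 t).deriv) t 0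
  rw [h0, zero_smul, NormedSpace.exp_zero, mul_one] at h2
  let _ : NormedAlgebra ℚ A := NormedAlgebra.restrictScalars ℚ ℝ A
  have h3 : NormedSpace.exp (t • J) * NormedSpace.exp (t • -J) = 1 := by
    rw [smul_neg, ← NormedSpace.exp_add_of_commute ((Commute.refl _).neg_right), add_neg_cancel,
      NormedSpace.exp_zero]
  calc NormedSpace.exp (t • J) = NormedSpace.exp (t • J) * (NormedSpace.exp (t • -J) * Y t) := by
        rw [h2, mul_one]
    _ = Y t := by rw [← mul_assoc, h3, one_mul]

theorem exp_of_cube_eq_zero {A : Type*} [NormedRing A] [NormedAlgebra ℝ A]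
    [CompleteSpace A] {N : A} (hN : N * (N * N) = 0) :
    NormedSpace.exp N = 1 + N + (2⁻¹ : ℝ) • (N * N) := by
  have := exp_smul_eq_of_hasDerivAt N
    (fun t => 1 + t • N + (t ^ 2 * 2⁻¹) • (N * N)) (fun t => by
      have h1 : HasDerivAt (fun t : ℝ => t • N) ((1 : ℝ) • N) t :=
        (hasDerivAt_id t).smul_const N
      have h2 : HasDerivAt (fun t : ℝ => (t ^ 2 * 2⁻¹) • (N * N)) (t • (N * N)) t := by
        refine ((((hasDerivAt_id t).pow 2).mul_const (2⁻¹ : ℝ)).smul_const (N * N)).congr_deriv ?_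
        congr 1
        simp; ring
      refine ((h1.const_add 1).add h2).congr_deriv ?_
      simp only [mul_add, mul_one, one_smul, mul_smul_comm, hN, smul_zero, add_zero]) (by simp) 1
  simpa using this

theorem exp_smul_of_cube_eq_neg {A : Type*} [NormedRing A] [NormedAlgebra ℝ A]
    [CompleteSpace A] {J : A} (hJ : J * (J * J) = -J) (t : ℝ) :
    NormedSpace.exp (t • J) = 1 + Real.sin t • J + (1 - Real.cos t) • (J * J) := by
  refine exp_smul_eq_of_hasDerivAt J
    (fun t => 1 + Real.sin t • J + (1 - Real.cos t) • (J * J)) (fun t => ?_) (by simp) t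
  refine ((((Real.hasDerivAt_sin t).smul_const J).const_add 1).add
    (((Real.hasDerivAt_cos t).const_sub 1).smul_const (J * J))).congr_deriv ?_
  simp only [mul_add, mul_one, mul_smul_comm, hJ, smul_neg, neg_neg]
  module

theorem exp_apply_eigenvector {W : Type*} [NormedAddCommGroup W] [NormedSpace ℝ W]
    [CompleteSpace W] {X : W →L[ℝ] W} {u : W} {a : ℝ} (h : X u = a • u) :
    NormedSpace.exp X u = Real.exp a • u := by
  have h1 : ∀ t, HasDerivAt (fun t : ℝ => Real.exp (-(t * a)) • (NormedSpace.exp (t • X)) u) 0 t :=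
    fun t => by
    have h2 : HasDerivAt (fun t : ℝ => Real.exp (-(t * a))) (Real.exp (-(t * a)) * -(1 * a)) t :=
      ((hasDerivAt_id t).mul_const a).neg.exp
    have h3 := (hasDerivAt_exp_smul_const X t).clm_apply (hasDerivAt_const t u)
    refine (h2.smul h3).congr_deriv ?_
    simp [h, smul_smul]
  have h2 := is_const_of_deriv_eq_zero (fun t => (h1 t).differentiableAt)
    (fun t => (h1 t).deriv) 1 0
  simp only [one_mul, one_smul, zero_mul, neg_zero, Real.exp_zero, zero_smul,
    NormedSpace.exp_zero] at h2
  have h3 : Real.exp a • Real.exp (-a) • (NormedSpace.exp X) u = Real.exp a • u := by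
    rw [h2]; rfl
  rw [smul_smul, ← Real.exp_add] at h3
  simpa using h3

theorem hasDerivAt_minkowskiForm {f g : ℝ → MinkowskiSpace d} {f' g' : MinkowskiSpace d} {t : ℝ}
    (hf : HasDerivAt f f' t) (hg : HasDerivAt g g' t) :
    HasDerivAt (fun t => η (f t) (g t)) (η f' (g t) + η (f t) g') t := by
  have h1 : ∀ i, HasDerivAt (fun t => f t i) (f' i) t := fun i =>
    (EuclideanSpace.proj (𝕜 := ℝ) i).hasFDerivAt.comp_hasDerivAt t hf
  have h2 : ∀ i, HasDerivAt (fun t => g t i) (g' i) t := fun i =>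
    (EuclideanSpace.proj (𝕜 := ℝ) i).hasFDerivAt.comp_hasDerivAt t hg
  unfold minkowskiForm
  refine (((h1 0).mul (h2 0)).neg.add (HasDerivAt.fun_sum fun i _ =>
    (h1 i.succ).mul (h2 i.succ))).congr_deriv ?_
  rw [Finset.sum_add_distrib]
  ring

theorem exp_mul_exp_neg {A : Type*} [NormedRing A] [NormedAlgebra ℝ A] [CompleteSpace A] (X : A) :
    NormedSpace.exp X * NormedSpace.exp (-X) = 1 := by
  let _ : NormedAlgebra ℚ A := NormedAlgebra.restrictScalars ℚ ℝ A
  rw [← NormedSpace.exp_add_of_commute ((Commute.refl _).neg_right), add_neg_cancel,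
    NormedSpace.exp_zero]

theorem exp_add_smul {A : Type*} [NormedRing A] [NormedAlgebra ℝ A] [CompleteSpace A] (a b : ℝ)
    (X : A) :
    NormedSpace.exp ((a + b) • X) = NormedSpace.exp (a • X) * NormedSpace.exp (b • X) := by
  let _ : NormedAlgebra ℚ A := NormedAlgebra.restrictScalars ℚ ℝ A
  rw [← NormedSpace.exp_add_of_commute (((Commute.refl X).smul_left a).smul_right b), add_smul]

/-- The exponential of an endomorphism, as an element of the linear group. -/
def expEquiv (X : MinkowskiSpace d →L[ℝ] MinkowskiSpace d) :
    MinkowskiSpace d ≃L[ℝ] MinkowskiSpace d :=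
  ContinuousLinearEquiv.equivOfInverse (NormedSpace.exp X) (NormedSpace.exp (-X))
    (fun x => by
      have := exp_mul_exp_neg (-X)
      rw [neg_neg] at this
      exact congrArg (fun f : MinkowskiSpace d →L[ℝ] MinkowskiSpace d => f x) this)
    (fun x => congrArg (fun f : MinkowskiSpace d →L[ℝ] MinkowskiSpace d => f x)
      (exp_mul_exp_neg X))

theorem expEquiv_apply (X : MinkowskiSpace d →L[ℝ] MinkowskiSpace d) (x : MinkowskiSpace d) :
    expEquiv X x = NormedSpace.exp X x := rfl

theorem expEquiv_add_smul (a b : ℝ) (X : MinkowskiSpace d →L[ℝ] MinkowskiSpace d) :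
    expEquiv ((a + b) • X) = expEquiv (a • X) * expEquiv (b • X) := by
  ext1
  funext x
  exact congrArg (fun f : MinkowskiSpace d →L[ℝ] MinkowskiSpace d => f x) (exp_add_smul a b X)

theorem expEquiv_zero : expEquiv (0 : MinkowskiSpace d →L[ℝ] MinkowskiSpace d) = 1 := by
  ext1
  funext x
  change NormedSpace.exp (0 : MinkowskiSpace d →L[ℝ] MinkowskiSpace d) x = x
  rw [NormedSpace.exp_zero]; rfl

theorem expEquiv_neg (X : MinkowskiSpace d →L[ℝ] MinkowskiSpace d) :
    expEquiv (-X) = (expEquiv X)⁻¹ := by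
  rw [eq_inv_iff_mul_eq_one]
  have := expEquiv_add_smul (-1) 1 X
  rw [neg_add_cancel, zero_smul_endomorphism, expEquiv_zero, neg_smul_endomorphism,
    one_smul_endomorphism] at this
  exact this.symm

theorem expEquiv_mem {X : MinkowskiSpace d →L[ℝ] MinkowskiSpace d} (hX : X ∈ lorentzAlgebra d) :
    expEquiv X ∈ lorentzGroup d := fun x y => by
  have h1 : ∀ z t, HasDerivAt (fun t : ℝ => (NormedSpace.exp (t • X)) z)
      (X ((NormedSpace.exp (t • X)) z)) t := fun z t =>
    ((hasDerivAt_exp_smul_const' X t).clm_apply (hasDerivAt_const t z)).congr_deriv (by simp)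
  have h2 : ∀ t, HasDerivAt (fun t : ℝ => η ((NormedSpace.exp (t • X)) x)
      ((NormedSpace.exp (t • X)) y)) 0 t := fun t =>
    (hasDerivAt_minkowskiForm (h1 x t) (h1 y t)).congr_deriv (hX _ _)
  have h3 := is_const_of_deriv_eq_zero (fun t => (h2 t).differentiableAt)
    (fun t => (h2 t).deriv) 1 0
  simp only [one_smul_endomorphism, zero_smul_endomorphism, NormedSpace.exp_zero] at h3
  exact h3

theorem conj_expEquiv (g : MinkowskiSpace d ≃L[ℝ] MinkowskiSpace d)
    {X Y : MinkowskiSpace d →L[ℝ] MinkowskiSpace d} (h : ∀ z, Y (g z) = g (X z)) :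
    expEquiv Y = g * expEquiv X * g⁻¹ := by
  let _ : NormedAlgebra ℚ (MinkowskiSpace d →L[ℝ] MinkowskiSpace d) :=
    NormedAlgebra.restrictScalars ℚ ℝ _
  let U : (MinkowskiSpace d →L[ℝ] MinkowskiSpace d)ˣ :=
    ⟨g, (g.symm : MinkowskiSpace d →L[ℝ] MinkowskiSpace d), by ext1 x; simp, by ext1 x; simp⟩
  have h1 : Y = U * X * (U⁻¹ : (MinkowskiSpace d →L[ℝ] MinkowskiSpace d)ˣ) := by
    ext1 x
    change Y x = g (X (g.symm x))
    rw [← h, ContinuousLinearEquiv.apply_symm_apply]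
  ext1
  funext x
  change NormedSpace.exp Y x = g (NormedSpace.exp X (g.symm x))
  rw [h1, NormedSpace.exp_units_conj]
  rfl

theorem det_expEquiv_pos (X : MinkowskiSpace d →L[ℝ] MinkowskiSpace d) :
    0 < LinearMap.det ((expEquiv X : MinkowskiSpace d ≃L[ℝ] MinkowskiSpace d) :
      MinkowskiSpace d →ₗ[ℝ] MinkowskiSpace d) := by
  have h1 : expEquiv X = expEquiv ((2⁻¹ : ℝ) • X) * expEquiv ((2⁻¹ : ℝ) • X) := by
    rw [← expEquiv_add_smul]; norm_num [one_smul_endomorphism]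
  have h2 : ((expEquiv X : MinkowskiSpace d ≃L[ℝ] MinkowskiSpace d) :
      MinkowskiSpace d →ₗ[ℝ] MinkowskiSpace d) =
      ((expEquiv ((2⁻¹ : ℝ) • X)).toLinearEquiv : MinkowskiSpace d →ₗ[ℝ] MinkowskiSpace d) *
      ((expEquiv ((2⁻¹ : ℝ) • X)).toLinearEquiv : MinkowskiSpace d →ₗ[ℝ] MinkowskiSpace d) := by
    rw [h1]; rfl
  rw [h2, map_mul]
  have h3 := ((expEquiv ((2⁻¹ : ℝ) • X)).toLinearEquiv.isUnit_det').ne_zero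
  exact mul_self_pos.2 h3

/-! ### The stabilizer of a null vector -/

theorem IsNullPair.exists_spatial {u : MinkowskiSpace d} (hu : u ≠ 0) (huu : η u u = 0) :
    ∃ v, IsNullPair u v ∧ ∀ w ∈ IsNullPair.perp u v, w 0 = 0 := by
  have h0 := null_zero_ne_zero hu huu
  set e : MinkowskiSpace d := EuclideanSpace.single 0 1 with he
  have h1 : ∀ x : MinkowskiSpace d, η e x = -x 0 := fun x => by
    rw [minkowskiForm_single_left]; simp
  have h2 : ∀ x : MinkowskiSpace d, η x e = -x 0 := fun x => by rw [minkowskiForm_comm, h1]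
  have h3 : e 0 = 1 := by simp [he]
  refine ⟨(2 * u 0 ^ 2)⁻¹ • (u - (2 * u 0) • e), ⟨huu, ?_, ?_⟩, fun w hw => ?_⟩
  · simp [huu, h1, h2, h3]; field_simp; ring_nf; simp
  · simp [huu, h2]; field_simp
  · rw [IsNullPair.mem_perp] at hw
    have h4 := hw.2
    simpa [hw.1, h1, h0] using h4

theorem minkowskiForm_eq_inner_of_zero {w : MinkowskiSpace d} (hw : w 0 = 0)
    (x : MinkowskiSpace d) : η w x = inner ℝ w x := by
  rw [PiLp.inner_apply, Fin.sum_univ_succ, minkowskiForm, hw]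
  simp [mul_comm]

/-- The orthogonal reflection along `a`; for a spatial vector `a` it is a Lorentz
transformation. -/
def reflectionAlong (a : MinkowskiSpace d) : MinkowskiSpace d ≃L[ℝ] MinkowskiSpace d :=
  ((ℝ ∙ a)ᗮ.reflection).toContinuousLinearEquiv

theorem reflectionAlong_apply {a : MinkowskiSpace d} (ha : a 0 = 0) (x : MinkowskiSpace d) :
    reflectionAlong a x = x - (2 * (η a x / η a a)) • a := by
  change (ℝ ∙ a)ᗮ.reflection x = _
  rw [Submodule.reflection_orthogonal_apply, Submodule.reflection_singleton_apply,
    minkowskiForm_eq_inner_of_zero ha, minkowskiForm_eq_inner_of_zero ha,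
    real_inner_self_eq_norm_sq]
  simp only [RCLike.ofReal_real_eq_id, id_eq]
  module

theorem reflectionAlong_reflectionAlong (a x : MinkowskiSpace d) :
    reflectionAlong a (reflectionAlong a x) = x := by
  change (ℝ ∙ a)ᗮ.reflection ((ℝ ∙ a)ᗮ.reflection x) = x
  exact Submodule.reflection_reflection _ x

theorem reflectionAlong_mul_self (a : MinkowskiSpace d) :
    reflectionAlong a * reflectionAlong a = 1 :=
  ContinuousLinearEquiv.ext (funext (reflectionAlong_reflectionAlong a))

theorem reflectionAlong_inv (a : MinkowskiSpace d) :
    (reflectionAlong a)⁻¹ = reflectionAlong a :=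
  inv_eq_of_mul_eq_one_left (reflectionAlong_mul_self a)

theorem reflectionAlong_zero : reflectionAlong (0 : MinkowskiSpace d) = 1 := by
  ext1; funext x
  rw [reflectionAlong_apply (by simp), smul_zero, sub_zero]
  rfl

theorem reflectionAlong_mem {a : MinkowskiSpace d} (ha : a 0 = 0) :
    reflectionAlong a ∈ lorentzGroup d := fun x y => by
  rw [reflectionAlong_apply ha, reflectionAlong_apply ha]
  by_cases h : η a a = 0
  · simp [h]
  · simp only [minkowskiForm_sub_left, minkowskiForm_sub_right, minkowskiForm_smul_left,
      minkowskiForm_smul_right, minkowskiForm_comm x a]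
    field_simp
    ring

theorem det_reflectionAlong {a : MinkowskiSpace d} (ha : a ≠ 0) :
    LinearMap.det ((reflectionAlong a).toLinearEquiv :
      MinkowskiSpace d →ₗ[ℝ] MinkowskiSpace d) = -1 := by
  have h := Submodule.det_reflection (𝕜 := ℝ) (K := (ℝ ∙ a)ᗮ)
  rw [Submodule.orthogonal_orthogonal, finrank_span_singleton ha, pow_one] at h
  exact h

/-- The group generated by the exponentials of the elements of `𝔬(1,d)` that annihilate `u`. -/
def expStabilizer (u : MinkowskiSpace d) :
    Subgroup (MinkowskiSpace d ≃L[ℝ] MinkowskiSpace d) :=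
  Subgroup.closure {g | ∃ X ∈ lorentzAlgebra d, X u = 0 ∧ g = expEquiv X}

theorem expEquiv_mem_expStabilizer {u : MinkowskiSpace d}
    {X : MinkowskiSpace d →L[ℝ] MinkowskiSpace d} (hX : X ∈ lorentzAlgebra d) (hXu : X u = 0) :
    expEquiv X ∈ expStabilizer u := Subgroup.subset_closure ⟨X, hX, hXu, rfl⟩

theorem det_mul_equiv (g k : MinkowskiSpace d ≃L[ℝ] MinkowskiSpace d) :
    LinearMap.det ((g * k).toLinearEquiv : MinkowskiSpace d →ₗ[ℝ] MinkowskiSpace d) =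
      LinearMap.det (g.toLinearEquiv : MinkowskiSpace d →ₗ[ℝ] MinkowskiSpace d) *
      LinearMap.det (k.toLinearEquiv : MinkowskiSpace d →ₗ[ℝ] MinkowskiSpace d) := by
  rw [← map_mul]; rfl

/-- The group of linear automorphisms with positive determinant. -/
def positiveDet (d : ℕ) : Subgroup (MinkowskiSpace d ≃L[ℝ] MinkowskiSpace d) where
  carrier := {g | 0 < LinearMap.det (g.toLinearEquiv :
    MinkowskiSpace d →ₗ[ℝ] MinkowskiSpace d)}
  mul_mem' {g k} hg hk := by
    simp only [Set.mem_ofPred_eq] at hg hk ⊢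
    rw [det_mul_equiv]; exact mul_pos hg hk
  one_mem' := by
    change 0 < LinearMap.det (LinearMap.id : MinkowskiSpace d →ₗ[ℝ] MinkowskiSpace d)
    rw [LinearMap.det_id]; exact one_pos
  inv_mem' {g} hg := by
    simp only [Set.mem_ofPred_eq] at hg ⊢
    have h1 := det_mul_equiv g g⁻¹
    rw [mul_inv_cancel] at h1
    have h2 : LinearMap.det ((1 : MinkowskiSpace d ≃L[ℝ] MinkowskiSpace d).toLinearEquiv :
        MinkowskiSpace d →ₗ[ℝ] MinkowskiSpace d) = 1 := LinearMap.det_id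
    rw [h2] at h1
    exact pos_of_mul_pos_right (h1 ▸ one_pos) hg.le

theorem mem_positiveDet {g : MinkowskiSpace d ≃L[ℝ] MinkowskiSpace d} :
    g ∈ positiveDet d ↔
      0 < LinearMap.det (g.toLinearEquiv : MinkowskiSpace d →ₗ[ℝ] MinkowskiSpace d) := Iff.rfl

theorem expStabilizer_le_positiveDet (u : MinkowskiSpace d) :
    expStabilizer u ≤ positiveDet d := by
  refine (Subgroup.closure_le _).2 ?_
  rintro _ ⟨X, -, -, rfl⟩
  exact det_expEquiv_pos X

theorem expStabilizer_le_lorentzGroup (u : MinkowskiSpace d) :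
    expStabilizer u ≤ lorentzGroup d := by
  refine (Subgroup.closure_le _).2 ?_
  rintro _ ⟨X, hX, -, rfl⟩
  exact expEquiv_mem hX

/-- A rotation of the plane spanned by two vectors of `{u, v}^⊥` takes one to a multiple of the
other. -/
theorem exists_rotation {u v : MinkowskiSpace d} (h : IsNullPair u v)
    {a b : MinkowskiSpace d} (ha : a ∈ IsNullPair.perp u v) (hb : b ∈ IsNullPair.perp u v)
    (ha0 : a ≠ 0) (hb0 : b ≠ 0) :
    ∃ X ∈ lorentzAlgebra d, X u = 0 ∧ ∃ c : ℝ, c ≠ 0 ∧ expEquiv X a = c • b := by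
  have haa := h.self_pos ha ha0
  set b' := b - (η a b / η a a) • a with hb'
  have hb'p : b' ∈ IsNullPair.perp u v := Submodule.sub_mem _ hb (Submodule.smul_mem _ _ ha)
  by_cases hb'0 : b' = 0
  · have h1 : b = (η a b / η a a) • a := sub_eq_zero.1 hb'0
    have h2 : η a b / η a a ≠ 0 := fun h2 => hb0 (by rw [h1, h2, zero_smul])
    refine ⟨0, Submodule.zero_mem _, rfl, (η a b / η a a)⁻¹, inv_ne_zero h2, ?_⟩
    rw [expEquiv_zero]
    exact ((inv_smul_eq_iff₀ h2).2 h1).symm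
  have hbb := h.self_pos hb'p hb'0
  have hab' : η a b' = 0 := by
    simp only [hb', minkowskiForm_sub_right, minkowskiForm_smul_right]
    field_simp; ring
  set r := √(η a a) with hr
  set s := √(η b' b') with hs
  have hr0 : 0 < r := Real.sqrt_pos.2 haa
  have hs0 : 0 < s := Real.sqrt_pos.2 hbb
  have hr2 : η a a = r * r := (Real.mul_self_sqrt haa.le).symm
  have hs2 : η b' b' = s * s := (Real.mul_self_sqrt hbb.le).symm
  obtain ⟨e, he⟩ : ∃ e, e = r⁻¹ • a := ⟨_, rfl⟩
  obtain ⟨f, hf⟩ : ∃ f, f = s⁻¹ • b' := ⟨_, rfl⟩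
  have hee : η e e = 1 := by rw [he]; simp [hr2]; field_simp
  have hff : η f f = 1 := by rw [hf]; simp [hs2]; field_simp
  have hef : η e f = 0 := by rw [he, hf]; simp [hab']
  have hfe : η f e = 0 := by rw [minkowskiForm_comm, hef]
  have hae : a = r • e := by rw [he, smul_inv_smul₀ hr0.ne']
  have hbf : b = (η a b / r) • e + s • f := by
    rw [he, hf, smul_inv_smul₀ hs0.ne', smul_smul, hb', hr2]
    have : η a b / r * r⁻¹ = η a b / (r * r) := by field_simp
    rw [this]; abel
  obtain ⟨p, hp⟩ : ∃ p, p = η a b / r := ⟨_, rfl⟩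
  rw [← hp] at hbf
  have hue : η u e = 0 := by rw [he]; simp [(IsNullPair.mem_perp.1 ha).1]
  have huf : η u f = 0 := by rw [hf]; simp [(IsNullPair.mem_perp.1 hb'p).1]
  have hJe : wedge f e e = f := by simp [wedge_apply, hee, hfe]
  have hJf : wedge f e f = -e := by simp [wedge_apply, hef, hff]
  have hJ3 : wedge f e * (wedge f e * wedge f e) = -wedge f e := by
    ext1 z
    simp only [mul_apply_eq_comp, neg_apply]
    rw [wedge_apply f e z]
    simp only [map_sub, map_smul, hJe, hJf, map_neg]
    module
  obtain ⟨z, hz⟩ : ∃ z : ℂ, z = ⟨p, s⟩ := ⟨_, rfl⟩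
  have hz0 : z ≠ 0 := fun h => by
    have := congrArg Complex.im h
    rw [hz] at this; exact hs0.ne' this
  have hzn : 0 < ‖z‖ := norm_pos_iff.2 hz0
  have hcos : ‖z‖ * Real.cos z.arg = p := by rw [Complex.norm_mul_cos_arg, hz]
  have hsin : ‖z‖ * Real.sin z.arg = s := by rw [Complex.norm_mul_sin_arg, hz]
  refine ⟨z.arg • wedge f e, Submodule.smul_mem _ _ (wedge_mem _ _), ?_, r / ‖z‖,
    (div_pos hr0 hzn).ne', ?_⟩
  · rw [smul_apply, wedge_apply, minkowskiForm_comm e, minkowskiForm_comm f, hue, huf]; simp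
  · rw [expEquiv_apply, hae, map_smul]
    have := exp_smul_of_cube_eq_neg hJ3 z.arg
    have h2 : NormedSpace.exp (z.arg • wedge f e) e =
        e + Real.sin z.arg • f + (1 - Real.cos z.arg) • (-e) := by
      rw [this]
      simp only [add_apply, smul_apply, mul_apply_eq_comp, hJe, hJf]
      rfl
    rw [h2, hbf, ← hcos, ← hsin]
    simp only [smul_add, smul_smul, smul_neg]
    field_simp
    module

/-- The product of the reflections along `b` and `a` is the commutator of the reflection along `a`
with the exponential of an infinitesimal rotation taking `a` to a multiple of `b`. -/
theorem reflectionAlong_mul_mem {u v : MinkowskiSpace d} (h : IsNullPair u v)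
    (hs : ∀ w ∈ IsNullPair.perp u v, w 0 = 0)
    {a b : MinkowskiSpace d} (ha : a ∈ IsNullPair.perp u v) (hb : b ∈ IsNullPair.perp u v)
    (ha0 : a ≠ 0) (hb0 : b ≠ 0) :
    reflectionAlong b * reflectionAlong a ∈ expStabilizer u := by
  obtain ⟨X, hX, hXu, c, hc, hXa⟩ := exists_rotation h ha hb ha0 hb0
  have hau : reflectionAlong a u = u := by
    rw [reflectionAlong_apply (hs a ha), minkowskiForm_comm, (IsNullPair.mem_perp.1 ha).1]
    simp
  have hT := expEquiv_mem hX
  -- the reflection along `b` is conjugate to that along `a`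
  have h1 : reflectionAlong b = expEquiv X * reflectionAlong a * (expEquiv X)⁻¹ := by
    ext1; funext x
    change _ = expEquiv X (reflectionAlong a ((expEquiv X).symm x))
    rw [reflectionAlong_apply (hs a ha), reflectionAlong_apply (hs b hb), map_sub,
      ContinuousLinearEquiv.apply_symm_apply, map_smul, hXa]
    have h2 : η a ((expEquiv X).symm x) = c * η b x := by
      rw [← hT, ContinuousLinearEquiv.apply_symm_apply, hXa, minkowskiForm_smul_left]
    have h3 : η a a = c * (c * η b b) := by
      rw [← hT, hXa, minkowskiForm_smul_left, minkowskiForm_smul_right]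
    rw [h2, h3, smul_smul]
    congr 2
    have := (h.self_pos hb hb0).ne'
    field_simp
  let Y : MinkowskiSpace d →L[ℝ] MinkowskiSpace d :=
    (reflectionAlong a : MinkowskiSpace d →L[ℝ] MinkowskiSpace d) * (-X) *
      (reflectionAlong a : MinkowskiSpace d →L[ℝ] MinkowskiSpace d)
  have hRR := reflectionAlong_reflectionAlong a
  have hY : ∀ x, Y x = reflectionAlong a (-X (reflectionAlong a x)) := fun x => rfl
  have hYmem : Y ∈ lorentzAlgebra d := fun x y => by
    have h5 := reflectionAlong_mem (hs a ha)
    rw [hY, hY, ← h5 (reflectionAlong a _) y, ← h5 x (reflectionAlong a _), hRR, hRR,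
      minkowskiForm_neg_left, minkowskiForm_neg_right, lorentzAlgebra_apply_left hX]
    ring
  have h2 : expEquiv Y = reflectionAlong a * (expEquiv X)⁻¹ * (reflectionAlong a)⁻¹ := by
    rw [← expEquiv_neg]
    exact conj_expEquiv _ fun z => by rw [hY, hRR]; rfl
  have h3 : reflectionAlong b * reflectionAlong a = expEquiv X * expEquiv Y := by
    rw [h1, h2, reflectionAlong_inv]; group
  rw [h3]
  refine mul_mem (expEquiv_mem_expStabilizer hX hXu) (expEquiv_mem_expStabilizer hYmem ?_)
  rw [hY, hau, hXu, neg_zero, map_zero]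

/-- A product of reflections is, up to one reflection, a product of exponentials. -/
theorem list_prod_reflectionAlong_mem {u v : MinkowskiSpace d} (h : IsNullPair u v)
    (hs : ∀ w ∈ IsNullPair.perp u v, w 0 = 0) (l : List (IsNullPair.perp u v)) :
    (l.map fun a : IsNullPair.perp u v => reflectionAlong (a : MinkowskiSpace d)).prod ∈
        expStabilizer u ∨
    ∃ a ∈ IsNullPair.perp u v, a ≠ 0 ∧
      reflectionAlong a * (l.map fun a : IsNullPair.perp u v => reflectionAlong
          (a : MinkowskiSpace d)).prod ∈
        expStabilizer u := by
  induction l with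
  | nil => left; simp [one_mem]
  | cons b l ih =>
    rw [List.map_cons, List.prod_cons]
    by_cases hb : (b : MinkowskiSpace d) = 0
    · rw [hb, reflectionAlong_zero, one_mul]; exact ih
    rcases ih with ih | ⟨a, ha, ha0, ih⟩
    · right
      refine ⟨b, b.2, hb, ?_⟩
      rwa [← mul_assoc, reflectionAlong_mul_self, one_mul]
    · left
      have := mul_mem (reflectionAlong_mul_mem h hs ha b.2 ha0 hb) ih
      rwa [mul_assoc, ← mul_assoc (reflectionAlong a), reflectionAlong_mul_self, one_mul] at this

theorem mul_apply_equiv (f g : MinkowskiSpace d ≃L[ℝ] MinkowskiSpace d) (x : MinkowskiSpace d) :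
    (f * g) x = f (g x) := rfl

theorem coe_reflection_orthogonal_singleton {F : Type*} [NormedAddCommGroup F]
    [InnerProductSpace ℝ F] {W : Submodule ℝ F} (b w : W) :
    (((ℝ ∙ b)ᗮ.reflection w : W) : F) =
      w - (2 * (inner ℝ (b : F) w / inner ℝ (b : F) b)) • (b : F) := by
  rw [Submodule.reflection_orthogonal_apply, Submodule.reflection_singleton_apply,
    real_inner_self_eq_norm_sq, two_smul]
  simp only [RCLike.ofReal_real_eq_id, id_eq, Submodule.coe_neg, Submodule.coe_sub,
    Submodule.coe_add, Submodule.coe_smul, Submodule.coe_inner, Submodule.coe_norm]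
  module

theorem reflectionAlong_coe {W : Submodule ℝ (MinkowskiSpace d)} {b : W}
    (hb : (b : MinkowskiSpace d) 0 = 0) (w : W) :
    reflectionAlong (b : MinkowskiSpace d) w = ((ℝ ∙ b)ᗮ.reflection w : W) := by
  rw [reflectionAlong_apply hb, minkowskiForm_eq_inner_of_zero hb,
    minkowskiForm_eq_inner_of_zero hb]
  exact (coe_reflection_orthogonal_singleton b w).symm

/-- A Lorentz transformation with positive determinant that fixes both vectors of a null pair is a
product of rotations. -/
theorem mem_expStabilizer_of_fixes_pair {u v : MinkowskiSpace d} (h : IsNullPair u v)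
    (hs : ∀ w ∈ IsNullPair.perp u v, w 0 = 0) {k : MinkowskiSpace d ≃L[ℝ] MinkowskiSpace d}
    (hk : k ∈ lorentzGroup d) (hku : k u = u) (hkv : k v = v) (hdet : k ∈ positiveDet d) :
    k ∈ expStabilizer u := by
  have hmem : ∀ w ∈ IsNullPair.perp u v, k w ∈ IsNullPair.perp u v := fun w hw => by
    rw [IsNullPair.mem_perp] at hw ⊢
    have h1 := hk u w
    have h2 := hk v w
    rw [hku] at h1
    rw [hkv] at h2
    exact ⟨h1.trans hw.1, h2.trans hw.2⟩
  let f : IsNullPair.perp u v →ₗᵢ[ℝ] IsNullPair.perp u v :=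
    { toLinearMap := (k.toLinearEquiv : MinkowskiSpace d →ₗ[ℝ] MinkowskiSpace d).restrict hmem
      norm_map' := fun w => by
        have h1 : ‖k (w : MinkowskiSpace d)‖ ^ 2 = ‖(w : MinkowskiSpace d)‖ ^ 2 := by
          rw [← minkowskiForm_self_of_zero (hs _ (hmem _ w.2)),
            ← minkowskiForm_self_of_zero (hs _ w.2)]
          exact hk _ _
        exact (sq_eq_sq₀ (norm_nonneg _) (norm_nonneg _)).1 h1 }
  obtain ⟨l, -, hl⟩ := (f.toLinearIsometryEquiv rfl).reflections_generate_dim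
  have hprod : ∀ l : List (IsNullPair.perp u v),
      (l.map fun a : IsNullPair.perp u v => reflectionAlong (a : MinkowskiSpace d)).prod u = u ∧
      (l.map fun a : IsNullPair.perp u v => reflectionAlong (a : MinkowskiSpace d)).prod v = v ∧
      ∀ w : IsNullPair.perp u v,
        (l.map fun a : IsNullPair.perp u v => reflectionAlong (a : MinkowskiSpace d)).prod w =
        ((l.map fun v => (ℝ ∙ v)ᗮ.reflection).prod w : IsNullPair.perp u v) := by
    intro l
    induction l with
    | nil => exact ⟨rfl, rfl, fun w => rfl⟩
    | cons b l ih =>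
      simp only [List.map_cons, List.prod_cons]
      have hb := IsNullPair.mem_perp.1 b.2
      refine ⟨?_, ?_, fun w => ?_⟩
      · rw [mul_apply_equiv, ih.1, reflectionAlong_apply (hs b b.2), minkowskiForm_comm _ u, hb.1]
        simp
      · rw [mul_apply_equiv, ih.2.1, reflectionAlong_apply (hs b b.2), minkowskiForm_comm _ v, hb.2]
        simp
      · rw [mul_apply_equiv, ih.2.2 w, reflectionAlong_coe (hs b b.2)]
        rfl
  have hk_eq : k = (l.map fun a : IsNullPair.perp u v =>
      reflectionAlong (a : MinkowskiSpace d)).prod := by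
    ext1; funext x
    obtain ⟨h1, h2, h3⟩ := hprod l
    obtain ⟨w, hw⟩ : ∃ w : IsNullPair.perp u v, x = w + (η v x • u + η u x • v) :=
      ⟨⟨_, h.perp_decomp x⟩, by simp only; abel⟩
    rw [hw, map_add, map_add, map_smul, map_smul, hku, hkv, map_add, map_add, map_smul, map_smul,
      h1, h2, h3, ← hl]
    rfl
  rcases list_prod_reflectionAlong_mem h hs l with h1 | ⟨a, ha, ha0, h1⟩
  · rwa [hk_eq]
  · -- an odd number of reflections would give a negative determinant
    rw [← hk_eq] at h1
    have h2 := expStabilizer_le_positiveDet _ h1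
    rw [mem_positiveDet, det_mul_equiv, det_reflectionAlong ha0] at h2
    rw [mem_positiveDet] at hdet
    linarith

theorem wedge_null_cube {u a : MinkowskiSpace d} (huu : η u u = 0) (hua : η u a = 0) :
    wedge u a * (wedge u a * wedge u a) = 0 := by
  ext1 z
  simp [wedge_apply, huu, hua, minkowskiForm_comm a u]

/-- The unipotent transformation generated by `u ∧ a`, where `u` is null and orthogonal to `a`. -/
theorem exp_wedge_null_apply {u a : MinkowskiSpace d} (huu : η u u = 0) (hua : η u a = 0)
    (x : MinkowskiSpace d) :
    expEquiv (wedge u a) x = x + wedge u a x - (2⁻¹ * η u x * η a a) • u := by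
  rw [expEquiv_apply, exp_of_cube_eq_zero (wedge_null_cube huu hua)]
  have h1 : wedge u a (wedge u a x) = -(η u x * η a a) • u := by
    simp [wedge_apply, huu, hua, minkowskiForm_comm a u]
  change x + wedge u a x + (2⁻¹ : ℝ) • (wedge u a (wedge u a x)) = _
  rw [h1]
  module

/-- The unipotent transformations fixing `u` act transitively on the null pairs starting
with `u`. -/
theorem exists_unipotent {u v v' : MinkowskiSpace d} (h : IsNullPair u v)
    (h' : IsNullPair u v') :
    ∃ a ∈ IsNullPair.perp u v, expEquiv (wedge u a) v = v' := by
  refine ⟨-(v' - η v v' • u - η u v' • v), Submodule.neg_mem _ (h.perp_decomp v'), ?_⟩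
  set a := -(v' - η v v' • u - η u v' • v) with ha
  have hap : a ∈ IsNullPair.perp u v := Submodule.neg_mem _ (h.perp_decomp v')
  have hap' := IsNullPair.mem_perp.1 hap
  rw [exp_wedge_null_apply h.left hap'.1, wedge_apply, minkowskiForm_comm a v, hap'.2, h.prod]
  have h1 : η a a = -(2 * η v v') := by
    simp only [ha, h'.prod, minkowskiForm_neg_left, minkowskiForm_neg_right,
      minkowskiForm_sub_left, minkowskiForm_sub_right, minkowskiForm_smul_left,
      minkowskiForm_smul_right, h.left, h.right, h.prod, h.prod', h'.prod', h'.right,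
      minkowskiForm_comm v' v]
    ring
  rw [h1, ha, h'.prod]
  module

theorem expStabilizer_fixes {u : MinkowskiSpace d} {g : MinkowskiSpace d ≃L[ℝ] MinkowskiSpace d}
    (hg : g ∈ expStabilizer u) : g u = u := by
  induction hg using Subgroup.closure_induction with
  | mem x hx =>
    obtain ⟨X, -, hXu, rfl⟩ := hx
    rw [expEquiv_apply, exp_apply_eigenvector (a := 0) (by rw [hXu, zero_smul])]
    simp
  | one => rfl
  | mul x y _ _ hx hy => change x (y u) = u; rw [hy, hx]
  | inv x _ hx => change x.symm u = u; rw [ContinuousLinearEquiv.symm_apply_eq, hx]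

theorem wedge_left_annihilates {u a : MinkowskiSpace d} (huu : η u u = 0) (hua : η u a = 0) :
    wedge u a u = 0 := by
  simp [wedge_apply, huu, minkowskiForm_comm a u, hua]

/-- The stabilizer of a null vector in the group of Lorentz transformations with positive
determinant is generated by one-parameter subgroups. -/
theorem mem_expStabilizer {u : MinkowskiSpace d} (hu : u ≠ 0) (huu : η u u = 0)
    {g : MinkowskiSpace d ≃L[ℝ] MinkowskiSpace d} (hg : g ∈ lorentzGroup d) (hgu : g u = u)
    (hdet : g ∈ positiveDet d) : g ∈ expStabilizer u := by
  obtain ⟨v, h, hs⟩ := IsNullPair.exists_spatial hu huu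
  have h' : IsNullPair u (g v) := ⟨huu, by rw [hg, h.right], by
    conv_lhs => rw [← hgu]
    rw [hg, h.prod]⟩
  obtain ⟨a, ha, hav⟩ := exists_unipotent h h'
  have hn : expEquiv (wedge u a) ∈ expStabilizer u := expEquiv_mem_expStabilizer (wedge_mem _ _)
    (wedge_left_annihilates huu (IsNullPair.mem_perp.1 ha).1)
  have hk : (expEquiv (wedge u a))⁻¹ * g ∈ expStabilizer u := by
    refine mem_expStabilizer_of_fixes_pair h hs
      (mul_mem (inv_mem (expStabilizer_le_lorentzGroup _ hn)) hg) ?_ ?_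
      (mul_mem (inv_mem (expStabilizer_le_positiveDet _ hn)) hdet)
    · change (expEquiv (wedge u a)).symm (g u) = u
      rw [hgu, ContinuousLinearEquiv.symm_apply_eq, expStabilizer_fixes hn]
    · change (expEquiv (wedge u a)).symm (g v) = v
      rw [ContinuousLinearEquiv.symm_apply_eq, hav]
  have := mul_mem hn hk
  rwa [mul_inv_cancel_left] at this

/-! ### The group generated by exponentials -/

/-- The group generated by the exponentials of the elements of `𝔬(1,d)`. -/
def expGroup (d : ℕ) : Subgroup (MinkowskiSpace d ≃L[ℝ] MinkowskiSpace d) :=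
  Subgroup.closure {g | ∃ X ∈ lorentzAlgebra d, g = expEquiv X}

theorem expEquiv_mem_expGroup {X : MinkowskiSpace d →L[ℝ] MinkowskiSpace d}
    (hX : X ∈ lorentzAlgebra d) : expEquiv X ∈ expGroup d := Subgroup.subset_closure ⟨X, hX, rfl⟩

theorem expGroup_le_positiveDet : expGroup d ≤ positiveDet d := by
  refine (Subgroup.closure_le _).2 ?_
  rintro _ ⟨X, -, rfl⟩
  exact det_expEquiv_pos X

theorem expGroup_le_lorentzGroup : expGroup d ≤ lorentzGroup d := by
  refine (Subgroup.closure_le _).2 ?_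
  rintro _ ⟨X, hX, rfl⟩
  exact expEquiv_mem hX

/-- The elements of `expGroup d` preserve the time orientation of null vectors. -/
theorem expGroup_pos {g : MinkowskiSpace d ≃L[ℝ] MinkowskiSpace d} (hg : g ∈ expGroup d)
    {x : MinkowskiSpace d} (hx : x ≠ 0) (hxx : η x x = 0) : 0 < g x 0 ↔ 0 < x 0 := by
  induction hg using Subgroup.closure_induction generalizing x with
  | mem g hg =>
    obtain ⟨X, hX, rfl⟩ := hg
    -- the time coordinate does not vanish along the one-parameter group
    have hne : ∀ t : ℝ, NormedSpace.exp (t • X) x 0 ≠ 0 := fun t => by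
      have h1 := expEquiv_mem ((lorentzAlgebra d).smul_mem t hX) x x
      rw [hxx] at h1
      exact null_zero_ne_zero (fun h => hx ((expEquiv (t • X)).map_eq_zero_iff.1 h)) h1
    have hcont : Continuous fun t : ℝ => NormedSpace.exp (t • X) x 0 := by
      have h1 : Continuous fun t : ℝ => NormedSpace.exp (t • X) :=
        continuous_iff_continuousAt.2 fun t => (hasDerivAt_exp_smul_const X t).continuousAt
      exact (EuclideanSpace.proj (𝕜 := ℝ) 0).continuous.comp (h1.clm_apply continuous_const)
    have h0 : NormedSpace.exp ((0 : ℝ) • X) x 0 = x 0 := by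
      rw [zero_smul_endomorphism, NormedSpace.exp_zero]; rfl
    have h1 : NormedSpace.exp ((1 : ℝ) • X) x 0 = expEquiv X x 0 := by
      rw [one_smul_endomorphism]; rfl
    rw [← h0, ← h1]
    constructor
    · intro hpos
      by_contra hneg
      obtain ⟨t, -, ht⟩ := intermediate_value_Icc zero_le_one hcont.continuousOn
        ⟨not_lt.1 hneg, hpos.le⟩
      exact hne t ht
    · intro hpos
      by_contra hneg
      obtain ⟨t, -, ht⟩ := intermediate_value_Icc' zero_le_one hcont.continuousOn
        ⟨not_lt.1 hneg, hpos.le⟩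
      exact hne t ht
  | one => rfl
  | mul g k hg hk ihg ihk =>
    have hk' : k ∈ lorentzGroup d := expGroup_le_lorentzGroup hk
    rw [← ihk hx hxx, ← ihg (x := k x) (fun h => hx (k.map_eq_zero_iff.1 h)) (by rw [hk', hxx])]
    rfl
  | inv g hg ih =>
    have hg' : g⁻¹ ∈ lorentzGroup d := inv_mem (expGroup_le_lorentzGroup hg)
    rw [← ih (x := g⁻¹ x) (fun h => hx ((g⁻¹).map_eq_zero_iff.1 h)) (by rw [hg', hxx])]
    change 0 < g (g.symm x) 0 ↔ _
    rw [ContinuousLinearEquiv.apply_symm_apply]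

theorem expGroup_eigenvalue_pos {g : MinkowskiSpace d ≃L[ℝ] MinkowskiSpace d}
    (hg : g ∈ expGroup d) {u : MinkowskiSpace d} (hu : u ≠ 0) (huu : η u u = 0) {c : ℝ}
    (hc : g u = c • u) : 0 < c := by
  have h0 := null_zero_ne_zero hu huu
  rcases lt_or_gt_of_ne h0 with h1 | h1
  · have h2 := expGroup_pos hg (x := -u) (neg_ne_zero.2 hu) (by simp [huu])
    rw [map_neg, hc] at h2
    have h3 : 0 < -(c * u 0) := by
      have := h2.2 (by simpa using h1)
      simpa using this
    nlinarith
  · have h2 := (expGroup_pos hg hu huu).2 h1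
    rw [hc] at h2
    have h3 : 0 < c * u 0 := by simpa using h2
    exact pos_of_mul_pos_left h3 h1.le

/-! ### The Lie algebra of the stabilizer of a point -/

theorem hasDerivAt_mem_submodule {F : Type*} [NormedAddCommGroup F] [NormedSpace ℝ F]
    [FiniteDimensional ℝ F] {k : Submodule ℝ F} {f : ℝ → F} {f' : F} {t : ℝ}
    (hf : HasDerivAt f f' t) (hk : ∀ s, f s ∈ k) : f' ∈ k := by
  rw [hasDerivAt_iff_tendsto_slope] at hf
  refine k.closed_of_finiteDimensional.mem_of_tendsto hf (Eventually.of_forall fun s => ?_)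
  exact k.smul_mem _ (k.sub_mem (hk _) (hk _))

theorem hasDerivAt_exp_conj {A : Type*} [NormedRing A] [NormedAlgebra ℝ A] [CompleteSpace A]
    (X Y : A) :
    HasDerivAt (fun t : ℝ => NormedSpace.exp (t • Y) * X * NormedSpace.exp (t • -Y))
      (Y * X - X * Y) 0 := by
  refine (((hasDerivAt_exp_smul_const Y 0).mul_const X).mul
    (hasDerivAt_exp_smul_const (-Y) 0)).congr_deriv ?_
  simp [sub_eq_add_neg]

/-- If a subspace is invariant, modulo a translation, under the one-parameter group of `Y`, then it
contains the corresponding commutators. -/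
theorem commutator_mem_of_exp_conj {k : Submodule ℝ (MinkowskiSpace d →L[ℝ] MinkowskiSpace d)}
    {X Y : MinkowskiSpace d →L[ℝ] MinkowskiSpace d} (Z : MinkowskiSpace d →L[ℝ] MinkowskiSpace d)
    (h : ∀ (t : ℝ) (X' : MinkowskiSpace d →L[ℝ] MinkowskiSpace d),
      (∀ z, X' (expEquiv (t • Y) z) = expEquiv (t • Y) (X z)) → X' - Z ∈ k) :
    Y * X - X * Y ∈ k := by
  refine hasDerivAt_mem_submodule ((hasDerivAt_exp_conj X Y).sub_const Z) fun t => ?_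
  refine h t _ fun z => ?_
  have h1 : t • -Y = -(t • Y) := by module
  have h2 : NormedSpace.exp (-(t • Y)) (expEquiv (t • Y) z) = z :=
    (expEquiv (t • Y)).symm_apply_apply z
  rw [h1, mul_apply_eq_comp, mul_apply_eq_comp, h2, expEquiv_apply]

/-- The conjugate of an element of `𝔬(1,d)` by a Lorentz transformation. -/
theorem exists_lorentzAlgebra_conj {g : MinkowskiSpace d ≃L[ℝ] MinkowskiSpace d}
    (hg : g ∈ lorentzGroup d) {X : MinkowskiSpace d →L[ℝ] MinkowskiSpace d}
    (hX : X ∈ lorentzAlgebra d) {Y : MinkowskiSpace d →L[ℝ] MinkowskiSpace d}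
    (hY : ∀ z, Y (g z) = g (X z)) : Y ∈ lorentzAlgebra d := fun x y => by
  obtain ⟨x, rfl⟩ := g.surjective x
  obtain ⟨y, rfl⟩ := g.surjective y
  rw [hY, hY, hg, hg]
  exact hX x y

theorem IsNullPair.exists_perp_ne_zero (hd : 2 ≤ d) {u v : MinkowskiSpace d}
    (h : IsNullPair u v) : ∃ w ∈ IsNullPair.perp u v, w ≠ 0 := by
  have h1 := h.finrank_perp
  have : Nontrivial (IsNullPair.perp u v) :=
    Module.nontrivial_of_finrank_pos (R := ℝ) (by omega)
  obtain ⟨w, hw⟩ := exists_ne (0 : IsNullPair.perp u v)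
  exact ⟨w, w.2, by simpa using hw⟩

/-- The normalizer of the stabilizer of a null line preserves that line. -/
theorem exists_eigenvalue (hd : 2 ≤ d) {u : MinkowskiSpace d} (hu : u ≠ 0) (huu : η u u = 0)
    {g : MinkowskiSpace d ≃L[ℝ] MinkowskiSpace d} (hg : g ∈ lorentzGroup d)
    (hinv : ∀ X Y : MinkowskiSpace d →L[ℝ] MinkowskiSpace d, X ∈ lineStabilizer u →
      (∀ z, Y (g z) = g (X z)) → Y ∈ lineStabilizer u) : ∃ χ : ℝ, g u = χ • u := by
  obtain ⟨v, h⟩ := IsNullPair.exists_right hu huu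
  obtain ⟨w, hw, hw0⟩ := h.exists_perp_ne_zero hd
  have hww := h.self_pos hw hw0
  rw [IsNullPair.mem_perp] at hw
  have h1 : wedge u w ∈ lineStabilizer u := mem_lineStabilizer.2
    ⟨wedge_mem _ _, 0, by rw [wedge_left_annihilates huu hw.1, zero_smul]⟩
  obtain ⟨-, a, ha⟩ := mem_lineStabilizer.1 (hinv _ (wedge (g u) (g w)) h1 fun z => by
    rw [← conj_wedge hg, ContinuousLinearEquiv.symm_apply_apply])
  by_cases hgu : η (g u) u = 0
  · exact ⟨_, eq_smul_of_orthogonal_of_null hu huu (by rw [minkowskiForm_comm, hgu])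
      (by rw [hg, huu])⟩
  · exfalso
    rw [wedge_apply] at ha
    have h2 := congrArg (fun x => η (g u) x) ha
    have h3 := congrArg (fun x => η (g w) x) ha
    simp only [minkowskiForm_sub_right, minkowskiForm_smul_right, hg _ _, huu, hw.1,
      minkowskiForm_comm w u, mul_zero, sub_zero, zero_sub] at h2 h3
    have ha0 : a = 0 := by
      rcases mul_eq_zero.1 h2.symm with h4 | h4
      · exact h4
      · exact absurd h4 hgu
    rw [ha0, zero_mul, neg_eq_zero] at h3
    rcases mul_eq_zero.1 h3 with h4 | h4
    · exact hgu h4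
    · exact hww.ne' h4

/-- A nonzero positive quadratic form on `𝔬(1,d)` whose radical is the stabilizer of the null line
of `u` cannot be preserved by a transformation that contracts or dilates `u`: iterating it, an
element transverse to the stabilizer would be contracted to zero modulo the stabilizer. -/
theorem abs_eigenvalue_le_one (hd : 2 ≤ d) {u : MinkowskiSpace d} (hu : u ≠ 0) (huu : η u u = 0)
    {Q : lorentzAlgebra d → ℝ} (hQc : Continuous Q) (hQ0 : Q 0 = 0)
    (hQadd : ∀ X Y : lorentzAlgebra d, Y.1 ∈ lineStabilizer u → Q (X + Y) = Q X)
    (hQz : ∀ X : lorentzAlgebra d, Q X = 0 → X.1 ∈ lineStabilizer u)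
    {S : Subgroup (MinkowskiSpace d ≃L[ℝ] MinkowskiSpace d)} (hS : S ≤ lorentzGroup d)
    (hinv : ∀ g ∈ S, ∀ X Y : lorentzAlgebra d, (∀ z, Y.1 (g z) = g (X.1 z)) → Q Y = Q X)
    {g : MinkowskiSpace d ≃L[ℝ] MinkowskiSpace d} (hg : g ∈ S) {χ : ℝ} (hχ : g u = χ • u) :
    |χ| ≤ 1 := by
  by_contra! hχ1
  have hχ0 : χ ≠ 0 := fun h => by rw [h, abs_zero] at hχ1; linarith
  have h0 := null_zero_ne_zero hu huu
  obtain ⟨v, h⟩ := IsNullPair.exists_right hu huu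
  obtain ⟨w, hw, hw0⟩ := h.exists_perp_ne_zero hd
  have hww := h.self_pos hw hw0
  rw [IsNullPair.mem_perp] at hw
  have hpow : ∀ m : ℕ, (g ^ m) u = χ ^ m • u := fun m => by
    induction m with
    | zero => rw [pow_zero, pow_zero, one_smul]; rfl
    | succ m ih => rw [pow_succ, mul_apply_equiv, hχ, map_smul, ih, smul_smul, pow_succ']
  let y : ℕ → MinkowskiSpace d := fun m => (χ ^ m)⁻¹ • (g ^ m) w
  let y' : ℕ → MinkowskiSpace d := fun m => y m - (y m 0 / u 0) • u
  have hpowS : ∀ m, g ^ m ∈ lorentzGroup d := fun m => hS (pow_mem hg m)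
  have hu' : ∀ m, u = (χ ^ m)⁻¹ • (g ^ m) u := fun m => by
    rw [hpow, smul_smul, inv_mul_cancel₀ (pow_ne_zero _ hχ0), one_smul]
  have huy : ∀ m, η u (y m) = 0 := fun m => by
    simp only [y]
    conv_lhs => rw [hu' m]
    simp [hpowS m _ _, hw.1]
  have hQ : ∀ m, Q ⟨wedge v w, wedge_mem _ _⟩ = Q ⟨wedge v (y' m), wedge_mem _ _⟩ := fun m => by
    rw [← hinv (g ^ m) (pow_mem hg m) ⟨wedge v w, wedge_mem _ _⟩
      ⟨wedge ((g ^ m) v) ((g ^ m) w), wedge_mem _ _⟩ fun z => by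
        rw [← conj_wedge (hpowS m), ContinuousLinearEquiv.symm_apply_apply]]
    rw [← hQadd ⟨wedge v (y' m), wedge_mem _ _⟩
      ⟨wedge ((g ^ m) v) ((g ^ m) w) - wedge v (y' m),
        Submodule.sub_mem _ (wedge_mem _ _) (wedge_mem _ _)⟩ ?_]
    · congr 1
      exact Subtype.ext (by simp)
    · refine mem_lineStabilizer.2
        ⟨Submodule.sub_mem _ (wedge_mem _ _) (wedge_mem _ _), -(y m 0 / u 0), ?_⟩
      have h1 : η ((g ^ m) w) u = 0 := by
        conv_lhs => rw [hu' m]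
        simp [hpowS m _ _, minkowskiForm_comm w u, hw.1]
      have h2 : η ((g ^ m) v) u = (χ ^ m)⁻¹ := by
        conv_lhs => rw [hu' m]
        simp [hpowS m _ _, h.prod']
      have h3 : η (y' m) u = 0 := by
        rw [minkowskiForm_comm]; simp [y', huy, huu]
      rw [sub_apply, wedge_apply, wedge_apply, h1, h2, h3, h.prod']
      simp only [y', y]
      module
  have hnorm : ∀ m, ‖y' m‖ = |χ|⁻¹ ^ m * Real.sqrt (η w w) := fun m => by
    have h1 := minkowskiForm_self_of_orthogonal hu huu (huy m)
    have h2 : η (y m) (y m) = (|χ|⁻¹ ^ m * Real.sqrt (η w w)) ^ 2 := by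
      simp only [y, minkowskiForm_smul_left, minkowskiForm_smul_right, hpowS m _ _]
      rw [mul_pow, Real.sq_sqrt hww.le, ← pow_mul, mul_comm m 2, pow_mul, inv_pow, sq_abs,
        inv_pow, ← pow_mul, mul_comm 2 m, pow_mul, sq, mul_inv]
      ring
    rw [h2] at h1
    exact ((sq_eq_sq₀ (by positivity) (norm_nonneg _)).1 h1).symm
  have hlim : Tendsto y' atTop (𝓝 0) := by
    rw [tendsto_zero_iff_norm_tendsto_zero]
    simp only [hnorm]
    have := (tendsto_pow_atTop_nhds_zero_of_lt_one (r := |χ|⁻¹) (by positivity)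
      (inv_lt_one_of_one_lt₀ hχ1)).mul_const (Real.sqrt (η w w))
    rwa [zero_mul] at this
  have hcont : Continuous fun x => Q ⟨wedge v x, wedge_mem _ _⟩ :=
    hQc.comp ((LinearMap.continuous_of_finiteDimensional (wedgeRight v)).subtype_mk _)
  have h1 := (hcont.tendsto 0).comp hlim
  have h2 : Q ⟨wedge v w, wedge_mem _ _⟩ = 0 := by
    have h3 : (fun m => Q ⟨wedge v (y' m), wedge_mem _ _⟩) =
      fun _ => Q ⟨wedge v w, wedge_mem _ _⟩ := funext fun m => (hQ m).symm
    have h4 : Q ⟨wedge v 0, wedge_mem _ _⟩ = 0 := by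
      rw [← hQ0]
      congr 1
      exact Subtype.ext (wedgeRight v).map_zero
    rw [h4] at h1
    change Tendsto (fun m => Q ⟨wedge v (y' m), wedge_mem _ _⟩) _ _ at h1
    rw [h3] at h1
    exact tendsto_nhds_unique tendsto_const_nhds h1
  obtain ⟨-, a, ha⟩ := mem_lineStabilizer.1 (hQz _ h2)
  have h3 := congrArg (fun x => η w x) ha
  simp [wedge_apply, minkowskiForm_comm w u, hw.1, h.prod'] at h3
  exact hww.ne' h3

theorem abs_eigenvalue_eq_one (hd : 2 ≤ d) {u : MinkowskiSpace d} (hu : u ≠ 0) (huu : η u u = 0)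
    {Q : lorentzAlgebra d → ℝ} (hQc : Continuous Q) (hQ0 : Q 0 = 0)
    (hQadd : ∀ X Y : lorentzAlgebra d, Y.1 ∈ lineStabilizer u → Q (X + Y) = Q X)
    (hQz : ∀ X : lorentzAlgebra d, Q X = 0 → X.1 ∈ lineStabilizer u)
    {S : Subgroup (MinkowskiSpace d ≃L[ℝ] MinkowskiSpace d)} (hS : S ≤ lorentzGroup d)
    (hinv : ∀ g ∈ S, ∀ X Y : lorentzAlgebra d, (∀ z, Y.1 (g z) = g (X.1 z)) → Q Y = Q X)
    {g : MinkowskiSpace d ≃L[ℝ] MinkowskiSpace d} (hg : g ∈ S) {χ : ℝ} (hχ : g u = χ • u) :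
    |χ| = 1 := by
  have hχ0 : χ ≠ 0 := by
    rintro rfl
    rw [zero_smul] at hχ
    exact hu (g.map_eq_zero_iff.1 hχ)
  have h1 : g⁻¹ u = χ⁻¹ • u := by
    change g.symm u = _
    rw [ContinuousLinearEquiv.symm_apply_eq, map_smul, hχ, smul_smul, inv_mul_cancel₀ hχ0, one_smul]
  have h2 := abs_eigenvalue_le_one hd hu huu hQc hQ0 hQadd hQz hS hinv hg hχ
  have h3 := abs_eigenvalue_le_one hd hu huu hQc hQ0 hQadd hQz hS hinv (inv_mem hg) h1
  rw [abs_inv] at h3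
  exact le_antisymm h2 ((inv_le_one₀ (abs_pos.2 hχ0)).1 h3)

theorem boost_mem_lineStabilizer {u v : MinkowskiSpace d} (h : IsNullPair u v) :
    wedge u v ∈ lineStabilizer u :=
  mem_lineStabilizer.2 ⟨wedge_mem _ _, 1, by simp [wedge_apply, h.prod', h.left]⟩

/-- A subspace of codimension one in the stabilizer of a null line that annihilates the line is
the whole annihilator. -/
theorem mem_of_annihilates {u : MinkowskiSpace d} (hu : u ≠ 0) (huu : η u u = 0)
    {s : Submodule ℝ (MinkowskiSpace d →L[ℝ] MinkowskiSpace d)} (hs : s ≤ lineStabilizer u)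
    (hsu : ∀ X ∈ s, X u = 0)
    (hdim : Module.finrank ℝ (lineStabilizer u) = Module.finrank ℝ s + 1)
    {X : MinkowskiSpace d →L[ℝ] MinkowskiSpace d} (hX : X ∈ lorentzAlgebra d) (hXu : X u = 0) :
    X ∈ s := by
  let q : Submodule ℝ (MinkowskiSpace d →L[ℝ] MinkowskiSpace d) :=
    lineStabilizer u ⊓ LinearMap.ker (LinearMap.applyₗ u ∘ₗ ContinuousLinearMap.coeLM ℝ)
  have hmem : ∀ X, X ∈ q ↔ X ∈ lineStabilizer u ∧ X u = 0 := fun X => by simp [q]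
  obtain ⟨v, h⟩ := IsNullPair.exists_right hu huu
  have h1 : q < lineStabilizer u := by
    refine lt_of_le_of_ne inf_le_left fun h1 => ?_
    have h2 := boost_mem_lineStabilizer h
    rw [← h1, hmem] at h2
    have h3 := h2.2
    simp [wedge_apply, h.prod', h.left] at h3
    exact hu h3
  have h2 := Submodule.finrank_lt_finrank_of_lt h1
  have h3 : s = q := Submodule.eq_of_le_of_finrank_le (fun Y hY => (hmem Y).2 ⟨hs hY, hsu Y hY⟩)
    (by omega)
  rw [h3, hmem]
  exact ⟨mem_lineStabilizer.2 ⟨hX, 0, by rw [hXu, zero_smul]⟩, hXu⟩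

/-- Modulo the stabilizer of the null line of `u`, the algebra `𝔬(1,d)` is spanned by the
elements `v ∧ w` with `w` orthogonal to `u` and `v`. -/
theorem linear_eq_zero_of_wedge {u v : MinkowskiSpace d} (h : IsNullPair u v)
    {l : lorentzAlgebra d →ₗ[ℝ] ℝ} (hl : ∀ X : lorentzAlgebra d, X.1 ∈ lineStabilizer u → l X = 0)
    (hw : ∀ w ∈ IsNullPair.perp u v, l ⟨wedge v w, wedge_mem _ _⟩ = 0) : l = 0 := by
  ext X
  have hb := h.perp_decomp (X.1 u)
  rw [lorentzAlgebra_apply_self X.2, zero_smul, sub_zero] at hb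
  have h1 := hl (X + ⟨wedge v (X.1 u - η v (X.1 u) • u), wedge_mem _ _⟩)
    (mem_lineStabilizer.2 ⟨Submodule.add_mem _ X.2 (wedge_mem _ _), η v (X.1 u), by
      rw [IsNullPair.mem_perp] at hb
      change X.1 u + wedge v _ u = _
      rw [wedge_apply, minkowskiForm_comm _ u, hb.1, h.prod']
      module⟩)
  rw [map_add, hw _ hb, add_zero] at h1
  rw [h1]; rfl

theorem IsNullPair.exists_perp_orthogonal (hd : 3 ≤ d) {u v : MinkowskiSpace d}
    (h : IsNullPair u v) (w : MinkowskiSpace d) :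
    ∃ w' ∈ IsNullPair.perp u v, w' ≠ 0 ∧ η w w' = 0 := by
  have h1 := h.finrank_perp
  have h2 := LinearMap.finrank_range_add_finrank_ker
    ((minkowskiFunctional w).domRestrict (IsNullPair.perp u v))
  have h3 : Module.finrank ℝ (LinearMap.range
    ((minkowskiFunctional w).domRestrict (IsNullPair.perp u v))) ≤ 1 :=
    (Submodule.finrank_le _).trans (by simp)
  have : Nontrivial (LinearMap.ker ((minkowskiFunctional w).domRestrict (IsNullPair.perp u v))) :=
    Module.nontrivial_of_finrank_pos (R := ℝ) (by omega)
  obtain ⟨w', hw'⟩ := exists_ne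
    (0 : LinearMap.ker ((minkowskiFunctional w).domRestrict (IsNullPair.perp u v)))
  exact ⟨w', w'.1.2, by simpa using hw', w'.2⟩

/-- For `d ≥ 3` the action of the stabilizer of `u` on `𝔬(1,d)` modulo the stabilizer of the line
of `u` has no invariant linear functional. -/
theorem linear_eq_zero_of_three_le (hd : 3 ≤ d) {u : MinkowskiSpace d} (hu : u ≠ 0)
    (huu : η u u = 0) {S : Subgroup (MinkowskiSpace d ≃L[ℝ] MinkowskiSpace d)}
    (hexp : ∀ X ∈ lorentzAlgebra d, X u = 0 → expEquiv X ∈ S)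
    {l : lorentzAlgebra d →ₗ[ℝ] ℝ} (hl : ∀ X : lorentzAlgebra d, X.1 ∈ lineStabilizer u → l X = 0)
    (hinv : ∀ g ∈ S, ∀ X Y : lorentzAlgebra d, (∀ z, Y.1 (g z) = g (X.1 z)) → l Y = l X) :
    l = 0 := by
  obtain ⟨v, h⟩ := IsNullPair.exists_right hu huu
  refine linear_eq_zero_of_wedge h hl fun w hw => ?_
  obtain ⟨w', hw', hw0, hww⟩ := h.exists_perp_orthogonal hd w
  have hpos := h.self_pos hw' hw0
  rw [IsNullPair.mem_perp] at hw hw'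
  have hY : wedge w w' ∈ lorentzAlgebra d := wedge_mem _ _
  have hYu : wedge w w' u = 0 := by
    simp [wedge_apply, minkowskiForm_comm _ u, hw.1, hw'.1]
  -- `v ∧ w` is, up to a factor, the commutator of `w ∧ w'` and `v ∧ w'`
  have h1 : wedge w w' * wedge v w' - wedge v w' * wedge w w' ∈
      (LinearMap.ker l).map (lorentzAlgebra d).subtype := by
    refine commutator_mem_of_exp_conj (wedge v w') fun t X' hX' => ?_
    have ht : t • wedge w w' ∈ lorentzAlgebra d := Submodule.smul_mem _ t hY
    have hX : X' ∈ lorentzAlgebra d :=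
      exists_lorentzAlgebra_conj (expEquiv_mem ht) (wedge_mem v w') hX'
    refine ⟨⟨X', hX⟩ - ⟨wedge v w', wedge_mem _ _⟩, ?_, rfl⟩
    have h2 := hinv _ (hexp _ ht (by rw [smul_apply, hYu, smul_zero])) ⟨_, wedge_mem v w'⟩ ⟨X', hX⟩
      hX'
    exact (map_sub l _ _).trans (sub_eq_zero.2 h2)
  rw [commutator_wedge hY] at h1
  have h2 : wedge (wedge w w' v) w' + wedge v (wedge w w' w') = η w' w' • wedge v w := by
    rw [← wedge_smul_right]
    have h3 : wedge w w' v = 0 := by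
      simp [wedge_apply, minkowskiForm_comm _ v, hw.2, hw'.2]
    have h4 : wedge w w' w' = η w' w' • w := by simp [wedge_apply, hww]
    rw [h3, h4]
    have h5 : wedge 0 w' = 0 := by rw [wedge_swap]; exact neg_eq_zero.2 (wedgeRight w').map_zero
    rw [h5, zero_add]
  rw [h2] at h1
  obtain ⟨X, hX, hXe⟩ := h1
  have h3 : X = η w' w' • (⟨wedge v w, wedge_mem _ _⟩ : lorentzAlgebra d) := Subtype.ext hXe
  have h4 : l X = 0 := hX
  rw [h3, map_smul, smul_eq_mul] at h4
  exact (mul_eq_zero.1 h4).resolve_left hpos.ne'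

/-- A Lorentz transformation preserves or reverses the time orientation of null vectors according
to the sign of the time component of the image of the time vector. -/
theorem timeVector_mul_pos {A : MinkowskiSpace d ≃L[ℝ] MinkowskiSpace d} (hA : A ∈ lorentzGroup d)
    {u : MinkowskiSpace d} (hu : u ≠ 0) (huu : η u u = 0) :
    0 < A (timeVector d) 0 * (A u 0 * u 0) := by
  have h0 := null_zero_ne_zero hu huu
  have h1 : ∀ x : MinkowskiSpace d, η (timeVector d) x = -x 0 := fun x => by
    rw [timeVector, minkowskiForm_single_left]; simp
  have h2 : η (A (timeVector d)) (A u) = -u 0 := by rw [hA, h1]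
  have h3 : η (A (timeVector d)) (A (timeVector d)) = -1 := by
    rw [hA, h1]; simp [timeVector]
  have h4 : η (A u) (A u) = 0 := by rw [hA, huu]
  rw [minkowskiForm_eq_inner] at h2
  rw [LightCone.minkowskiForm_self] at h3 h4
  have h5 := abs_le.1 (abs_real_inner_le_norm (LightCone.spacePart (A (timeVector d)))
    (LightCone.spacePart (A u)))
  generalize A (timeVector d) 0 = a at *
  generalize A u 0 = b at *
  generalize u 0 = c at *
  generalize ‖LightCone.spacePart (A (timeVector d))‖ = p at *
  generalize ‖LightCone.spacePart (A u)‖ = q at *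
  generalize inner ℝ (LightCone.spacePart (A (timeVector d))) (LightCone.spacePart (A u)) = s at *
  have h6 : s ^ 2 ≤ (p * q) ^ 2 := sq_le_sq' h5.1 h5.2
  have h7 : s ^ 2 + b ^ 2 ≤ (a * b) ^ 2 := by
    have : (p * q) ^ 2 = (a ^ 2 - 1) * b ^ 2 := by
      rw [mul_pow]
      have e1 : p ^ 2 = a ^ 2 - 1 := by linarith
      have e2 : q ^ 2 = b ^ 2 := by linarith
      rw [e1, e2]
    nlinarith
  have h8 : c = a * b - s := by linarith
  have h9 : 0 < c ^ 2 := by positivity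
  subst h8
  nlinarith [sq_nonneg b]

/-- For `d = 2`, a Lorentz transformation that preserves `u` up to a sign which differs from that
of its determinant acts on `𝔬(1,2)` modulo the stabilizer of the line of `u` by `-1`. -/
theorem linear_eq_zero_of_two {u : MinkowskiSpace 2} (hu : u ≠ 0) (huu : η u u = 0)
    {l : lorentzAlgebra 2 →ₗ[ℝ] ℝ} (hl : ∀ X : lorentzAlgebra 2, X.1 ∈ lineStabilizer u → l X = 0)
    {g : MinkowskiSpace 2 ≃L[ℝ] MinkowskiSpace 2} (hg : g ∈ lorentzGroup 2) {ε : ℝ}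
    (hε : g u = ε • u) (hε1 : |ε| = 1)
    (hdet : LinearMap.det (g.toLinearEquiv : MinkowskiSpace 2 →ₗ[ℝ] MinkowskiSpace 2) * ε < 0)
    (hinv : ∀ X Y : lorentzAlgebra 2, (∀ z, Y.1 (g z) = g (X.1 z)) → l Y = l X) :
    l = 0 := by
  obtain ⟨v, h⟩ := IsNullPair.exists_right hu huu
  have hεε : ε * ε = 1 := by rw [← abs_mul_abs_self, hε1, one_mul]
  obtain ⟨w, hw, hw0⟩ := h.exists_perp_ne_zero le_rfl
  have hpos := h.self_pos hw hw0
  have hspan : ∀ x ∈ IsNullPair.perp u v, ∃ c : ℝ, x = c • w := fun x hx => by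
    have h1 : Module.finrank ℝ (IsNullPair.perp u v) = 1 := by have := h.finrank_perp; omega
    obtain ⟨c, hc⟩ := (finrank_eq_one_iff_of_nonzero' (⟨w, hw⟩ : IsNullPair.perp u v)
      (by simpa using hw0)).1 h1 ⟨x, hx⟩
    exact ⟨c, (congrArg Subtype.val hc).symm⟩
  have hw' := IsNullPair.mem_perp.1 hw
  have hwu : η w u = 0 := by rw [minkowskiForm_comm, hw'.1]
  have hwv : η w v = 0 := by rw [minkowskiForm_comm, hw'.2]
  -- the images of `w` and `v`
  have hgwu : η u (g w) = 0 := by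
    have h1 := hg u w
    rw [hε, minkowskiForm_smul_left, hw'.1] at h1
    rcases mul_eq_zero.1 h1 with h2 | h2
    · rw [h2] at hεε; simp at hεε
    · exact h2
  have hgvu : η u (g v) = ε := by
    have h1 := hg u v
    rw [hε, minkowskiForm_smul_left, h.prod] at h1
    calc η u (g v) = ε * ε * η u (g v) := by rw [hεε, one_mul]
      _ = ε := by rw [mul_assoc, h1, mul_one]
  obtain ⟨δ, hδ⟩ := hspan _ (h.perp_decomp (g w))
  rw [hgwu, zero_smul, sub_zero] at hδ
  obtain ⟨c, hc⟩ : ∃ c, η v (g w) = c := ⟨_, rfl⟩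
  rw [hc, sub_eq_iff_eq_add] at hδ
  obtain ⟨α, hα⟩ := hspan _ (h.perp_decomp (g v))
  obtain ⟨β, hβ⟩ : ∃ β, η v (g v) = β := ⟨_, rfl⟩
  rw [hgvu, hβ, sub_sub, sub_eq_iff_eq_add] at hα
  have hδδ : δ * δ = 1 := by
    have h1 := hg w w
    rw [hδ] at h1
    simp [hw'.1, hwu, huu] at h1
    exact mul_right_cancel₀ hpos.ne' (by linarith)
  -- if `g` acted trivially then `ε • g` would be unipotent, of positive determinant
  have hεδ : ε * δ ≠ 1 := fun hεδ => by
    have hp : IsNullPair u (ε • g v) := ⟨huu, by simp [hg _ _, h.right], by simp [hgvu, hεε]⟩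
    obtain ⟨a, ha, hav⟩ := exists_unipotent h hp
    have hn := expEquiv_mem_expStabilizer (wedge_mem u a)
      (wedge_left_annihilates huu (IsNullPair.mem_perp.1 ha).1)
    have hnu := expStabilizer_fixes hn
    have hnL := expStabilizer_le_lorentzGroup _ hn
    have hnw : expEquiv (wedge u a) w = ε • g w := by
      obtain ⟨γ, hγ⟩ : ∃ γ : ℝ, expEquiv (wedge u a) w = w + γ • u := by
        rw [exp_wedge_null_apply huu (IsNullPair.mem_perp.1 ha).1, wedge_apply, hw'.1]
        exact ⟨η a w, by module⟩
      have h1 := hnL v w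
      rw [hav, hγ, hw'.2] at h1
      have h2 := hg v w
      rw [hw'.2] at h2
      rw [hγ]
      have h3 : η (g v) u = ε := by rw [minkowskiForm_comm, hgvu]
      rw [hδ] at h2 ⊢
      simp only [minkowskiForm_smul_left, minkowskiForm_add_right, minkowskiForm_smul_right,
        h3] at h1 h2
      have h4 : γ = ε * c := by
        have h6 : δ = ε := by
          calc δ = ε * ε * δ := by rw [hεε, one_mul]
            _ = ε := by rw [mul_assoc, hεδ, mul_one]
        rw [h6] at h2
        linear_combination h1 - h2 - γ * hεε
      rw [h4, smul_add, smul_smul, smul_smul, hεδ, one_smul]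
    have hall : ∀ x, expEquiv (wedge u a) x = ε • g x := fun x => by
      obtain ⟨b, hb⟩ := hspan _ (h.perp_decomp x)
      rw [sub_sub, sub_eq_iff_eq_add] at hb
      rw [hb]
      simp only [map_add, map_smul, hnu, hav, hnw, smul_add, hε, smul_comm ε, smul_smul, mul_assoc,
        hεε, mul_one]
    have h1 := expStabilizer_le_positiveDet _ hn
    rw [mem_positiveDet] at h1
    have h2 : ((expEquiv (wedge u a)).toLinearEquiv : MinkowskiSpace 2 →ₗ[ℝ] MinkowskiSpace 2) =
        ε • (g.toLinearEquiv : MinkowskiSpace 2 →ₗ[ℝ] MinkowskiSpace 2) :=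
      LinearMap.ext fun x => hall x
    rw [h2, LinearMap.det_smul, finrank_euclideanSpace, Fintype.card_fin, pow_succ, pow_two, hεε,
      one_mul] at h1
    linarith
  have hεδ' : ε * δ = -1 := by
    have h1 : (ε * δ - 1) * (ε * δ + 1) = 0 := by
      calc _ = (ε * ε) * (δ * δ) - 1 := by ring
        _ = 0 := by rw [hεε, hδδ]; ring
    rcases mul_eq_zero.1 h1 with h2 | h2
    · exact absurd (sub_eq_zero.1 h2) hεδ
    · linarith
  refine linear_eq_zero_of_wedge h hl fun x hx => ?_
  have hkey : l ⟨wedge v w, wedge_mem _ _⟩ = 0 := by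
    have h1 := hinv ⟨wedge v w, wedge_mem _ _⟩ ⟨wedge (g v) (g w), wedge_mem _ _⟩ fun z => by
      rw [← conj_wedge hg, ContinuousLinearEquiv.symm_apply_apply]
    have h2 := hl (⟨wedge (g v) (g w), wedge_mem _ _⟩ - (ε * δ) • ⟨wedge v w, wedge_mem _ _⟩)
      (mem_lineStabilizer.2 ⟨Submodule.sub_mem _ (wedge_mem _ _)
        (Submodule.smul_mem _ _ (wedge_mem _ _)), -(ε * c), by
          change wedge (g v) (g w) u - (ε * δ) • wedge v w u = _
          simp only [wedge_apply, minkowskiForm_comm _ u, hgwu, hgvu, h.prod, hw'.1]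
          rw [hδ]
          module⟩)
    have h3 := (map_sub l _ _).symm.trans h2
    rw [map_smul, h1, hεδ', smul_eq_mul] at h3
    linarith
  obtain ⟨b, rfl⟩ := hspan x hx
  have h1 : (⟨wedge v (b • w), wedge_mem _ _⟩ : lorentzAlgebra 2) = b • ⟨wedge v w, wedge_mem _ _⟩
      :=
    Subtype.ext (wedge_smul_right b v w)
  rw [h1, map_smul, hkey, smul_zero]

/-- A subspace `k` that is normalized by a subspace `s ≤ k` of codimension at most one is a
subalgebra: brackets of elements of a one-dimensional complement vanish. -/
theorem commutator_mem_of_codim_one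
    {s k : Submodule ℝ (MinkowskiSpace d →L[ℝ] MinkowskiSpace d)} (hsk : s ≤ k)
    (hbr : ∀ X ∈ s, ∀ Y ∈ k, X * Y - Y * X ∈ k)
    (hdim : Module.finrank ℝ k ≤ Module.finrank ℝ s + 1) :
    ∀ X ∈ k, ∀ Y ∈ k, X * Y - Y * X ∈ k := by
  by_cases hks : k ≤ s
  · exact fun X hX => hbr X (hks hX)
  obtain ⟨X₀, hX₀, hX₀s⟩ := SetLike.not_le_iff_exists.1 hks
  have h1 : s < s ⊔ Submodule.span ℝ {X₀} := by
    refine lt_of_le_of_ne le_sup_left fun h => hX₀s ?_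
    rw [h]
    exact Submodule.mem_sup_right (Submodule.mem_span_singleton_self _)
  have h2 := Submodule.finrank_lt_finrank_of_lt h1
  have h3 : s ⊔ Submodule.span ℝ {X₀} = k := Submodule.eq_of_le_of_finrank_le
    (sup_le hsk ((Submodule.span_singleton_le_iff_mem _ _).2 hX₀)) (by omega)
  have hdec : ∀ X ∈ k, ∃ Y ∈ s, ∃ a : ℝ, X = Y + a • X₀ := fun X hX => by
    rw [← h3, Submodule.mem_sup] at hX
    obtain ⟨Y, hY, Z, hZ, rfl⟩ := hX
    obtain ⟨a, rfl⟩ := Submodule.mem_span_singleton.1 hZ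
    exact ⟨Y, hY, a, rfl⟩
  intro X hX Y hY
  obtain ⟨X, hX', a, rfl⟩ := hdec X hX
  obtain ⟨Y, hY', b, rfl⟩ := hdec Y hY
  have h4 : (X + a • X₀) * (Y + b • X₀) - (Y + b • X₀) * (X + a • X₀) =
      (X * Y - Y * X) + b • (X * X₀ - X₀ * X) - a • (Y * X₀ - X₀ * Y) := by
    ext1 z
    simp only [sub_apply, add_apply, smul_apply, mul_apply_eq_comp, map_add, map_smul]
    module
  rw [h4]
  exact k.sub_mem (k.add_mem (hbr _ hX' _ (hsk hY')) (k.smul_mem _ (hbr _ hX' _ hX₀)))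
    (k.smul_mem _ (hbr _ hY' _ hX₀))

/-! ### Stabilizers of points on lightcones and circles -/

/-- A null vector of a positive semidefinite symmetric form is orthogonal to all vectors. -/
theorem bilin_eq_zero_of_self {F : Type*} [AddCommGroup F] [Module ℝ F]
    {B : F →ₗ[ℝ] F →ₗ[ℝ] ℝ} (hsymm : ∀ x y, B x y = B y x) (hpos : ∀ x, 0 ≤ B x x) {y : F}
    (hy : B y y = 0) (x : F) : B x y = 0 := by
  by_contra hxy
  obtain ⟨c, hc⟩ : ∃ c, c * (2 * B x y) = -(B x x + 1) :=
    ⟨-(B x x + 1) / (2 * B x y), div_mul_cancel₀ _ (mul_ne_zero two_ne_zero hxy)⟩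
  have h := hpos (x + c • y)
  simp only [map_add, map_smul, LinearMap.add_apply, LinearMap.smul_apply, smul_eq_mul,
    hsymm y x, hy] at h
  linarith

theorem continuous_bilin_self {F : Type*} [NormedAddCommGroup F] [NormedSpace ℝ F]
    [FiniteDimensional ℝ F] (B : F →ₗ[ℝ] F →ₗ[ℝ] ℝ) : Continuous fun x => B x x := by
  have h : Continuous fun x => LinearMap.toContinuousLinearMap (B x) :=
    LinearMap.continuous_of_finiteDimensional
      ((LinearMap.toContinuousLinearMap (𝕜 := ℝ) (E := F) (F' := ℝ)).toLinearMap ∘ₗ B)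
  exact h.clm_apply continuous_id

/-- The Lie algebra `s` of a stabilizer in `O(1,d)`, contained with codimension at most one in an
invariant subspace `k` of codimension `d - 1`, forces `k` to be the stabilizer of a null line. -/
theorem exists_null_line (hd : 2 ≤ d) {s k : Submodule ℝ (MinkowskiSpace d →L[ℝ] MinkowskiSpace d)}
    (hsk : s ≤ k) (hk : k ≤ lorentzAlgebra d)
    {S : Subgroup (MinkowskiSpace d ≃L[ℝ] MinkowskiSpace d)} (hS : S ≤ lorentzGroup d)
    (hexp : ∀ X ∈ s, expEquiv X ∈ S)
    (hinv : ∀ g ∈ S, ∀ X Y : MinkowskiSpace d →L[ℝ] MinkowskiSpace d, X ∈ k →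
      (∀ z, Y (g z) = g (X z)) → Y ∈ k)
    (hdim : Module.finrank ℝ k + d = Module.finrank ℝ (lorentzAlgebra d) + 1)
    (hdim' : Module.finrank ℝ k ≤ Module.finrank ℝ s + 1) :
    ∃ u : MinkowskiSpace d, u ≠ 0 ∧ η u u = 0 ∧ k = lineStabilizer u ∧
      ∀ g ∈ S, ∃ χ : ℝ, g u = χ • u := by
  have hbr : ∀ X ∈ s, ∀ Y ∈ k, X * Y - Y * X ∈ k := fun X hX Y hY =>
    commutator_mem_of_exp_conj 0 fun t X' hX' => by
      rw [sub_zero]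
      exact hinv _ (hexp _ (s.smul_mem t hX)) Y X' hY hX'
  obtain ⟨u, hu, huu, rfl⟩ := exists_eq_lineStabilizer hd hk
    (commutator_mem_of_codim_one hsk hbr hdim') hdim
  exact ⟨u, hu, huu, rfl, fun g hg => exists_eigenvalue hd hu huu (hS hg) (hinv g hg)⟩

/-- The situation of an orbit of `O(1,d)` that is homothetic to the lightcone: `L` is the
infinitesimal action at a point, `B` the induced tensor, `S₀` the stabilizer and `S` the larger
group of the transformations that preserve `L` and `B`. Then `S` meets the group generated by
exponentials in `S₀`, and no linear functional that vanishes on the null vectors of `B` is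
invariant. -/
theorem stabilizer_of_lightcone (hd : 2 ≤ d) {F : Type*} [AddCommGroup F] [Module ℝ F]
    {L : lorentzAlgebra d →ₗ[ℝ] F} {B : F →ₗ[ℝ] F →ₗ[ℝ] ℝ}
    (hsymm : ∀ x y, B x y = B y x) (hpos : ∀ x, 0 ≤ B x x)
    {S₀ S : Subgroup (MinkowskiSpace d ≃L[ℝ] MinkowskiSpace d)} (hS₀ : S₀ ≤ S)
    (hS : S ≤ lorentzGroup d) (hexp : ∀ X, L X = 0 → expEquiv X.1 ∈ S₀)
    (hinv : ∀ g ∈ S, ∀ X Y : lorentzAlgebra d, (∀ z, Y.1 (g z) = g (X.1 z)) →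
      B (L Y) (L Y) = B (L X) (L X))
    (hdim : Module.finrank ℝ (LinearMap.ker L) + d = Module.finrank ℝ (lorentzAlgebra d))
    {k : Submodule ℝ (lorentzAlgebra d)} (hk : ∀ X, X ∈ k ↔ B (L X) (L X) = 0)
    (hdimk : Module.finrank ℝ k + d = Module.finrank ℝ (lorentzAlgebra d) + 1) :
    (∀ g ∈ S, g ∈ expGroup d → g ∈ S₀) ∧
    ∀ l : lorentzAlgebra d →ₗ[ℝ] ℝ, (∀ X ∈ k, l X = 0) →
      (∀ g ∈ S₀, ∀ X Y : lorentzAlgebra d, (∀ z, Y.1 (g z) = g (X.1 z)) → l Y = l X) →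
      (d = 2 → ∃ A ∈ lorentzGroup d, LinearMap.det (A : MinkowskiSpace d →ₗ[ℝ] MinkowskiSpace d) *
        A (timeVector d) 0 < 0 ∧ ∃ g ∈ expGroup d, g⁻¹ * A ∈ S₀) → l = 0 := by
  have hmap : ∀ (q : Submodule ℝ (lorentzAlgebra d)) (X : lorentzAlgebra d),
      X.1 ∈ q.map (lorentzAlgebra d).subtype ↔ X ∈ q := fun q X =>
    ⟨by rintro ⟨Y, hY, h⟩; rwa [← Subtype.ext h], fun h => ⟨X, h, rfl⟩⟩
  have hfin : ∀ q : Submodule ℝ (lorentzAlgebra d),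
      Module.finrank ℝ (q.map (lorentzAlgebra d).subtype) = Module.finrank ℝ q := fun q =>
    (Submodule.equivMapOfInjective _ Subtype.val_injective q).finrank_eq.symm
  have hle : ∀ q : Submodule ℝ (lorentzAlgebra d), q.map (lorentzAlgebra d).subtype ≤
      lorentzAlgebra d := fun q => Submodule.map_subtype_le _ q
  have hsk : LinearMap.ker L ≤ k := fun X hX => by
    rw [LinearMap.mem_ker] at hX
    rw [hk, hX, map_zero]
  obtain ⟨u, hu, huu, hku, heig⟩ := exists_null_line hd (Submodule.map_mono hsk) (hle k) hS
    (by
      rintro _ ⟨X, hX, rfl⟩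
      exact hS₀ (hexp X hX))
    (by
      rintro g hg _ Y ⟨X, hX, rfl⟩ hXY
      have hY : Y ∈ lorentzAlgebra d := exists_lorentzAlgebra_conj (hS hg) X.2 hXY
      refine ⟨⟨Y, hY⟩, (hk _).2 ?_, rfl⟩
      rw [hinv g hg X ⟨Y, hY⟩ hXY]
      exact (hk X).1 hX)
    (by rw [hfin, hdimk]) (by rw [hfin, hfin]; omega)
  have hku' : ∀ X : lorentzAlgebra d, X.1 ∈ lineStabilizer u ↔ B (L X) (L X) = 0 := fun X => by
    rw [← hku, hmap, hk]
  have hcont : Continuous fun X => B (L X) (L X) :=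
    continuous_bilin_self (LinearMap.mk₂ ℝ (fun X Y => B (L X) (L Y))
      (fun X X' Y => by rw [map_add, map_add, LinearMap.add_apply])
      (fun c X Y => by rw [map_smul, map_smul, LinearMap.smul_apply])
      (fun X Y Y' => by rw [map_add, map_add]) (fun c X Y => by rw [map_smul, map_smul]))
  have habs : ∀ g ∈ S, ∀ χ : ℝ, g u = χ • u → |χ| = 1 := fun g hg χ hχ => by
    refine abs_eigenvalue_eq_one hd hu huu (Q := fun X => B (L X) (L X))
      hcont (by simp) (fun X Y hY => ?_)
      (fun X hX => (hku' X).2 hX) hS hinv hg hχ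
    have h1 := bilin_eq_zero_of_self hsymm hpos ((hku' Y).1 hY)
    simp only [map_add, LinearMap.add_apply, h1, hsymm (L Y) (L X), add_zero]
  have hann : ∀ X ∈ lorentzAlgebra d, X u = 0 → expEquiv X ∈ S₀ := fun X hX hXu => by
    have h1 : X ∈ (LinearMap.ker L).map (lorentzAlgebra d).subtype := by
      refine mem_of_annihilates hu huu (hku ▸ Submodule.map_mono hsk) ?_ ?_ hX hXu
      · rintro _ ⟨Y, hY, rfl⟩
        have hYk : Y.1 ∈ lineStabilizer u := by rw [← hku, hmap]; exact hsk hY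
        obtain ⟨-, a, ha⟩ := mem_lineStabilizer.1 hYk
        have h2 := habs _ (hS₀ (hexp Y hY)) (Real.exp a) (exp_apply_eigenvector ha)
        rw [Real.abs_exp, Real.exp_eq_one_iff] at h2
        rw [h2, zero_smul] at ha
        exact ha
      · rw [← hku, hfin, hfin]; omega
    obtain ⟨Y, hY, rfl⟩ := h1
    exact hexp Y hY
  have hS₀' : expStabilizer u ≤ S₀ := (Subgroup.closure_le _).2 (by
    rintro _ ⟨X, hX, hXu, rfl⟩
    exact hann X hX hXu)
  refine ⟨fun g hg hge => ?_, fun l hl hlinv hd2 => ?_⟩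
  · obtain ⟨χ, hχ⟩ := heig g hg
    have h1 := habs g hg χ hχ
    rw [abs_of_pos (expGroup_eigenvalue_pos hge hu huu hχ)] at h1
    rw [h1, one_smul] at hχ
    exact hS₀' (mem_expStabilizer hu huu (hS hg) hχ (expGroup_le_positiveDet hge))
  · have hl' : ∀ X : lorentzAlgebra d, X.1 ∈ lineStabilizer u → l X = 0 := fun X hX =>
      hl X ((hk X).2 ((hku' X).1 hX))
    rcases Nat.lt_or_ge 2 d with h3 | h3
    · exact linear_eq_zero_of_three_le h3 hu huu hann hl' hlinv
    obtain rfl : d = 2 := le_antisymm h3 hd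
    obtain ⟨A, hA, hdet, g, hg, hgA⟩ := hd2 rfl
    obtain ⟨ε, hε⟩ := heig _ (hS₀ hgA)
    have hε1 := habs _ (hS₀ hgA) ε hε
    refine linear_eq_zero_of_two hu huu hl' (hS (hS₀ hgA)) hε hε1 ?_ (hlinv _ hgA)
    -- the time orientation of `A` is given by the sign `ε`
    have h0 := null_zero_ne_zero hu huu
    have hAu : A u = g (ε • u) := by
      rw [← hε, mul_apply_equiv]
      exact (g.apply_symm_apply _).symm
    have h1 := timeVector_mul_pos hA hu huu
    have hε0 : ε ≠ 0 := by rintro rfl; simp at hε1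
    have h4 : 0 < A (timeVector 2) 0 * ε := by
      have h5 : ∀ c : ℝ, c ≠ 0 → (0 < g (c • u) 0 ↔ 0 < c * u 0) := fun c hc =>
        expGroup_pos hg (x := c • u) (smul_ne_zero hc hu) (by simp [huu])
      rw [hAu, map_smul] at h1
      have h6 := h5 1 one_ne_zero
      rw [one_smul, one_mul] at h6
      have h7 := h5 (-1) (by norm_num)
      rw [map_smul] at h7
      have h8 : 0 < g u 0 * u 0 := by
        simp only [PiLp.smul_apply, smul_eq_mul] at h7
        rcases lt_or_gt_of_ne h0 with h9 | h9
        · have := h7.2 (by linarith)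
          nlinarith
        · exact mul_pos (h6.2 h9) h9
      simp only [PiLp.smul_apply, smul_eq_mul] at h1
      have h10 : A (timeVector 2) 0 * (ε * g u 0 * u 0) =
        (A (timeVector 2) 0 * ε) * (g u 0 * u 0) := by ring
      rw [h10] at h1
      exact pos_of_mul_pos_left h1 h8.le
    have h5 : LinearMap.det (A.toLinearEquiv : MinkowskiSpace 2 →ₗ[ℝ] MinkowskiSpace 2) =
        LinearMap.det (g.toLinearEquiv : MinkowskiSpace 2 →ₗ[ℝ] MinkowskiSpace 2) *
        LinearMap.det ((g⁻¹ * A).toLinearEquiv : MinkowskiSpace 2 →ₗ[ℝ] MinkowskiSpace 2) := by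
      rw [← det_mul_equiv, mul_inv_cancel_left]
    have h6 := expGroup_le_positiveDet hg
    rw [mem_positiveDet] at h6
    change LinearMap.det (A.toLinearEquiv : MinkowskiSpace 2 →ₗ[ℝ] MinkowskiSpace 2) *
        A (timeVector 2) 0 < 0 at hdet
    rw [h5] at hdet
    generalize LinearMap.det ((g⁻¹ * A).toLinearEquiv :
      MinkowskiSpace 2 →ₗ[ℝ] MinkowskiSpace 2) = D at hdet ⊢
    generalize LinearMap.det (g.toLinearEquiv : MinkowskiSpace 2 →ₗ[ℝ] MinkowskiSpace 2) = D' at *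
    generalize A (timeVector 2) 0 = a at *
    have h7 : D * a < 0 := by
      by_contra! h8
      nlinarith
    by_contra! h8
    have h9 : D * ε * (a * ε) = D * a := by
      calc D * ε * (a * ε) = D * a * (|ε| * |ε|) := by rw [abs_mul_abs_self]; ring
        _ = D * a := by rw [hε1]; ring
    linarith [mul_nonneg h8 h4.le]

/-- The situation of a one-dimensional orbit of `O(1,2)`: `L` is the infinitesimal action at a
point,
`S₀` the stabilizer and `S` a larger group that preserves the kernel of `L`. This kernel is the
stabilizer of a null line, so `S` preserves the line and meets the group generated by exponentials
in `S₀`. -/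
theorem stabilizer_of_circle {F : Type*} [AddCommGroup F] [Module ℝ F]
    {L : lorentzAlgebra 2 →ₗ[ℝ] F}
    {S₀ S : Subgroup (MinkowskiSpace 2 ≃L[ℝ] MinkowskiSpace 2)} (hS₀ : S₀ ≤ S)
    (hS : S ≤ lorentzGroup 2) (hexp : ∀ X, L X = 0 → expEquiv X.1 ∈ S₀)
    (hinv : ∀ g ∈ S, ∀ X Y : lorentzAlgebra 2, (∀ z, Y.1 (g z) = g (X.1 z)) →
      L X = 0 → L Y = 0)
    (hdim : Module.finrank ℝ (LinearMap.ker L) + 1 = Module.finrank ℝ (lorentzAlgebra 2)) :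
    ∀ g ∈ S, g ∈ expGroup 2 → g ∈ S₀ := by
  have hfin : Module.finrank ℝ ((LinearMap.ker L).map (lorentzAlgebra 2).subtype) =
      Module.finrank ℝ (LinearMap.ker L) := 
    (Submodule.equivMapOfInjective _ Subtype.val_injective _).finrank_eq.symm
  have hexp' : ∀ X ∈ (LinearMap.ker L).map (lorentzAlgebra 2).subtype, expEquiv X ∈ S₀ := by
    rintro _ ⟨X, hX, rfl⟩
    exact hexp X hX
  obtain ⟨u, hu, huu, hku, heig⟩ := exists_null_line le_rfl (le_refl
      ((LinearMap.ker L).map (lorentzAlgebra 2).subtype))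
    (Submodule.map_subtype_le _ _) hS
    (fun X hX => hS₀ (hexp' X hX))
    (by
      rintro g hg _ Y ⟨X, hX, rfl⟩ hXY
      have hY : Y ∈ lorentzAlgebra 2 := exists_lorentzAlgebra_conj (hS hg) X.2 hXY
      exact ⟨⟨Y, hY⟩, hinv g hg X ⟨Y, hY⟩ hXY hX, rfl⟩)
    (by rw [hfin]; omega) (by omega)
  rw [hku] at hexp'
  intro g hg hge
  obtain ⟨χ, hχ⟩ := heig g hg
  have hχ0 := expGroup_eigenvalue_pos hge hu huu hχ
  obtain ⟨v, h⟩ := IsNullPair.exists_right hu huu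
  -- a boost with the same eigenvalue as `g`
  have hb : Real.log χ • wedge u v ∈ lineStabilizer u :=
    Submodule.smul_mem _ _ (boost_mem_lineStabilizer h)
  have hbu : expEquiv (Real.log χ • wedge u v) u = χ • u := by
    rw [expEquiv_apply, exp_apply_eigenvector (a := Real.log χ), Real.exp_log hχ0]
    simp [wedge_apply, h.prod', h.left]
  have hbL := (mem_lineStabilizer.1 hb).1
  have h1 : (expEquiv (Real.log χ • wedge u v))⁻¹ * g ∈ expStabilizer u := by
    refine mem_expStabilizer hu huu (mul_mem (inv_mem (expEquiv_mem hbL)) (hS hg)) ?_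
      (expGroup_le_positiveDet (mul_mem (inv_mem (expEquiv_mem_expGroup hbL)) hge))
    change (expEquiv (Real.log χ • wedge u v)).symm (g u) = u
    rw [ContinuousLinearEquiv.symm_apply_eq, hbu, hχ]
  have h2 : expStabilizer u ≤ S₀ := (Subgroup.closure_le _).2 (by
    rintro _ ⟨X, hX, hXu, rfl⟩
    exact hexp' X (mem_lineStabilizer.2 ⟨hX, 0, by rw [hXu, zero_smul]⟩))
  have := mul_mem (hexp' _ hb) (h2 h1)
  rwa [mul_inv_cancel_left] at this

end Algebra

/-! ### Maps of constant rank and local sections -/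

/-- A map of constant rank `r` is locally a function of `r` coordinates, so its local image has
dimension at most `r`. -/
theorem exists_nhds_dimH_image_le {X : Type*} [NormedAddCommGroup X] [NormedSpace ℝ X]
    [FiniteDimensional ℝ X] {Y : Type*} [NormedAddCommGroup Y] [NormedSpace ℝ Y]
    [FiniteDimensional ℝ Y] {f : X → Y} {x₀ : X} {r : ℕ} (hf : ContDiffAt ℝ 1 f x₀)
    (hr : ∀ᶠ x in 𝓝 x₀, Module.finrank ℝ (LinearMap.range (fderiv ℝ f x).toLinearMap) = r) :
    ∃ U ∈ 𝓝 x₀, dimH (f '' U) ≤ r := by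
  have : CompleteSpace X := FiniteDimensional.complete ℝ X
  set D := fderiv ℝ f x₀ with hD
  set R := LinearMap.range D.toLinearMap
  set N := LinearMap.ker D.toLinearMap
  obtain ⟨P, hP⟩ := Submodule.ClosedComplemented.of_finiteDimensional R
  obtain ⟨Q, hQ⟩ := Submodule.ClosedComplemented.of_finiteDimensional N
  have hinj : Function.Injective (((P ∘L D).prod Q).toLinearMap : X →ₗ[ℝ] R × N) := by
    rw [← LinearMap.ker_eq_bot, LinearMap.ker_eq_bot']
    intro x hx
    have h1 : P (D x) = 0 := congrArg Prod.fst hx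
    have h2 : Q x = 0 := congrArg Prod.snd hx
    have h3 := hP ⟨D x, LinearMap.mem_range_self _ x⟩
    rw [h1] at h3
    have h4 : x ∈ N := (congrArg Subtype.val h3).symm
    have h5 := hQ ⟨x, h4⟩
    rw [h2] at h5
    exact (congrArg Subtype.val h5).symm
  have hdim : Module.finrank ℝ X = Module.finrank ℝ (R × N) := by
    rw [Module.finrank_prod, ← LinearMap.finrank_range_add_finrank_ker D.toLinearMap]
  let Ψ' : X ≃L[ℝ] R × N := (LinearMap.linearEquivOfInjective _ hinj hdim).toContinuousLinearEquiv
  let Ψ : X → R × N := fun x => (P (f x), Q x)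
  have hΨ' : HasFDerivAt Ψ (Ψ' : X →L[ℝ] R × N) x₀ :=
    (P.hasFDerivAt.comp x₀ (hf.differentiableAt one_ne_zero).hasFDerivAt).prodMk Q.hasFDerivAt
  have hΨ : ContDiffAt ℝ 1 Ψ x₀ :=
    (P.contDiff.contDiffAt.comp x₀ hf).prodMk Q.contDiff.contDiffAt
  set e := hΨ.toOpenPartialHomeomorph Ψ hΨ' one_ne_zero
  have hx₀ : x₀ ∈ e.source := hΨ.mem_toOpenPartialHomeomorph_source hΨ' one_ne_zero
  have hw₀ : Ψ x₀ ∈ e.target := hΨ.image_mem_toOpenPartialHomeomorph_target hΨ' one_ne_zero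
  have hsymm₀ : e.symm (Ψ x₀) = x₀ := e.left_inv hx₀
  have hφ : ContDiffAt ℝ 1 e.symm (Ψ x₀) := hΨ.to_localInverse hΨ' one_ne_zero
  have hev : ∀ᶠ w in 𝓝 (Ψ x₀), w ∈ e.target ∧ ContDiffAt ℝ 1 e.symm w ∧
      ContDiffAt ℝ 1 f (e.symm w) ∧
      Module.finrank ℝ (LinearMap.range (fderiv ℝ f (e.symm w)).toLinearMap) = r := by
    have h1 : Tendsto e.symm (𝓝 (Ψ x₀)) (𝓝 x₀) := by
      have := hφ.continuousAt.tendsto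
      rwa [hsymm₀] at this
    filter_upwards [e.open_target.mem_nhds hw₀, hφ.eventually (by simp),
      h1.eventually (hf.eventually (by simp)), h1.eventually hr] with w h1 h2 h3 h4
    exact ⟨h1, h2, h3, h4⟩
  obtain ⟨ε, hε, hball⟩ := Metric.eventually_nhds_iff_ball.1 hev
  have hR : Module.finrank ℝ R = r := hr.self_of_nhds
  let g : R × N → Y := fun w => f (e.symm w)
  have hg : ∀ w ∈ Metric.ball (Ψ x₀) ε, ContDiffAt ℝ 1 g w := fun w hw =>
    (hball w hw).2.2.1.comp w (hball w hw).2.1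
  -- the derivative of `g` vanishes in the direction of `N`
  have hg' : ∀ w ∈ Metric.ball (Ψ x₀) ε, ∀ v : N, fderiv ℝ g w (0, v) = 0 := fun w hw v => by
    have hgd := ((hg w hw).differentiableAt one_ne_zero).hasFDerivAt
    have hrange : LinearMap.range (fderiv ℝ g w).toLinearMap ≤
        LinearMap.range (fderiv ℝ f (e.symm w)).toLinearMap := by
      have h1 : fderiv ℝ g w = (fderiv ℝ f (e.symm w)).comp (fderiv ℝ e.symm w) :=
        fderiv_comp w ((hball w hw).2.2.1.differentiableAt one_ne_zero)
          ((hball w hw).2.1.differentiableAt one_ne_zero)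
      rw [h1]
      exact LinearMap.range_comp_le_range _ _
    have hPg : ∀ z, P (fderiv ℝ g w z) = z.1 := by
      have h1 : HasFDerivAt (fun w => P (g w)) (P ∘L fderiv ℝ g w) w :=
        P.hasFDerivAt.comp w hgd
      have h2 : HasFDerivAt (fun w => P (g w)) (ContinuousLinearMap.fst ℝ R N) w := by
        refine (ContinuousLinearMap.fst ℝ R N).hasFDerivAt.congr_of_eventuallyEq ?_
        filter_upwards [e.open_target.mem_nhds (hball w hw).1] with z hz
        exact congrArg Prod.fst (e.right_inv hz)
      intro z
      exact congrArg (fun F : R × N →L[ℝ] R => F z) (h1.unique h2)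
    have h1 := LinearMap.finrank_range_add_finrank_ker
      (P.toLinearMap.domRestrict (LinearMap.range (fderiv ℝ g w).toLinearMap))
    have h2 : LinearMap.range
        (P.toLinearMap.domRestrict (LinearMap.range (fderiv ℝ g w).toLinearMap)) = ⊤ := by
      rw [LinearMap.range_eq_top]
      exact fun a => ⟨⟨fderiv ℝ g w (a, 0), LinearMap.mem_range_self _ _⟩, hPg (a, 0)⟩
    rw [h2, finrank_top, hR] at h1
    have h3 := (Submodule.finrank_mono hrange).trans_eq (hball w hw).2.2.2
    have h4 : LinearMap.ker
        (P.toLinearMap.domRestrict (LinearMap.range (fderiv ℝ g w).toLinearMap)) = ⊥ :=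
      Submodule.finrank_eq_zero.1 (by omega)
    have h5 := LinearMap.ker_eq_bot'.1 h4 ⟨fderiv ℝ g w (0, v), LinearMap.mem_range_self _ _⟩
      (hPg (0, v))
    exact congrArg Subtype.val h5
  have hconst : ∀ w ∈ Metric.ball (Ψ x₀) ε, g w = g (w.1, (Ψ x₀).2) := fun w hw => by
    rw [← ball_prod_same] at hw
    have hmem : ∀ b ∈ Metric.ball (Ψ x₀).2 ε, (w.1, b) ∈ Metric.ball (Ψ x₀) ε := fun b hb => by
      rw [← ball_prod_same]; exact ⟨hw.1, hb⟩
    have hd : ∀ b ∈ Metric.ball (Ψ x₀).2 ε, HasFDerivAt (fun b => g (w.1, b)) 0 b := fun b hb => by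
      have h1 := ((hg _ (hmem b hb)).differentiableAt one_ne_zero).hasFDerivAt.comp b
        ((hasFDerivAt_const w.1 b).prodMk (hasFDerivAt_id b))
      refine h1.congr_fderiv ?_
      ext v
      exact hg' _ (hmem b hb) v
    exact Metric.isOpen_ball.is_const_of_fderiv_eq_zero (𝕜 := ℝ)
      (convex_ball _ _).isPreconnected (fun b hb => (hd b
          hb).differentiableAt.differentiableWithinAt)
      (fun b hb => (hd b hb).fderiv) hw.2 (Metric.mem_ball_self hε)
  refine ⟨e.source ∩ Ψ ⁻¹' Metric.ball (Ψ x₀) ε, inter_mem (e.open_source.mem_nhds hx₀)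
    (hΨ.continuousAt.preimage_mem_nhds (Metric.ball_mem_nhds _ hε)), ?_⟩
  have hsub : f '' (e.source ∩ Ψ ⁻¹' Metric.ball (Ψ x₀) ε) ⊆
      (fun a => g (a, (Ψ x₀).2)) '' Metric.ball (Ψ x₀).1 ε := by
    rintro _ ⟨x, ⟨hx, hxb⟩, rfl⟩
    refine ⟨(Ψ x).1, ?_, ?_⟩
    · have : Ψ x ∈ Metric.ball (Ψ x₀) ε := hxb
      rw [← ball_prod_same] at this
      exact this.1
    · change g ((Ψ x).1, _) = f x
      rw [← hconst _ hxb]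
      exact congrArg f (e.left_inv hx)
  refine (dimH_mono hsub).trans ?_
  have h1 : ContDiffOn ℝ 1 (fun a => g (a, (Ψ x₀).2)) (Metric.ball (Ψ x₀).1 ε) := fun a ha => by
    have h2 : (a, (Ψ x₀).2) ∈ Metric.ball (Ψ x₀) ε := by
      rw [← ball_prod_same]; exact ⟨ha, Metric.mem_ball_self hε⟩
    exact ((hg _ h2).comp a (contDiffAt_id.prodMk contDiffAt_const)).contDiffWithinAt
  refine (h1.dimH_image_le (convex_ball _ _) subset_rfl).trans ?_
  refine (dimH_mono (Set.subset_univ _)).trans_eq ?_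
  rw [Real.dimH_univ_eq_finrank, hR]

theorem finrank_range_comp_equiv {A B C D : Type*} [AddCommGroup A] [Module ℝ A] [AddCommGroup B]
    [Module ℝ B] [AddCommGroup C] [Module ℝ C] [AddCommGroup D] [Module ℝ D] (e₁ : C ≃ₗ[ℝ] D)
    (e₂ : A ≃ₗ[ℝ] B) (f : B →ₗ[ℝ] C) :
    Module.finrank ℝ (LinearMap.range (e₁.toLinearMap ∘ₗ f ∘ₗ e₂.toLinearMap)) =
      Module.finrank ℝ (LinearMap.range f) := by
  rw [LinearMap.range_comp, LinearMap.range_comp_of_range_eq_top _ e₂.range]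
  exact e₁.finrank_map_eq _

section Submersion

variable {E₁ : Type*} [NormedAddCommGroup E₁] [NormedSpace ℝ E₁] [FiniteDimensional ℝ E₁]
  {X : Type*} [TopologicalSpace X] [ChartedSpace E₁ X] [IsManifold 𝓘(ℝ, E₁) ∞ X]
  {E₂ : Type*} [NormedAddCommGroup E₂] [NormedSpace ℝ E₂] [FiniteDimensional ℝ E₂]
  {Y : Type*} [TopologicalSpace Y] [ChartedSpace E₂ Y] [IsManifold 𝓘(ℝ, E₂) ∞ Y]

/-- A smooth surjective map of constant rank defined on a second countable manifold is a
submersion. -/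
theorem mfderiv_surjective_of_rank_eq [SecondCountableTopology X] {f : X → Y}
    (hf : ContMDiff 𝓘(ℝ, E₁) 𝓘(ℝ, E₂) ∞ f) (hsurj : Function.Surjective f) {r : ℕ}
    (hr : ∀ x, Module.finrank ℝ (LinearMap.range
      (mfderiv 𝓘(ℝ, E₁) 𝓘(ℝ, E₂) f x).toLinearMap) = r) (x₀ : X) :
    Function.Surjective (mfderiv 𝓘(ℝ, E₁) 𝓘(ℝ, E₂) f x₀) := by
  have : CompleteSpace E₂ := FiniteDimensional.complete ℝ E₂
  let ψ := extChartAt 𝓘(ℝ, E₂) (f x₀)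
  let W := f ⁻¹' (chartAt E₂ (f x₀)).source
  have hW : IsOpen W := (chartAt E₂ (f x₀)).open_source.preimage hf.continuous
  have hloc : ∀ x ∈ W, ∃ U ∈ 𝓝[W] x, dimH (ψ '' (f '' (U ∩ W))) ≤ r := fun x hx => by
    let φ := extChartAt 𝓘(ℝ, E₁) x
    let F : E₁ → E₂ := fun z => ψ (f (φ.symm z))
    have hφx : φ.symm (φ x) = x := extChartAt_to_inv x
    have hcont : ContinuousAt φ.symm (φ x) := continuousAt_extChartAt_symm x
    have hev : ∀ᶠ z in 𝓝 (φ x), z ∈ φ.target ∧ φ.symm z ∈ W := by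
      refine Filter.Eventually.and (extChartAt_target_mem_nhds x) (hcont.eventually ?_)
      rw [hφx]
      exact hW.mem_nhds hx
    have hmd : ∀ z, z ∈ φ.target ∧ φ.symm z ∈ W →
        ContMDiffAt 𝓘(ℝ, E₁) 𝓘(ℝ, E₂) ∞ F z ∧ mfderiv 𝓘(ℝ, E₁) 𝓘(ℝ, E₂) F z =
          (mfderiv 𝓘(ℝ, E₂) 𝓘(ℝ, E₂) ψ (f (φ.symm z))) ∘L
          (mfderiv 𝓘(ℝ, E₁) 𝓘(ℝ, E₂) f (φ.symm z)) ∘L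
          (mfderiv 𝓘(ℝ, E₁) 𝓘(ℝ, E₁) φ.symm z) := fun z hz => by
      have h1 : ContMDiffAt 𝓘(ℝ, E₁) 𝓘(ℝ, E₁) ∞ φ.symm z :=
        (contMDiffOn_extChartAt_symm x).contMDiffAt
          ((isOpen_extChartAt_target x).mem_nhds hz.1)
      have h2 : ContMDiffAt 𝓘(ℝ, E₂) 𝓘(ℝ, E₂) ∞ ψ (f (φ.symm z)) :=
        contMDiffAt_extChartAt' hz.2
      have h3 := hf.contMDiffAt (x := φ.symm z)
      refine ⟨h2.comp z (h3.comp z h1), ?_⟩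
      have h4 := h3.comp z h1
      have e1 := mfderiv_comp z (h2.mdifferentiableAt (by simp)) (h4.mdifferentiableAt (by simp))
      have e2 := mfderiv_comp z (h3.mdifferentiableAt (by simp)) (h1.mdifferentiableAt (by simp))
      change mfderiv _ _ (ψ ∘ (f ∘ φ.symm)) z = _
      rw [e1, e2]
      rfl
    have hF : ContDiffAt ℝ 1 F (φ x) :=
      ((hmd _ hev.self_of_nhds).1.of_le (by simp)).contDiffAt
    obtain ⟨U, hU, hUd⟩ := exists_nhds_dimH_image_le (r := r) hF (by
      filter_upwards [hev] with z hz
      rw [← mfderiv_eq_fderiv, (hmd z hz).2, ← hr (φ.symm z)]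
      have h1 : (mfderiv 𝓘(ℝ, E₂) 𝓘(ℝ, E₂) ψ (f (φ.symm z))).IsInvertible :=
        isInvertible_mfderiv_extChartAt (by rw [extChartAt_source]; exact hz.2)
      have h2 : (mfderiv 𝓘(ℝ, E₁) 𝓘(ℝ, E₁) φ.symm z).IsInvertible := by
        have := isInvertible_mfderivWithin_extChartAt_symm (I := 𝓘(ℝ, E₁)) hz.1
        rwa [modelWithCornersSelf_coe, Set.range_id, mfderivWithin_univ] at this
      obtain ⟨e1, he1⟩ := h1
      obtain ⟨e2, he2⟩ := h2
      rw [← he1, ← he2]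
      exact finrank_range_comp_equiv e1.toLinearEquiv e2.toLinearEquiv
        (mfderiv 𝓘(ℝ, E₁) 𝓘(ℝ, E₂) f (φ.symm z)).toLinearMap)
    refine ⟨φ ⁻¹' U ∩ φ.source, mem_nhdsWithin_of_mem_nhds (inter_mem
      ((continuousAt_extChartAt x).preimage_mem_nhds hU) (extChartAt_source_mem_nhds x)), ?_⟩
    refine (dimH_mono ?_).trans hUd
    rintro _ ⟨_, ⟨y, ⟨⟨hyU, hys⟩, hyW⟩, rfl⟩, rfl⟩
    exact ⟨φ y, hyU, by simp only [F]; rw [φ.left_inv hys]⟩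
  choose! U hU hUd using hloc
  obtain ⟨t, htW, htc, hcover⟩ := TopologicalSpace.countable_cover_nhdsWithin hU
  have h1 : ψ '' (f '' W) ⊆ ⋃ x ∈ t, ψ '' (f '' (U x ∩ W)) := by
    rintro _ ⟨_, ⟨x, hx, rfl⟩, rfl⟩
    obtain ⟨y, hy, hxy⟩ := Set.mem_iUnion₂.1 (hcover hx)
    exact Set.mem_iUnion₂.2 ⟨y, hy, _, ⟨x, ⟨hxy, hx⟩, rfl⟩, rfl⟩
  have h2 : ψ '' (f '' W) ∈ 𝓝 (ψ (f x₀)) := by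
    rw [Set.image_preimage_eq _ hsurj, ← extChartAt_source 𝓘(ℝ, E₂) (f x₀),
      (extChartAt 𝓘(ℝ, E₂) (f x₀)).image_source_eq_target]
    exact extChartAt_target_mem_nhds (f x₀)
  have h3 : (Module.finrank ℝ E₂ : ENNReal) ≤ r := by
    rw [← Real.dimH_of_mem_nhds h2]
    refine (dimH_mono h1).trans ?_
    rw [dimH_bUnion htc]
    exact iSup₂_le fun x hx => hUd x (htW hx)
  have h4 : LinearMap.range (mfderiv 𝓘(ℝ, E₁) 𝓘(ℝ, E₂) f x₀).toLinearMap = ⊤ :=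
    have : FiniteDimensional ℝ (TangentSpace 𝓘(ℝ, E₂) (f x₀)) := inferInstanceAs
      (FiniteDimensional ℝ E₂)
    Submodule.eq_top_of_finrank_eq (le_antisymm (Submodule.finrank_le _)
      ((Nat.cast_le.1 h3).trans_eq (hr x₀).symm))
  exact LinearMap.range_eq_top.1 h4

end Submersion

section LocalSection

variable {E₁ : Type*} [NormedAddCommGroup E₁] [NormedSpace ℝ E₁]
  {X : Type*} [TopologicalSpace X] [ChartedSpace E₁ X] [IsManifold 𝓘(ℝ, E₁) ∞ X]
  {E₂ : Type*} [NormedAddCommGroup E₂] [NormedSpace ℝ E₂] [FiniteDimensional ℝ E₂]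
  {Y : Type*} [TopologicalSpace Y] [ChartedSpace E₂ Y]

/-- A map that is a submersion at `x₀` has a smooth local section through `x₀`. -/
theorem exists_local_section {f : X → Y} {x₀ : X} (hf : ContMDiffAt 𝓘(ℝ, E₁) 𝓘(ℝ, E₂) ∞ f x₀)
    (hs : Function.Surjective (mfderiv 𝓘(ℝ, E₁) 𝓘(ℝ, E₂) f x₀)) :
    ∃ σ : Y → X, ContMDiffAt 𝓘(ℝ, E₂) 𝓘(ℝ, E₁) ∞ σ (f x₀) ∧ σ (f x₀) = x₀ ∧
      ∀ᶠ y in 𝓝 (f x₀), f (σ y) = y := by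
  have : CompleteSpace E₂ := FiniteDimensional.complete ℝ E₂
  let ψ := extChartAt 𝓘(ℝ, E₂) (f x₀)
  let φ := extChartAt 𝓘(ℝ, E₁) x₀
  let F : E₁ → E₂ := fun z => ψ (f (φ.symm z))
  have hφ₀ : φ.symm (φ x₀) = x₀ := extChartAt_to_inv x₀
  have hF : ContDiffAt ℝ ∞ F (φ x₀) := by
    have := (contMDiffAt_iff.1 hf).2
    rwa [modelWithCornersSelf_coe, Set.range_id, contDiffWithinAt_univ] at this
  let D : E₁ →L[ℝ] E₂ := mfderiv 𝓘(ℝ, E₁) 𝓘(ℝ, E₂) f x₀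
  have hD : HasFDerivAt F D (φ x₀) := by
    have : HasFDerivWithinAt F D (Set.range 𝓘(ℝ, E₁)) (φ x₀) :=
      (hf.mdifferentiableAt (by simp)).hasMFDerivAt.2
    rwa [modelWithCornersSelf_coe, Set.range_id, hasFDerivWithinAt_univ] at this
  obtain ⟨R₀, hR₀⟩ := D.toLinearMap.exists_rightInverse_of_surjective (LinearMap.range_eq_top.2 hs)
  let R : E₂ →L[ℝ] E₁ := LinearMap.toContinuousLinearMap R₀
  have hR : ∀ v, D (R v) = v := fun v => congrArg (fun l : E₂ →ₗ[ℝ] E₂ => l v) hR₀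
  let k : E₂ → E₂ := fun w => F (φ x₀ + R w)
  have hz : φ x₀ + R 0 = φ x₀ := by rw [map_zero, add_zero]
  have hk : ContDiffAt ℝ ∞ k 0 := by
    refine ContDiffAt.comp (g := F) 0 ?_ (contDiffAt_const.add R.contDiff.contDiffAt)
    rwa [hz]
  have hk' : HasFDerivAt k ((ContinuousLinearEquiv.refl ℝ E₂ : E₂ ≃L[ℝ] E₂) : E₂ →L[ℝ] E₂) 0 := by
    have h1 : HasFDerivAt (fun w => φ x₀ + R w) R 0 := R.hasFDerivAt.const_add _
    have h2 : HasFDerivAt F D (φ x₀ + R 0) := by rwa [hz]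
    refine (h2.comp 0 h1).congr_fderiv ?_
    ext v
    exact hR v
  have hk0 : k 0 = ψ (f x₀) := by simp only [k, F, hz, hφ₀]
  let g : E₂ → E₂ := hk.localInverse hk' (by simp)
  have hg : ContDiffAt ℝ ∞ g (ψ (f x₀)) := by
    rw [← hk0]; exact hk.to_localInverse hk' (by simp)
  have hg0 : g (ψ (f x₀)) = 0 := by
    rw [← hk0]; exact hk.localInverse_apply_image hk' (by simp)
  have hgk : ∀ᶠ w in 𝓝 (ψ (f x₀)), k (g w) = w := by
    rw [← hk0]
    exact (hk.hasStrictFDerivAt' hk' (by simp)).eventually_right_inverse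
  have hψ : ContMDiffAt 𝓘(ℝ, E₂) 𝓘(ℝ, E₂) ∞ ψ (f x₀) := contMDiffAt_extChartAt
  let σ : Y → X := fun y => φ.symm (φ x₀ + R (g (ψ y)))
  have hσ₀ : σ (f x₀) = x₀ := by simp only [σ, hg0, hz, hφ₀]
  have hσ : ContMDiffAt 𝓘(ℝ, E₂) 𝓘(ℝ, E₁) ∞ σ (f x₀) := by
    have h1 : ContDiffAt ℝ ∞ (fun w => φ x₀ + R (g w)) (ψ (f x₀)) :=
      contDiffAt_const.add (R.contDiff.contDiffAt.comp _ hg)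
    have h2 : ContMDiffAt 𝓘(ℝ, E₂) 𝓘(ℝ, E₁) ∞ (fun y => φ x₀ + R (g (ψ y))) (f x₀) :=
      h1.contMDiffAt.comp (f x₀) hψ
    refine ContMDiffAt.comp (f x₀) ?_ h2
    rw [hg0, hz]
    exact (contMDiffOn_extChartAt_symm x₀).contMDiffAt (extChartAt_target_mem_nhds x₀)
  refine ⟨σ, hσ, hσ₀, ?_⟩
  have hfσ : Tendsto (fun y => f (σ y)) (𝓝 (f x₀)) (𝓝 (f x₀)) := by
    have h1 := hσ.continuousAt.tendsto
    rw [hσ₀] at h1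
    exact hf.continuousAt.tendsto.comp h1
  filter_upwards [hψ.continuousAt.eventually hgk, hfσ (extChartAt_source_mem_nhds (I := 𝓘(ℝ, E₂))
      _),
    extChartAt_source_mem_nhds (I := 𝓘(ℝ, E₂)) (f x₀)] with y h1 h2 h3
  exact ψ.injOn h2 h3 h1

theorem image_mem_nhds_of_mfderiv_surjective {f : X → Y} {x₀ : X}
    (hf : ContMDiffAt 𝓘(ℝ, E₁) 𝓘(ℝ, E₂) ∞ f x₀)
    (hs : Function.Surjective (mfderiv 𝓘(ℝ, E₁) 𝓘(ℝ, E₂) f x₀)) : Set.range f ∈ 𝓝 (f x₀) := by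
  obtain ⟨σ, -, -, hσ⟩ := exists_local_section hf hs
  filter_upwards [hσ] with y hy
  exact ⟨σ y, hy⟩

/-- Smooth functions descend along surjective submersions. -/
theorem contMDiff_of_comp_submersion {f : X → Y} (hf : ContMDiff 𝓘(ℝ, E₁) 𝓘(ℝ, E₂) ∞ f)
    (hsurj : Function.Surjective f)
    (hs : ∀ x, Function.Surjective (mfderiv 𝓘(ℝ, E₁) 𝓘(ℝ, E₂) f x))
    {E₃ : Type*} [NormedAddCommGroup E₃] [NormedSpace ℝ E₃] {Z : Type*} [TopologicalSpace Z]
    [ChartedSpace E₃ Z] {g : Y → Z}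
    (hg : ContMDiff 𝓘(ℝ, E₁) 𝓘(ℝ, E₃) ∞ fun x => g (f x)) :
    ContMDiff 𝓘(ℝ, E₂) 𝓘(ℝ, E₃) ∞ g := fun y => by
  obtain ⟨x, rfl⟩ := hsurj y
  obtain ⟨σ, hσ, hσx, hev⟩ := exists_local_section hf.contMDiffAt (hs x)
  refine (ContMDiffAt.comp (f x) (hg.contMDiffAt (x := σ (f x))) hσ).congr_of_eventuallyEq ?_
  filter_upwards [hev] with y hy
  simp only [Function.comp_apply, hy]

theorem finrank_range_le_of_intertwine {f₁ f₂ : E₁ →L[ℝ] E₂}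
    {a : E₁ →L[ℝ] E₁} {b b' : E₂ →L[ℝ] E₂} (h : f₂ ∘L a = b ∘L f₁) (hb : ∀ v, b' (b v) = v) :
    Module.finrank ℝ (LinearMap.range f₁.toLinearMap) ≤
      Module.finrank ℝ (LinearMap.range f₂.toLinearMap) := by
  have h1 := (Submodule.equivMapOfInjective b.toLinearMap (Function.LeftInverse.injective hb)
    (LinearMap.range f₁.toLinearMap)).finrank_eq
  rw [h1, ← LinearMap.range_comp, ← ContinuousLinearMap.toLinearMap_comp, ← h]
  exact Submodule.finrank_mono (LinearMap.range_comp_le_range _ _)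

/-- The rank of a map does not decrease along a symmetry. -/
theorem finrank_range_mfderiv_le_of_equivariant {f : X → Y}
    (hf : ContMDiff 𝓘(ℝ, E₁) 𝓘(ℝ, E₂) ∞ f) {α : X → X} {β β' : Y → Y}
    (hα : ContMDiff 𝓘(ℝ, E₁) 𝓘(ℝ, E₁) ∞ α) (hβ : ContMDiff 𝓘(ℝ, E₂) 𝓘(ℝ, E₂) ∞ β)
    (hβ' : ContMDiff 𝓘(ℝ, E₂) 𝓘(ℝ, E₂) ∞ β') (hββ : ∀ y, β' (β y) = y)
    (hαβ : ∀ x, f (α x) = β (f x)) (x : X) :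
    Module.finrank ℝ (LinearMap.range (mfderiv 𝓘(ℝ, E₁) 𝓘(ℝ, E₂) f x).toLinearMap) ≤
      Module.finrank ℝ (LinearMap.range (mfderiv 𝓘(ℝ, E₁) 𝓘(ℝ, E₂) f (α x)).toLinearMap) := by
  have d1 := fun x => (hf.contMDiffAt (x := x)).mdifferentiableAt (by simp)
  have d2 := (hα.contMDiffAt (x := x)).mdifferentiableAt (by simp)
  have d3 := (hβ.contMDiffAt (x := f x)).mdifferentiableAt (by simp)
  have d4 := (hβ'.contMDiffAt (x := β (f x))).mdifferentiableAt (by simp)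
  have e1 : (mfderiv 𝓘(ℝ, E₁) 𝓘(ℝ, E₂) f (α x) : E₁ →L[ℝ] E₂) ∘L
      (mfderiv 𝓘(ℝ, E₁) 𝓘(ℝ, E₁) α x : E₁ →L[ℝ] E₁) =
      (mfderiv 𝓘(ℝ, E₂) 𝓘(ℝ, E₂) β (f x) : E₂ →L[ℝ] E₂) ∘L
        (mfderiv 𝓘(ℝ, E₁) 𝓘(ℝ, E₂) f x : E₁ →L[ℝ] E₂) := by
    have h1 := mfderiv_comp x (d1 _) d2
    have h2 := mfderiv_comp x d3 (d1 x)
    have h3 : f ∘ α = β ∘ f := funext hαβ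
    rw [h3] at h1
    exact h1.symm.trans h2
  have e2 : ∀ v, (mfderiv 𝓘(ℝ, E₂) 𝓘(ℝ, E₂) β' (β (f x)) : E₂ →L[ℝ] E₂)
      ((mfderiv 𝓘(ℝ, E₂) 𝓘(ℝ, E₂) β (f x) : E₂ →L[ℝ] E₂) v) = v := fun v => by
    have h1 := mfderiv_comp (f x) d4 d3
    have h3 : β' ∘ β = id := funext hββ
    rw [h3, mfderiv_id] at h1
    exact (congrArg (fun l : E₂ →L[ℝ] E₂ => l v) h1).symm
  exact finrank_range_le_of_intertwine (E₁ := E₁) (E₂ := E₂) e1 e2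

/-- A curve in a manifold with vanishing derivative is constant. -/
theorem eq_of_mfderiv_eq_zero [T2Space X] {γ : ℝ → X} (hγ : ContMDiff 𝓘(ℝ, ℝ) 𝓘(ℝ, E₁) ∞ γ)
    (h : ∀ t, mfderiv 𝓘(ℝ, ℝ) 𝓘(ℝ, E₁) γ t = 0) (s t : ℝ) : γ s = γ t := by
  have hlc : IsLocallyConstant γ := by
    rw [IsLocallyConstant.iff_eventually_eq]
    intro t
    let φ := extChartAt 𝓘(ℝ, E₁) (γ t)
    have h1 : γ ⁻¹' φ.source ∈ 𝓝 t :=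
      hγ.continuous.continuousAt.preimage_mem_nhds (extChartAt_source_mem_nhds (γ t))
    obtain ⟨ε, hε, hball⟩ := Metric.mem_nhds_iff.1 h1
    have hd : ∀ s ∈ Metric.ball t ε, HasFDerivAt (fun s => φ (γ s)) 0 s := fun s hs => by
      have h2 : MDifferentiableAt 𝓘(ℝ, E₁) 𝓘(ℝ, E₁) φ (γ s) := by
        refine mdifferentiableAt_extChartAt ?_
        rw [← extChartAt_source 𝓘(ℝ, E₁)]; exact hball hs
      have h3 := h2.hasMFDerivAt.comp s
        ((hγ.contMDiffAt (x := s)).mdifferentiableAt (by simp)).hasMFDerivAt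
      rw [h s] at h3
      have h4 := h3.hasFDerivAt
      exact h4.congr_fderiv (by ext; exact map_zero (mfderiv 𝓘(ℝ, E₁) 𝓘(ℝ, E₁) φ (γ s)))
    filter_upwards [Metric.ball_mem_nhds t hε] with s hs
    have h5 := Metric.isOpen_ball.is_const_of_fderiv_eq_zero (𝕜 := ℝ)
      (convex_ball t ε).isPreconnected
      (fun b hb => (hd b hb).differentiableAt.differentiableWithinAt)
      (fun b hb => (hd b hb).fderiv) hs (Metric.mem_ball_self hε)
    exact φ.injOn (hball hs) (hball (Metric.mem_ball_self hε)) h5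
  exact hlc.apply_eq_of_preconnectedSpace s t

end LocalSection

/-! ### The fixed points of a smooth idempotent map -/

section Fixed

variable {E : Type*} [NormedAddCommGroup E] [NormedSpace ℝ E]
  {M : Type*} [TopologicalSpace M] [ChartedSpace E M]
  {F : Type*} [NormedAddCommGroup F] [NormedSpace ℝ F]

/-- A chart `c` of a subspace of a manifold is adapted if it extends to a smooth map `α` on the
manifold around its source and if its inverse is smooth as a map `β` into the manifold. -/
def IsAdaptedChart {p : M → Prop} (c : OpenPartialHomeomorph {x // p x} F) : Prop :=
  ∃ (α : M → F) (β : F → M), (∀ x ∈ c.source, ContMDiffAt 𝓘(ℝ, E) 𝓘(ℝ, F) ∞ α x) ∧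
    (∀ x ∈ c.source, c x = α x) ∧ ContMDiffOn 𝓘(ℝ, F) 𝓘(ℝ, E) ∞ β c.target ∧
    ∀ z ∈ c.target, (c.symm z : M) = β z

/-- A linear idempotent factors through the Euclidean space of the dimension of its range. -/
theorem exists_factorization_of_idempotent [FiniteDimensional ℝ E] {D : E →L[ℝ] E}
    (hD : ∀ v, D (D v) = D v) {k : ℕ}
    (hk : Module.finrank ℝ (LinearMap.range D.toLinearMap) = k) :
    ∃ (A : E →L[ℝ] EuclideanSpace ℝ (Fin k)) (B : EuclideanSpace ℝ (Fin k) →L[ℝ] E),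
      (∀ z, A (B z) = z) ∧ ∀ v, B (A v) = D v := by
  let e : LinearMap.range D.toLinearMap ≃L[ℝ] EuclideanSpace ℝ (Fin k) :=
    ContinuousLinearEquiv.ofFinrankEq (by rw [hk, finrank_euclideanSpace, Fintype.card_fin])
  let A₀ : E →L[ℝ] LinearMap.range D.toLinearMap :=
    D.codRestrict _ fun v => LinearMap.mem_range_self D.toLinearMap v
  refine ⟨(e : _ →L[ℝ] _) ∘L A₀, (Submodule.subtypeL (LinearMap.range D.toLinearMap)) ∘L
    (e.symm : _ →L[ℝ] LinearMap.range D.toLinearMap),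
    fun z => ?_, fun v => ?_⟩
  · have h : A₀ (e.symm z : E) = e.symm z := by
      obtain ⟨v, hv⟩ := (e.symm z).2
      refine Subtype.ext ?_
      change D (e.symm z : E) = e.symm z
      rw [← hv]
      exact hD v
    change e (A₀ (e.symm z : E)) = z
    rw [h, e.apply_symm_apply]
  · change ((e.symm (e (A₀ v)) : LinearMap.range D.toLinearMap) : E) = D v
    rw [e.symm_apply_apply]
    rfl

/-- Cartan's linearization: an idempotent map is conjugate to its derivative near a fixed
point. -/
theorem exists_linearization_of_idempotent [FiniteDimensional ℝ E] {f : E → E} {s : Set E}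
    (hs : IsOpen s) (hf : ContDiffOn ℝ ∞ f s) {z₀ : E} (hz₀ : z₀ ∈ s) (hfz : f z₀ = z₀)
    (hff : ∀ z ∈ s, f (f z) = f z) {D : E →L[ℝ] E} (hD : HasFDerivAt f D z₀) :
    (∀ v, D (D v) = D v) ∧ ∃ g : OpenPartialHomeomorph E E, z₀ ∈ g.source ∧ g.source ⊆ s ∧
      ContDiffOn ℝ ∞ g g.source ∧ ContDiffOn ℝ ∞ g.symm g.target ∧
      ∀ z ∈ g.source, f z ∈ g.source → g (f z) = D (g z) := by
  have : CompleteSpace E := FiniteDimensional.complete ℝ E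
  have hDD : ∀ v, D (D v) = D v := fun v => by
    have h1 : HasFDerivAt f D (f z₀) := by rwa [hfz]
    have h2 := (h1.comp z₀ hD).congr_of_eventuallyEq (f₁ := f) (by
      filter_upwards [hs.mem_nhds hz₀] with z hz using (hff z hz).symm)
    exact (congrArg (fun l : E →L[ℝ] E => l v) (hD.unique h2)).symm
  refine ⟨hDD, ?_⟩
  let G : E → E := fun z => D (f z) + (z - f z) - D (z - f z)
  have hG : ContDiffOn ℝ ∞ G s := by
    have h1 := contDiffOn_id.sub hf
    exact ((D.contDiff.comp_contDiffOn hf).add h1).sub (D.contDiff.comp_contDiffOn h1)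
  have hG' : HasFDerivAt G ((ContinuousLinearEquiv.refl ℝ E : E ≃L[ℝ] E) : E →L[ℝ] E) z₀ := by
    have h1 := (hasFDerivAt_id z₀).sub hD
    refine (((D.hasFDerivAt.comp z₀ hD).add h1).sub (D.hasFDerivAt.comp z₀ h1)).congr_fderiv ?_
    ext v
    simp [hDD]
  have hGat : ContDiffAt ℝ ∞ G z₀ := hG.contDiffAt (hs.mem_nhds hz₀)
  -- the derivative stays invertible near `z₀`
  have hinv : ∀ᶠ z in 𝓝 z₀, fderiv ℝ G z ∈ Set.range ((↑) : (E ≃L[ℝ] E) → E →L[ℝ] E) := by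
    have h1 : ContinuousAt (fderiv ℝ G) z₀ := (hGat.fderiv_right (m := 0) (by simp)).continuousAt
    refine h1.eventually ?_
    rw [hG'.fderiv]
    exact ContinuousLinearEquiv.nhds _
  obtain ⟨t, htsub, hto, hzt⟩ := mem_nhds_iff.1 (inter_mem hinv (hs.mem_nhds hz₀))
  let g := (hGat.toOpenPartialHomeomorph G hG' (by simp)).restrOpen t hto
  have hgs : g.source ⊆ t := fun z hz => hz.2
  have hgst : g.source ⊆ s := fun z hz => (htsub (hgs hz)).2
  refine ⟨g, ⟨hGat.mem_toOpenPartialHomeomorph_source hG' (by simp), hzt⟩, hgst,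
    hG.mono hgst, fun w hw => ?_, fun z hz hfzs => ?_⟩
  · have h1 := g.map_target hw
    obtain ⟨L, hL⟩ := (htsub (hgs h1)).1
    have h2 : ContDiffAt ℝ ∞ G (g.symm w) := hG.contDiffAt (hs.mem_nhds (hgst h1))
    refine (g.contDiffAt_symm hw (f₀' := L) ?_ h2).contDiffWithinAt
    rw [hL]
    exact (h2.differentiableAt (by simp)).hasFDerivAt
  · change G (f z) = D (G z)
    simp only [G, hff z (hgst hz), sub_self, add_zero, sub_zero, map_add, map_sub, hDD]
    abel

/-- The fixed points of a smooth idempotent map have adapted charts. -/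
theorem exists_adapted_chart [FiniteDimensional ℝ E] [IsManifold 𝓘(ℝ, E) ∞ M] {ρ : M → M}
    (hρ : ContMDiff 𝓘(ℝ, E) 𝓘(ℝ, E) ∞ ρ) (hidem : ∀ x, ρ (ρ x) = ρ x) {k : ℕ}
    (y : {x // ρ x = x}) (hk : Module.finrank ℝ (LinearMap.range
      (mfderiv 𝓘(ℝ, E) 𝓘(ℝ, E) ρ y).toLinearMap) = k) :
    ∃ c : OpenPartialHomeomorph {x // ρ x = x} (EuclideanSpace ℝ (Fin k)),
      y ∈ c.source ∧ IsAdaptedChart (E := E) c := by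
  obtain ⟨y, hy⟩ := y
  let φ := chartAt E y
  have hφt : ContMDiffOn 𝓘(ℝ, E) 𝓘(ℝ, E) ∞ φ.symm φ.target := contMDiffOn_chart_symm
  have hφs : ContMDiffOn 𝓘(ℝ, E) 𝓘(ℝ, E) ∞ φ φ.source := contMDiffOn_chart
  have hys : y ∈ φ.source := mem_chart_source E y
  let f : E → E := fun z => φ (ρ (φ.symm z))
  let s : Set E := φ.target ∩ φ.symm ⁻¹' (ρ ⁻¹' φ.source)
  have hs : IsOpen s :=
    φ.isOpen_inter_preimage_symm (φ.open_source.preimage hρ.continuous)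
  have hf : ContDiffOn ℝ ∞ f s := by
    rw [← contMDiffOn_iff_contDiffOn]
    exact hφs.comp (hρ.comp_contMDiffOn (hφt.mono Set.inter_subset_left)) fun z hz => hz.2
  have hsy : φ.symm (φ y) = y := φ.left_inv hys
  have hz₀ : φ y ∈ s := ⟨φ.map_source hys, by
    simp only [Set.mem_preimage, hsy, hy]; exact hys⟩
  have hfz : f (φ y) = φ y := by simp only [f, hsy, hy]
  have hff : ∀ z ∈ s, f (f z) = f z := fun z hz => by
    simp only [f]
    rw [φ.left_inv hz.2, hidem]
  obtain ⟨D, hDm⟩ : ∃ D : E →L[ℝ] E, D = mfderiv 𝓘(ℝ, E) 𝓘(ℝ, E) ρ y := ⟨_, rfl⟩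
  have hDk : Module.finrank ℝ (LinearMap.range D.toLinearMap) = k := by rw [hDm]; exact hk
  have hD : HasFDerivAt f D (φ y) := by
    have h1 : HasFDerivWithinAt (fun z => extChartAt 𝓘(ℝ, E) (ρ y)
        (ρ ((extChartAt 𝓘(ℝ, E) y).symm z))) D (Set.range 𝓘(ℝ, E)) (extChartAt 𝓘(ℝ, E) y y) := by
      rw [hDm]
      exact ((hρ.contMDiffAt (x := y)).mdifferentiableAt (by simp)).hasMFDerivAt.2
    rw [modelWithCornersSelf_coe, Set.range_id, hasFDerivWithinAt_univ, hy] at h1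
    exact h1
  obtain ⟨hDD, g, hzg, hgs, hg, hgsymm, hgf⟩ :=
    exists_linearization_of_idempotent hs hf hz₀ hfz hff hD
  obtain ⟨A, B, hAB, hBA⟩ := exists_factorization_of_idempotent hDD hDk
  let Φ := φ.trans g
  have hΦs : ∀ {x}, x ∈ Φ.source ↔ x ∈ φ.source ∧ φ x ∈ g.source := fun {x} => by
    simp [Φ]
  have hΦt : ∀ {w}, w ∈ Φ.target ↔ w ∈ g.target ∧ g.symm w ∈ φ.target := fun {w} => by
    simp [Φ]
  have hΦρ : ∀ x ∈ Φ.source, ρ x ∈ Φ.source → Φ (ρ x) = D (Φ x) := fun x hx hρx => by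
    rw [hΦs] at hx hρx
    have h1 : f (φ x) = φ (ρ x) := by simp only [f]; rw [φ.left_inv hx.1]
    have h2 := hgf (φ x) hx.2 (by rw [h1]; exact hρx.2)
    rw [h1] at h2
    exact h2
  let T : Set (EuclideanSpace ℝ (Fin k)) :=
    {z | B z ∈ Φ.target ∧ ρ (Φ.symm (B z)) ∈ Φ.source}
  have hfix : ∀ z ∈ T, ρ (Φ.symm (B z)) = Φ.symm (B z) := fun z hz => by
    refine Φ.injOn hz.2 (Φ.map_target hz.1) ?_
    rw [hΦρ _ (Φ.map_target hz.1) hz.2, Φ.right_inv hz.1, ← hBA, hAB]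
  have hBΦ : ∀ x ∈ Φ.source, ρ x = x → B (A (Φ x)) = Φ x := fun x hx hxρ => by
    rw [hBA, ← hΦρ x hx (by rwa [hxρ]), hxρ]
  have hTo : IsOpen T := by
    have h1 : IsOpen (Φ.target ∩ Φ.symm ⁻¹' (ρ ⁻¹' Φ.source)) :=
      Φ.isOpen_inter_preimage_symm (Φ.open_source.preimage hρ.continuous)
    exact h1.preimage B.continuous
  let c : OpenPartialHomeomorph {x // ρ x = x} (EuclideanSpace ℝ (Fin k)) :=
    { toFun := fun x => A (Φ x)
      invFun := fun z => ⟨ρ (Φ.symm (B z)), hidem _⟩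
      source := {x | (x : M) ∈ Φ.source}
      target := T
      map_source' := fun x hx => by
        have h1 := hBΦ x hx x.2
        refine ⟨by rw [h1]; exact Φ.map_source hx, ?_⟩
        rw [h1, Φ.left_inv hx, x.2]
        exact hx
      map_target' := fun z hz => hz.2
      left_inv' := fun x hx => Subtype.ext (by
        change ρ (Φ.symm (B (A (Φ x)))) = x
        rw [hBΦ x hx x.2, Φ.left_inv hx, x.2])
      right_inv' := fun z hz => by
        change A (Φ (ρ (Φ.symm (B z)))) = z
        rw [hfix z hz, Φ.right_inv hz.1, hAB]
      open_source := Φ.open_source.preimage continuous_subtype_val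
      open_target := hTo
      continuousOn_toFun := A.continuous.comp_continuousOn
        (Φ.continuousOn.comp continuous_subtype_val.continuousOn fun x hx => hx)
      continuousOn_invFun := by
        refine (Topology.IsInducing.subtypeVal.continuousOn_iff).2 ?_
        exact hρ.continuous.comp_continuousOn
          (Φ.continuousOn_symm.comp B.continuous.continuousOn fun z hz => hz.1) }
  refine ⟨c, hΦs.2 ⟨hys, hzg⟩, fun x => A (Φ x), fun z => ρ (Φ.symm (B z)), fun x hx => ?_,
    fun x _ => rfl, ?_, fun z _ => rfl⟩
  · have hx' := hΦs.1 hx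
    have h1 : ContMDiffAt 𝓘(ℝ, E) 𝓘(ℝ, E) ∞ g (φ x) :=
      (hg.contDiffAt (g.open_source.mem_nhds hx'.2)).contMDiffAt
    have h2 : ContMDiffAt 𝓘(ℝ, E) 𝓘(ℝ, E) ∞ φ x :=
      hφs.contMDiffAt (φ.open_source.mem_nhds hx'.1)
    exact (A.contDiff.contDiffAt.contMDiffAt).comp (x : M) (h1.comp (x : M) h2)
  · refine hρ.comp_contMDiffOn ?_
    have h1 : ContMDiffOn 𝓘(ℝ, EuclideanSpace ℝ (Fin k)) 𝓘(ℝ, E) ∞ (fun z => g.symm (B z)) T :=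
      (hgsymm.comp B.contDiff.contDiffOn fun z hz => (hΦt.1 hz.1).1).contMDiffOn
    exact hφt.comp h1 fun z hz => (hΦt.1 hz.1).2

/-- The fixed points of a smooth idempotent map of constant rank form a submanifold. -/
theorem exists_chartedSpace_fixed [FiniteDimensional ℝ E] [IsManifold 𝓘(ℝ, E) ∞ M] {ρ : M → M}
    (hρ : ContMDiff 𝓘(ℝ, E) 𝓘(ℝ, E) ∞ ρ) (hidem : ∀ x, ρ (ρ x) = ρ x) {k : ℕ}
    (hk : ∀ x, ρ x = x → Module.finrank ℝ (LinearMap.range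
      (mfderiv 𝓘(ℝ, E) 𝓘(ℝ, E) ρ x).toLinearMap) = k) :
    ∃ _ : ChartedSpace (EuclideanSpace ℝ (Fin k)) {x // ρ x = x},
      IsManifold (𝓡 k) ∞ {x // ρ x = x} ∧
      ContMDiff (𝓡 k) 𝓘(ℝ, E) ∞ (Subtype.val : {x // ρ x = x} → M) ∧
      ContMDiff 𝓘(ℝ, E) (𝓡 k) ∞ (fun x => (⟨ρ x, hidem x⟩ : {x // ρ x = x})) := by
  choose c hc hca using fun y : {x // ρ x = x} => exists_adapted_chart hρ hidem y (hk y y.2)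
  let cs : ChartedSpace (EuclideanSpace ℝ (Fin k)) {x // ρ x = x} :=
    { atlas := Set.range c
      chartAt := c
      mem_chart_source := hc
      chart_mem_atlas := fun y => ⟨y, rfl⟩ }
  have hman : IsManifold (𝓡 k) ∞ {x // ρ x = x} := by
    refine isManifold_of_contDiffOn _ _ _ ?_
    rintro _ _ ⟨y, rfl⟩ ⟨y', rfl⟩
    obtain ⟨α, β, hα, hcα, hβ, hcβ⟩ := hca y
    obtain ⟨α', β', hα', hcα', hβ', hcβ'⟩ := hca y'
    intro z hz
    have hz' : z ∈ (c y).target ∧ (c y).symm z ∈ (c y').source := by simpa using hz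
    have h1 : ContMDiffAt (𝓡 k) (𝓡 k) ∞ (fun z => α' (β z)) z := by
      refine ContMDiffAt.comp z ?_ (hβ.contMDiffAt ((c y).open_target.mem_nhds hz'.1))
      rw [← hcβ z hz'.1]
      exact hα' _ hz'.2
    refine (h1.contDiffAt.contDiffWithinAt).congr_of_eventuallyEq_of_mem ?_ hz
    filter_upwards [self_mem_nhdsWithin] with w hw
    have hw' : w ∈ (c y).target ∧ (c y).symm w ∈ (c y').source := by simpa using hw
    change c y' ((c y).symm w) = α' (β w)
    rw [hcα' _ hw'.2, hcβ w hw'.1]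
  refine ⟨cs, hman, fun y => ?_, fun x => ?_⟩
  · obtain ⟨α, β, hα, hcα, hβ, hcβ⟩ := hca y
    have h1 : ContMDiffAt (𝓡 k) (𝓡 k) ∞ (c y) y :=
      (contMDiffOn_chart (x := y)).contMDiffAt ((c y).open_source.mem_nhds (hc y))
    have h2 : ContMDiffAt (𝓡 k) 𝓘(ℝ, E) ∞ β (c y y) :=
      hβ.contMDiffAt ((c y).open_target.mem_nhds ((c y).map_source (hc y)))
    refine (h2.comp y h1).congr_of_eventuallyEq ?_
    filter_upwards [(c y).open_source.mem_nhds (hc y)] with z hz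
    rw [Function.comp_apply, ← hcβ _ ((c y).map_source hz), (c y).left_inv hz]
  · let y : {x // ρ x = x} := ⟨ρ x, hidem x⟩
    obtain ⟨α, β, hα, hcα, hβ, hcβ⟩ := hca y
    have h1 : ContMDiffAt 𝓘(ℝ, E) (𝓡 k) ∞ (fun x => α (ρ x)) x :=
      ContMDiffAt.comp x (hα y (hc y)) hρ.contMDiffAt
    have hcont : Continuous fun x => (⟨ρ x, hidem x⟩ : {x // ρ x = x}) :=
      hρ.continuous.subtype_mk _
    have h2 : ContMDiffAt (𝓡 k) (𝓡 k) ∞ (c y).symm (α (ρ x)) := by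
      have := (contMDiffOn_chart_symm (I := 𝓡 k) (n := ∞) (x := y)).contMDiffAt
        ((c y).open_target.mem_nhds ((c y).map_source (hc y)))
      rwa [hcα y (hc y)] at this
    refine (h2.comp x h1).congr_of_eventuallyEq ?_
    filter_upwards [hcont.continuousAt.preimage_mem_nhds ((c y).open_source.mem_nhds (hc y))]
      with w hw
    rw [Function.comp_apply, ← hcα ⟨ρ w, hidem w⟩ hw, (c y).left_inv hw]

end Fixed

/-! ### Pulling back a lightlike metric to a Riemannian metric -/

section Pullback

variable {E : Type*} [NormedAddCommGroup E] [NormedSpace ℝ E]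
  {M : Type*} [TopologicalSpace M] [ChartedSpace E M] [IsManifold 𝓘(ℝ, E) ∞ M]

/-- The pullback of the tensor of a lightlike metric under a map. -/
noncomputable def LightlikeMetric.pullback (h : LightlikeMetric E M)
    {F : Type*} [NormedAddCommGroup F] [NormedSpace ℝ F]
    {N : Type*} [TopologicalSpace N] [ChartedSpace F N] (i : N → M) (y : N) :
    TangentSpace 𝓘(ℝ, F) y →L[ℝ] TangentSpace 𝓘(ℝ, F) y →L[ℝ] ℝ :=
  let D : F →L[ℝ] E := mfderiv 𝓘(ℝ, F) 𝓘(ℝ, E) i y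
  let B : E →L[ℝ] E →L[ℝ] ℝ := h.form (i y)
  let P : F →L[ℝ] F →L[ℝ] ℝ := B.bilinearComp D D
  P

theorem LightlikeMetric.pullback_apply (h : LightlikeMetric E M)
    {F : Type*} [NormedAddCommGroup F] [NormedSpace ℝ F]
    {N : Type*} [TopologicalSpace N] [ChartedSpace F N] (i : N → M) (y : N)
    (v w : TangentSpace 𝓘(ℝ, F) y) :
    h.pullback i y v w =
      h.form (i y) (mfderiv 𝓘(ℝ, F) 𝓘(ℝ, E) i y v) (mfderiv 𝓘(ℝ, F) 𝓘(ℝ, E) i y w) := rfl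

/-- A family of bilinear forms on a Euclidean space is smooth if its coefficients are. -/
theorem contMDiffAt_bilinear_of_apply {F : Type*} [NormedAddCommGroup F] [NormedSpace ℝ F]
    {N : Type*} [TopologicalSpace N] [ChartedSpace F N] {k : ℕ}
    {T : N → EuclideanSpace ℝ (Fin k) →L[ℝ] EuclideanSpace ℝ (Fin k) →L[ℝ] ℝ} {y : N}
    (hT : ∀ v w, ContMDiffAt 𝓘(ℝ, F) 𝓘(ℝ, ℝ) ∞ (fun z => T z v w) y) :
    ContMDiffAt 𝓘(ℝ, F) 𝓘(ℝ, EuclideanSpace ℝ (Fin k) →L[ℝ] EuclideanSpace ℝ (Fin k) →L[ℝ] ℝ) ∞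
      T y := by
  have key : T = fun z => ∑ i : Fin k, ∑ j : Fin k,
      (T z (EuclideanSpace.single i 1) (EuclideanSpace.single j 1)) •
        ((EuclideanSpace.proj i : EuclideanSpace ℝ (Fin k) →L[ℝ] ℝ).smulRight
          (EuclideanSpace.proj j : EuclideanSpace ℝ (Fin k) →L[ℝ] ℝ)) := by
    ext z v w
    have hv : ∀ v : EuclideanSpace ℝ (Fin k), v = ∑ i, v i • EuclideanSpace.single i (1 : ℝ) := by
      intro v; ext i
      simp [Finset.sum_apply, Pi.single_apply]
    conv_lhs => rw [hv v, hv w]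
    simp only [map_sum, map_smul, sum_apply, smul_apply,
      smul_eq_mul, ContinuousLinearMap.smulRight_apply, PiLp.proj_apply, Finset.mul_sum]
    rw [Finset.sum_comm]
    refine Finset.sum_congr rfl fun i _ => Finset.sum_congr rfl fun j _ => ?_
    ring
  rw [key]
  refine ContMDiffAt.sum fun i _ => ContMDiffAt.sum fun j _ => ?_
  exact (hT _ _).smul contMDiffAt_const

/-- The pullback of a smooth tensor under a smooth map is smooth. -/
theorem LightlikeMetric.contMDiff_pullback (h : LightlikeMetric E M) {k : ℕ}
    {N : Type*} [TopologicalSpace N] [ChartedSpace (EuclideanSpace ℝ (Fin k)) N]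
    [IsManifold (𝓡 k) ∞ N] {i : N → M} (hi : ContMDiff (𝓡 k) 𝓘(ℝ, E) ∞ i) :
    ContMDiff (𝓡 k) ((𝓡 k).prod 𝓘(ℝ, EuclideanSpace ℝ (Fin k) →L[ℝ]
      EuclideanSpace ℝ (Fin k) →L[ℝ] ℝ)) ∞
    (fun y : N => Bundle.TotalSpace.mk' (EuclideanSpace ℝ (Fin k) →L[ℝ]
      EuclideanSpace ℝ (Fin k) →L[ℝ] ℝ)
      (E := fun y : N => TangentSpace (𝓡 k) y →L[ℝ] TangentSpace (𝓡 k) y →L[ℝ] ℝ) y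
      (h.pullback i y)) := by
  intro y₀
  rw [contMDiffAt_hom_bundle]
  refine ⟨contMDiffAt_id, contMDiffAt_bilinear_of_apply fun v w => ?_⟩
  let e := trivializationAt (EuclideanSpace ℝ (Fin k)) (TangentSpace (𝓡 k)) y₀
  have hy₀ : y₀ ∈ e.baseSet := FiberBundle.mem_baseSet_trivializationAt' y₀
  have hsec : ∀ v : EuclideanSpace ℝ (Fin k), ContMDiffAt (𝓡 k) (𝓡 k).tangent ∞
      (fun y => (⟨y, e.symmL ℝ y v⟩ : TangentBundle (𝓡 k) N)) y₀ := by
    intro v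
    have h2 : ContMDiffAt (𝓡 k) ((𝓡 k).prod 𝓘(ℝ, EuclideanSpace ℝ (Fin k))) ∞
        (fun y : N => Bundle.TotalSpace.mk' (EuclideanSpace ℝ (Fin k))
          (E := Bundle.Trivial N (EuclideanSpace ℝ (Fin k))) y v) y₀ :=
      Bundle.contMDiffAt_totalSpace.2 ⟨contMDiffAt_id, contMDiffAt_const⟩
    exact (e.contMDiffAt_symmL (IB := 𝓡 k) (n := ∞) hy₀).clm_bundle_apply h2
  have hpush : ∀ v : EuclideanSpace ℝ (Fin k), ContMDiffAt (𝓡 k) 𝓘(ℝ, E).tangent ∞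
      (fun y => (⟨i y, mfderiv (𝓡 k) 𝓘(ℝ, E) i y (e.symmL ℝ y v)⟩ : TangentBundle 𝓘(ℝ, E) M))
      y₀ := fun v => ((hi.contMDiff_tangentMap (m := ∞) (by simp)).contMDiffAt).comp y₀ (hsec v)
  have hform := (h.contMDiff (i y₀)).comp y₀ (hi y₀)
  have hres := hform.clm_bundle_apply₂ (F₃ := ℝ) (E₃ := Bundle.Trivial M ℝ) (hpush v) (hpush w)
  have hres2 := (Bundle.contMDiffAt_totalSpace.1 hres).2
  refine hres2.congr_of_eventuallyEq ?_
  filter_upwards [e.open_baseSet.mem_nhds hy₀] with y hy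
  rw [inCoordinates_apply_eq₂ hy hy (Set.mem_univ _)]
  simp only [LightlikeMetric.pullback_apply]
  have hs : ∀ v, e.symmL ℝ y v = e.symm y v := fun v => e.symmL_apply hy v
  rw [hs, hs]
  simp [e]

/-- A positive definite bilinear form on a finite-dimensional space has a bounded unit ball. -/
theorem isVonNBounded_of_posDef {F : Type*} [NormedAddCommGroup F] [NormedSpace ℝ F]
    [FiniteDimensional ℝ F] (B : F →L[ℝ] F →L[ℝ] ℝ) (hpos : ∀ v, v ≠ 0 → 0 < B v v) :
    Bornology.IsVonNBounded ℝ {v : F | B v v < 1} := by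
  have : ProperSpace F := FiniteDimensional.proper ℝ F
  rw [NormedSpace.isVonNBounded_iff, isBounded_iff_forall_norm_le]
  rcases (Metric.sphere (0 : F) 1).eq_empty_or_nonempty with hs | hs
  · refine ⟨0, fun v _ => ?_⟩
    by_contra hv
    have hv : v ≠ 0 := by rintro rfl; simp at hv
    have : ‖v‖⁻¹ • v ∈ Metric.sphere (0 : F) 1 := by simp [norm_smul, hv]
    rw [hs] at this
    exact this
  · obtain ⟨u, hu, hmin⟩ := (isCompact_sphere (0 : F) 1).exists_isMinOn hs
      (f := fun v => B v v) (by fun_prop)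
    have hu0 : u ≠ 0 := by rintro rfl; simp at hu
    have hm := hpos u hu0
    refine ⟨max 1 (B u u)⁻¹, fun v hv => ?_⟩
    by_contra! hlt
    have h1 : 1 < ‖v‖ := lt_of_le_of_lt (le_max_left _ _) hlt
    have h2 : (B u u)⁻¹ < ‖v‖ := lt_of_le_of_lt (le_max_right _ _) hlt
    have hv0 : 0 < ‖v‖ := by linarith
    have hvs : ‖v‖⁻¹ • v ∈ Metric.sphere (0 : F) 1 := by
      simp [norm_smul, hv0.ne']
    have h3 : B u u ≤ B (‖v‖⁻¹ • v) (‖v‖⁻¹ • v) := hmin hvs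
    simp only [map_smul, smul_apply, smul_eq_mul] at h3
    have h4 : B u u * ‖v‖ ^ 2 ≤ B v v := by
      have := mul_le_mul_of_nonneg_right h3 (sq_nonneg ‖v‖)
      refine this.trans_eq ?_
      field_simp
    have h5 : 1 < B u u * ‖v‖ := by
      have := mul_lt_mul_of_pos_left h2 hm
      rwa [mul_inv_cancel₀ hm.ne'] at this
    have h6 : B v v < 1 := hv
    nlinarith

/-- The pullback of a lightlike metric is a Riemannian metric once it is positive definite. -/
noncomputable def LightlikeMetric.riemannianPullback (h : LightlikeMetric E M) {k : ℕ}
    {N : Type*} [TopologicalSpace N] [ChartedSpace (EuclideanSpace ℝ (Fin k)) N]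
    [IsManifold (𝓡 k) ∞ N] {i : N → M} (hi : ContMDiff (𝓡 k) 𝓘(ℝ, E) ∞ i)
    (hpos : ∀ (y : N) (v : TangentSpace (𝓡 k) y), v ≠ 0 → h.pullback i y v v ≠ 0) :
    Bundle.ContMDiffRiemannianMetric (𝓡 k) ∞ (EuclideanSpace ℝ (Fin k))
      (fun y : N => TangentSpace (𝓡 k) y) where
  inner := h.pullback i
  symm _ _ _ := h.symm _ _ _
  pos y v hv := lt_of_le_of_ne (h.nonneg _ _) (hpos y v hv).symm
  isVonNBounded y := isVonNBounded_of_posDef (F := EuclideanSpace ℝ (Fin k)) (h.pullback i y)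
    fun v hv => lt_of_le_of_ne (h.nonneg _ _) (hpos y v hv).symm
  contMDiff := h.contMDiff_pullback hi

theorem LightlikeMetric.form_congr (h : LightlikeMetric E M) {x y : M} (hxy : x = y) (v w : E) :
    (h.form x : E →L[ℝ] E →L[ℝ] ℝ) v w = (h.form y : E →L[ℝ] E →L[ℝ] ℝ) v w := by
  rw [hxy]

/-- A null vector of a positive symmetric form is orthogonal to all vectors. -/
theorem form_eq_zero_of_null {F : Type*} [NormedAddCommGroup F] [NormedSpace ℝ F]
    {B : F →L[ℝ] F →L[ℝ] ℝ} (hsymm : ∀ v w, B v w = B w v) (hpos : ∀ v, 0 ≤ B v v) {v : F}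
    (hv : B v v = 0) (w : F) : B w v = 0 :=
  bilin_eq_zero_of_self (B := (ContinuousLinearMap.coeLM ℝ).comp B.toLinearMap) hsymm hpos hv w

/-- Two null vectors of a positive semidefinite form with a kernel of dimension one are
proportional. -/
theorem exists_smul_eq_of_null {F : Type*} [NormedAddCommGroup F] [NormedSpace ℝ F]
    {B : F →L[ℝ] F →L[ℝ] ℝ} (hsymm : ∀ v w, B v w = B w v) (hpos : ∀ v, 0 ≤ B v v)
    (hdim : Module.finrank ℝ (LinearMap.ker B.toLinearMap) = 1) {v w : F} (hv : B v v = 0)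
    (hw : B w w = 0) (hv0 : v ≠ 0) : ∃ t : ℝ, t • v = w := by
  have hker : ∀ u : F, B u u = 0 → u ∈ LinearMap.ker B.toLinearMap := by
    intro u hu
    rw [LinearMap.mem_ker]
    ext z
    exact (hsymm u z).trans (form_eq_zero_of_null hsymm hpos hu z)
  have hv0' : (⟨v, hker v hv⟩ : LinearMap.ker B.toLinearMap) ≠ 0 := fun h =>
    hv0 (congrArg Subtype.val h)
  obtain ⟨t, ht⟩ := exists_smul_eq_of_finrank_eq_one hdim hv0' ⟨w, hker w hw⟩
  exact ⟨t, congrArg Subtype.val ht⟩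

end Pullback

/-! ### Orbit maps of transitive actions -/

section ChainRule

variable {E₁ : Type*} [NormedAddCommGroup E₁] [NormedSpace ℝ E₁]
  {X : Type*} [TopologicalSpace X] [ChartedSpace E₁ X]
  {E₂ : Type*} [NormedAddCommGroup E₂] [NormedSpace ℝ E₂]
  {Y : Type*} [TopologicalSpace Y] [ChartedSpace E₂ Y]
  {E₃ : Type*} [NormedAddCommGroup E₃] [NormedSpace ℝ E₃]
  {Z : Type*} [TopologicalSpace Z] [ChartedSpace E₃ Z]

/-- The chain rule for a composition that is only known pointwise. -/
theorem mfderiv_apply_of_comp {F : Y → Z} {G : X → Y} {K : X → Z}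
    (hF : ContMDiff 𝓘(ℝ, E₂) 𝓘(ℝ, E₃) ∞ F) (hG : ContMDiff 𝓘(ℝ, E₁) 𝓘(ℝ, E₂) ∞ G)
    (h : ∀ x, F (G x) = K x) {x : X} {y : Y} (hy : G x = y) (v : E₁) :
    (mfderiv 𝓘(ℝ, E₁) 𝓘(ℝ, E₃) K x : E₁ →L[ℝ] E₃) v =
      (mfderiv 𝓘(ℝ, E₂) 𝓘(ℝ, E₃) F y : E₂ →L[ℝ] E₃)
        ((mfderiv 𝓘(ℝ, E₁) 𝓘(ℝ, E₂) G x : E₁ →L[ℝ] E₂) v) := by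
  subst hy
  have h1 : K = F ∘ G := (funext h).symm
  have h2 := mfderiv_comp x ((hF.contMDiffAt (x := G x)).mdifferentiableAt (by simp))
    ((hG.contMDiffAt (x := x)).mdifferentiableAt (by simp))
  rw [h1]
  exact congrArg (fun l : E₁ →L[ℝ] E₃ => l v) h2

theorem mfderiv_apply_of_eq_id {K : X → X} (h : ∀ x, K x = x) (x : X) (v : E₁) :
    (mfderiv 𝓘(ℝ, E₁) 𝓘(ℝ, E₁) K x : E₁ →L[ℝ] E₁) v = v := by
  rw [show K = id from funext h, mfderiv_id]
  rfl

end ChainRule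

section

variable {E₁ : Type*} [NormedAddCommGroup E₁] [NormedSpace ℝ E₁] [FiniteDimensional ℝ E₁]
  {X : Type*} [TopologicalSpace X] [ChartedSpace E₁ X] [IsManifold 𝓘(ℝ, E₁) ∞ X]
  [SecondCountableTopology X] [Group X]
  {E₂ : Type*} [NormedAddCommGroup E₂] [NormedSpace ℝ E₂] [FiniteDimensional ℝ E₂]
  {Y : Type*} [TopologicalSpace Y] [ChartedSpace E₂ Y] [IsManifold 𝓘(ℝ, E₂) ∞ Y]
  {E₃ : Type*} [NormedAddCommGroup E₃] [NormedSpace ℝ E₃] [FiniteDimensional ℝ E₃]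
  {Z : Type*} [TopologicalSpace Z] [ChartedSpace E₃ Z]

/-- A smooth surjective map `φ : X → Y` on a Lie group is a submersion if its composition with an
immersion `ι : Y → Z` is equivariant: `φ` then has constant rank. -/
theorem mfderiv_surjective_of_equivariant {φ : X → Y} {ι : Y → Z}
    (hmul : ∀ a : X, ContMDiff 𝓘(ℝ, E₁) 𝓘(ℝ, E₁) ∞ (fun b => a * b))
    (hφ : ContMDiff 𝓘(ℝ, E₁) 𝓘(ℝ, E₂) ∞ φ) (hsurj : Function.Surjective φ)
    (hι : ContMDiff 𝓘(ℝ, E₂) 𝓘(ℝ, E₃) ∞ ι)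
    (hinj : ∀ y, Function.Injective (mfderiv 𝓘(ℝ, E₂) 𝓘(ℝ, E₃) ι y))
    {β : X → Z → Z} (hβ : ∀ a, ContMDiff 𝓘(ℝ, E₃) 𝓘(ℝ, E₃) ∞ (β a))
    (hββ : ∀ a z, β a⁻¹ (β a z) = z) (heq : ∀ a b, ι (φ (a * b)) = β a (ι (φ b))) (x : X) :
    Function.Surjective (mfderiv 𝓘(ℝ, E₁) 𝓘(ℝ, E₂) φ x) := by
  have hle : ∀ a b : X, Module.finrank ℝ (LinearMap.range
      (mfderiv 𝓘(ℝ, E₁) 𝓘(ℝ, E₃) (fun b => ι (φ b)) b).toLinearMap) ≤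
      Module.finrank ℝ (LinearMap.range
        (mfderiv 𝓘(ℝ, E₁) 𝓘(ℝ, E₃) (fun b => ι (φ b)) (a * b)).toLinearMap) := fun a b =>
    finrank_range_mfderiv_le_of_equivariant (f := fun b => ι (φ b)) (hι.comp hφ) (hmul a)
      (hβ a) (hβ a⁻¹) (hββ a) (heq a) b
  have hrank : ∀ b : X, Module.finrank ℝ (LinearMap.range
      (mfderiv 𝓘(ℝ, E₁) 𝓘(ℝ, E₂) φ b).toLinearMap) = Module.finrank ℝ (LinearMap.range
        (mfderiv 𝓘(ℝ, E₁) 𝓘(ℝ, E₃) (fun b => ι (φ b)) b).toLinearMap) := fun b => by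
    have h1 : (mfderiv 𝓘(ℝ, E₁) 𝓘(ℝ, E₃) (fun b => ι (φ b)) b : E₁ →L[ℝ] E₃) =
        (mfderiv 𝓘(ℝ, E₂) 𝓘(ℝ, E₃) ι (φ b) : E₂ →L[ℝ] E₃) ∘L
          (mfderiv 𝓘(ℝ, E₁) 𝓘(ℝ, E₂) φ b : E₁ →L[ℝ] E₂) :=
      ContinuousLinearMap.ext fun v => mfderiv_apply_of_comp hι hφ (fun _ => rfl) rfl v
    have h2 : LinearMap.range
        (mfderiv 𝓘(ℝ, E₁) 𝓘(ℝ, E₃) (fun b => ι (φ b)) b : E₁ →L[ℝ] E₃).toLinearMap =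
        (LinearMap.range (mfderiv 𝓘(ℝ, E₁) 𝓘(ℝ, E₂) φ b : E₁ →L[ℝ] E₂).toLinearMap).map
          (mfderiv 𝓘(ℝ, E₂) 𝓘(ℝ, E₃) ι (φ b) : E₂ →L[ℝ] E₃).toLinearMap := by
      rw [h1, ContinuousLinearMap.toLinearMap_comp, LinearMap.range_comp]
    have h3 := (Submodule.equivMapOfInjective
      (mfderiv 𝓘(ℝ, E₂) 𝓘(ℝ, E₃) ι (φ b) : E₂ →L[ℝ] E₃).toLinearMap (hinj (φ b))
      (LinearMap.range (mfderiv 𝓘(ℝ, E₁) 𝓘(ℝ, E₂) φ b : E₁ →L[ℝ] E₂).toLinearMap)).finrank_eq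
    rw [← h2] at h3
    exact h3
  refine mfderiv_surjective_of_rank_eq hφ hsurj (fun b => (hrank b).trans (le_antisymm ?_ ?_)) x
    (r := Module.finrank ℝ (LinearMap.range
      (mfderiv 𝓘(ℝ, E₁) 𝓘(ℝ, E₃) (fun b => ι (φ b)) 1).toLinearMap))
  · have := hle b⁻¹ b
    rwa [inv_mul_cancel] at this
  · have := hle b 1
    rwa [mul_one] at this

end

/-- Each element of a product of Lie groups acts by a smooth map. -/
theorem contMDiff_prod_smul {E : Type*} [NormedAddCommGroup E] [NormedSpace ℝ E]
    {M : Type*} [TopologicalSpace M] [ChartedSpace E M]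
    (E₁ : Type*) [NormedAddCommGroup E₁] [NormedSpace ℝ E₁]
    {H : Type*} [Group H] [TopologicalSpace H] [ChartedSpace E₁ H]
    (E₂ : Type*) [NormedAddCommGroup E₂] [NormedSpace ℝ E₂]
    {H' : Type*} [Group H'] [TopologicalSpace H'] [ChartedSpace E₂ H']
    [MulAction (H × H') M]
    [ContMDiffSMul (𝓘(ℝ, E₁).prod 𝓘(ℝ, E₂)) 𝓘(ℝ, E) ∞ (H × H') M] (g : H × H') :
    ContMDiff 𝓘(ℝ, E) 𝓘(ℝ, E) ∞ (fun x : M => g • x) := by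
  have h := ContMDiffSMul.contMDiff_smul (I := 𝓘(ℝ, E₁).prod 𝓘(ℝ, E₂)) (I' := 𝓘(ℝ, E)) (n := ∞)
    (G := H × H') (M := M)
  exact h.comp (contMDiff_const.prodMk contMDiff_id)

section Product

variable {E : Type*} [NormedAddCommGroup E] [NormedSpace ℝ E] [FiniteDimensional ℝ E]
  {M : Type*} [TopologicalSpace M] [ChartedSpace E M] [IsManifold 𝓘(ℝ, E) ∞ M]
  {E₁ : Type*} [NormedAddCommGroup E₁] [NormedSpace ℝ E₁] [FiniteDimensional ℝ E₁]
  {H : Type*} [Group H] [TopologicalSpace H] [SecondCountableTopology H]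
  [ChartedSpace E₁ H] [LieGroup 𝓘(ℝ, E₁) ∞ H]
  {E₂ : Type*} [NormedAddCommGroup E₂] [NormedSpace ℝ E₂] [FiniteDimensional ℝ E₂]
  {H' : Type*} [Group H'] [TopologicalSpace H'] [SecondCountableTopology H']
  [ChartedSpace E₂ H'] [LieGroup 𝓘(ℝ, E₂) ∞ H']
  [MulAction (H × H') M]
  [ContMDiffSMul (𝓘(ℝ, E₁).prod 𝓘(ℝ, E₂)) 𝓘(ℝ, E) ∞ (H × H') M]

/-- A map on a homogeneous space of `H × H'` is smooth if it is smooth when read in the group. -/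
theorem contMDiff_of_comp_orbit_map (htrans : MulAction.IsPretransitive (H × H') M) (p : M)
    {E₃ : Type*} [NormedAddCommGroup E₃] [NormedSpace ℝ E₃] {Z : Type*} [TopologicalSpace Z]
    [ChartedSpace E₃ Z] {f : M → Z}
    (hf : ContMDiff (𝓘(ℝ, E₁).prod 𝓘(ℝ, E₂)) 𝓘(ℝ, E₃) ∞ (fun a : H × H' => f (a • p))) :
    ContMDiff 𝓘(ℝ, E) 𝓘(ℝ, E₃) ∞ f := by
  have hsmul := ContMDiffSMul.contMDiff_smul (I := 𝓘(ℝ, E₁).prod 𝓘(ℝ, E₂)) (I' := 𝓘(ℝ, E))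
    (n := ∞) (G := H × H') (M := M)
  have horb : ContMDiff (𝓘(ℝ, E₁).prod 𝓘(ℝ, E₂)) 𝓘(ℝ, E) ∞ (fun a : H × H' => a • p) :=
    hsmul.comp (contMDiff_id.prodMk contMDiff_const)
  have hmul : ∀ a : H × H', ContMDiff (𝓘(ℝ, E₁).prod 𝓘(ℝ, E₂)) (𝓘(ℝ, E₁).prod 𝓘(ℝ, E₂)) ∞
      (fun b => a * b) := fun a => contMDiff_mul_left
  have hM : IsManifold (𝓘(ℝ, E₁).prod 𝓘(ℝ, E₂)) ∞ (H × H') := inferInstance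
  have hact : ∀ a : H × H', ContMDiff 𝓘(ℝ, E) 𝓘(ℝ, E) ∞ (fun x : M => a • x) :=
    contMDiff_prod_smul E₁ E₂
  let cs : ChartedSpace (E₁ × E₂) (H × H') := prodChartedSpace E₁ H E₂ H'
  have hsurj : Function.Surjective (fun a : H × H' => a • p) := MulAction.surjective_smul _ p
  rw [← modelWithCornersSelf_prod] at horb hf
  simp only [← modelWithCornersSelf_prod] at hmul
  rw [← modelWithCornersSelf_prod] at hM
  let hM' : IsManifold 𝓘(ℝ, E₁ × E₂) ∞ (H × H') := hM
  refine contMDiff_of_comp_submersion (X := H × H') (E₁ := E₁ × E₂) horb hsurj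
    (mfderiv_surjective_of_equivariant (ι := id) (β := fun a x => a • x) hmul horb hsurj
      contMDiff_id (fun y => ?_) hact (fun a z => inv_smul_smul a z)
      fun a b => mul_smul a b p) hf
  rw [mfderiv_id]
  exact Function.injective_id

end Product

/-! ### Splitting a homogeneous lightlike manifold along an orbit -/

section Splitting

variable {E : Type*} [NormedAddCommGroup E] [NormedSpace ℝ E] [FiniteDimensional ℝ E]
  {M : Type*} [TopologicalSpace M] [ChartedSpace E M] [IsManifold 𝓘(ℝ, E) ∞ M]
  {E₁ : Type*} [NormedAddCommGroup E₁] [NormedSpace ℝ E₁] [FiniteDimensional ℝ E₁]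
  {H : Type*} [Group H] [TopologicalSpace H] [SecondCountableTopology H]
  [ChartedSpace E₁ H] [LieGroup 𝓘(ℝ, E₁) ∞ H]
  {E₂ : Type*} [NormedAddCommGroup E₂] [NormedSpace ℝ E₂] [FiniteDimensional ℝ E₂]
  {H' : Type*} [Group H'] [TopologicalSpace H'] [SecondCountableTopology H']
  [ChartedSpace E₂ H'] [LieGroup 𝓘(ℝ, E₂) ∞ H']
  [MulAction (H × H') M]
  [ContMDiffSMul (𝓘(ℝ, E₁).prod 𝓘(ℝ, E₂)) 𝓘(ℝ, E) ∞ (H × H') M]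
  {E₀ : Type*} [NormedAddCommGroup E₀] [NormedSpace ℝ E₀]
  {C : Type*} [TopologicalSpace C] [ChartedSpace E₀ C]

include E₂ in
/-- If the `H`-component of every element of the stabilizer of `p` fixes `p`, then
`(a, b) • p ↦ a • p` and `(a, b) • p ↦ b • p` are well-defined smooth maps. -/
theorem exists_orbit_projections (htrans : MulAction.IsPretransitive (H × H') M) {p : M}
    {ι : C → M} {π : H → C} (hιinj : Function.Injective ι)
    (hπ : ContMDiff 𝓘(ℝ, E₁) 𝓘(ℝ, E₀) ∞ π) (hιπ : ∀ a, ι (π a) = ((a, 1) : H × H') • p)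
    (hstab : ∀ (a : H) (b : H'), (a, b) • p = p → ((a, 1) : H × H') • p = p) :
    ∃ (f : M → C) (ρ : M → M), ContMDiff 𝓘(ℝ, E) 𝓘(ℝ, E₀) ∞ f ∧ ContMDiff 𝓘(ℝ, E) 𝓘(ℝ, E) ∞ ρ ∧
      ∀ (a : H) (b : H'), f ((a, b) • p) = π a ∧ ρ ((a, b) • p) = ((1, b) : H × H') • p := by
  have hsurj : Function.Surjective (fun a : H × H' => a • p) := MulAction.surjective_smul _ p
  choose s hs using hsurj
  have hwd : ∀ (a a' : H) (b b' : H'), (a, b) • p = (a', b') • p →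
      ((a, 1) : H × H') • p = ((a', 1) : H × H') • p ∧
        ((1, b) : H × H') • p = ((1, b') : H × H') • p := by
    intro a a' b b' h
    have h1 : (a'⁻¹ * a, b'⁻¹ * b) • p = p := by
      have : ((a', b') : H × H')⁻¹ • (a, b) • p = p := by rw [h, inv_smul_smul]
      rwa [smul_smul] at this
    have h2 := hstab _ _ h1
    have h3 : ((1, b'⁻¹ * b) : H × H') • p = p := by
      have : ((1, b'⁻¹ * b) : H × H') = (a'⁻¹ * a, b'⁻¹ * b) * (a'⁻¹ * a, 1)⁻¹ := by simp
      rw [this, mul_smul, inv_smul_eq_iff.2 h2.symm, h1]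
    constructor
    · have : ((a, 1) : H × H') = (a', 1) * (a'⁻¹ * a, 1) := by simp
      rw [this, mul_smul, h2]
    · have : ((1, b) : H × H') = (1, b') * (1, b'⁻¹ * b) := by simp
      rw [this, mul_smul, h3]
  let f : M → C := fun x => π (s x).1
  let ρ : M → M := fun x => ((1, (s x).2) : H × H') • p
  have key : ∀ (a : H) (b : H'), f ((a, b) • p) = π a ∧
      ρ ((a, b) • p) = ((1, b) : H × H') • p := by
    intro a b
    have := hwd _ a _ b (hs ((a, b) • p))
    exact ⟨hιinj (by rw [hιπ, hιπ]; exact this.1), this.2⟩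
  refine ⟨f, ρ, ?_, ?_, key⟩
  · refine contMDiff_of_comp_orbit_map (E₁ := E₁) (E₂ := E₂) htrans p ?_
    exact (hπ.comp contMDiff_fst).congr fun a => (key a.1 a.2).1
  · refine contMDiff_of_comp_orbit_map (E₁ := E₁) (E₂ := E₂) htrans p ?_
    have hsmul := ContMDiffSMul.contMDiff_smul (I := 𝓘(ℝ, E₁).prod 𝓘(ℝ, E₂)) (I' := 𝓘(ℝ, E))
      (n := ∞) (G := H × H') (M := M)
    have h1 : ContMDiff (𝓘(ℝ, E₁).prod 𝓘(ℝ, E₂)) 𝓘(ℝ, E) ∞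
        (fun a : H × H' => ((1, a.2) : H × H') • p) :=
      hsmul.comp ((contMDiff_const.prodMk contMDiff_snd).prodMk contMDiff_const)
    exact h1.congr fun a => (key a.1 a.2).2

end Splitting

/-! ### Orbit splittings and the product map -/

/-- The data of a splitting of a homogeneous space `M` of `H × H'`: `ι` maps a manifold `C` onto
the `H`-orbit of `p` and `i` maps a manifold `N` onto the `H'`-orbit of `p`, and `f`, `r` are smooth
left inverses of `ι`, `i` that are constant on the orbits of the other group. -/
structure OrbitSplitting (E : Type*) [NormedAddCommGroup E] [NormedSpace ℝ E]
    {M : Type*} [TopologicalSpace M] [ChartedSpace E M] {H H' : Type*} [Group H] [Group H']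
    [MulAction (H × H') M] (p : M)
    (E₀ : Type*) [NormedAddCommGroup E₀] [NormedSpace ℝ E₀]
    {C : Type*} [TopologicalSpace C] [ChartedSpace E₀ C] (ι : C → M) (π : H → C) (f : M → C)
    (k : ℕ) {N : Type*} [TopologicalSpace N] [ChartedSpace (EuclideanSpace ℝ (Fin k)) N]
    [MulAction H' N] (y₀ : N) (i : N → M) (r : M → N) : Prop where
  smooth_ι : ContMDiff 𝓘(ℝ, E₀) 𝓘(ℝ, E) ∞ ι
  smooth_f : ContMDiff 𝓘(ℝ, E) 𝓘(ℝ, E₀) ∞ f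
  smooth_i : ContMDiff (𝓡 k) 𝓘(ℝ, E) ∞ i
  smooth_r : ContMDiff 𝓘(ℝ, E) (𝓡 k) ∞ r
  surjective : Function.Surjective π
  ι_π (a : H) : ι (π a) = ((a, 1) : H × H') • p
  f_ι (x : C) : f (ι x) = x
  f_smul (b : H') (m : M) : f (((1, b) : H × H') • m) = f m
  r_i (y : N) : r (i y) = y
  r_smul (a : H) (m : M) : r (((a, 1) : H × H') • m) = r m
  i_smul (b : H') (y : N) : i (b • y) = ((1, b) : H × H') • i y
  i_base : i y₀ = p
  transitive (y : N) : ∃ b : H', b • y₀ = y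

namespace OrbitSplitting

section Algebra

variable {E : Type*} [NormedAddCommGroup E] [NormedSpace ℝ E]
  {M : Type*} [TopologicalSpace M] [ChartedSpace E M] {H H' : Type*} [Group H] [Group H']
  [MulAction (H × H') M] {E₀ : Type*} [NormedAddCommGroup E₀] [NormedSpace ℝ E₀]
  {C : Type*} [TopologicalSpace C] [ChartedSpace E₀ C]
  {k : ℕ} {N : Type*} [TopologicalSpace N] [ChartedSpace (EuclideanSpace ℝ (Fin k)) N]
  [MulAction H' N] {p : M} {ι : C → M} {π : H → C} {f : M → C} {y₀ : N} {i : N → M} {r : M → N}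
  (S : OrbitSplitting E (H' := H') p E₀ ι π f k y₀ i r)
include S

theorem ι_π_one : ι (π 1) = p := by rw [S.ι_π, ← Prod.one_eq_mk, one_smul]

theorem f_i (y : N) : f (i y) = π 1 := by
  obtain ⟨b, rfl⟩ := S.transitive y
  rw [S.i_smul, S.f_smul, S.i_base, ← S.ι_π_one, S.f_ι]

theorem f_smul_i (a : H) (y : N) : f (((a, 1) : H × H') • i y) = π a := by
  obtain ⟨b, rfl⟩ := S.transitive y
  have h1 : ((a, 1) : H × H') • i (b • y₀) = ((1, b) : H × H') • ι (π a) := by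
    rw [S.i_smul, S.i_base, S.ι_π, smul_smul, smul_smul]; simp
  rw [h1, S.f_smul, S.f_ι]

theorem ι_f_smul (a : H) (x : C) :
    ι (f (((a, 1) : H × H') • ι x)) = ((a, 1) : H × H') • ι x := by
  obtain ⟨a', rfl⟩ := S.surjective x
  have h1 : ((a, 1) : H × H') • ι (π a') = ι (π (a * a')) := by
    rw [S.ι_π, S.ι_π, smul_smul]; simp
  rw [h1, S.f_ι]

/-- The product map `C × N → M`. -/
theorem exists_product_map (htrans : MulAction.IsPretransitive (H × H') M) :
    ∃ Φ : C × N ≃ M, (∀ m, Φ.symm m = (f m, r m)) ∧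
      (∀ (a : H) (y : N), Φ (π a, y) = ((a, 1) : H × H') • i y) ∧
      ∀ (x : C) (b : H') (y : N), b • y₀ = y → Φ (x, y) = ((1, b) : H × H') • ι x := by
  choose β hβ using S.transitive
  have h1 : ∀ (a : H) (b : H') (y : N), b • y₀ = y →
      ((1, b) : H × H') • ι (π a) = ((a, 1) : H × H') • i y := by
    rintro a b _ rfl
    rw [S.i_smul, S.i_base, S.ι_π, smul_smul, smul_smul]; simp
  refine ⟨⟨fun z => ((1, β z.2) : H × H') • ι z.1, fun m => (f m, r m), ?_, ?_⟩, fun _ => rfl,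
    fun a y => h1 a _ y (hβ y), ?_⟩
  · rintro ⟨x, y⟩
    obtain ⟨a, rfl⟩ := S.surjective x
    simp only [h1 a _ y (hβ y), S.f_smul_i, S.r_smul, S.r_i]
  · intro m
    obtain ⟨⟨a, b⟩, rfl⟩ := htrans.exists_smul_eq p m
    have h2 : ((a, b) : H × H') • p = ((a, 1) : H × H') • i (b • y₀) := by
      rw [S.i_smul, S.i_base, smul_smul]; simp
    simp only [h2, S.f_smul_i, S.r_smul, S.r_i, h1 a _ _ (hβ _)]
  · intro x b y hb
    obtain ⟨a, rfl⟩ := S.surjective x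
    exact (h1 a _ y (hβ y)).trans (h1 a b y hb).symm

end Algebra

variable {E : Type*} [NormedAddCommGroup E] [NormedSpace ℝ E]
  {M : Type*} [TopologicalSpace M] [ChartedSpace E M]
  {E₁ : Type*} [NormedAddCommGroup E₁] [NormedSpace ℝ E₁]
  {H : Type*} [Group H] [TopologicalSpace H] [ChartedSpace E₁ H]
  {E₂ : Type*} [NormedAddCommGroup E₂] [NormedSpace ℝ E₂]
  {H' : Type*} [Group H'] [TopologicalSpace H'] [ChartedSpace E₂ H']
  [MulAction (H × H') M]
  [hact : ContMDiffSMul (𝓘(ℝ, E₁).prod 𝓘(ℝ, E₂)) 𝓘(ℝ, E) ∞ (H × H') M]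
  {E₀ : Type*} [NormedAddCommGroup E₀] [NormedSpace ℝ E₀]
  {C : Type*} [TopologicalSpace C] [ChartedSpace E₀ C]
  {k : ℕ} {N : Type*} [TopologicalSpace N] [ChartedSpace (EuclideanSpace ℝ (Fin k)) N]
  [MulAction H' N] {p : M} {ι : C → M} {π : H → C} {f : M → C} {y₀ : N} {i : N → M} {r : M → N}
  (S : OrbitSplitting E (H' := H') p E₀ ι π f k y₀ i r)
include S hact

variable (E₁) in
theorem contMDiffSMul : ContMDiffSMul 𝓘(ℝ, E₂) (𝓡 k) ∞ H' N := by
  constructor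
  have h1 : ContMDiff (𝓘(ℝ, E₂).prod (𝓡 k)) (𝓡 k) ∞
      (fun z : H' × N => r (((1, z.1) : H × H') • i z.2)) :=
    S.smooth_r.comp (hact.contMDiff_smul.comp ((contMDiff_const.prodMk contMDiff_fst).prodMk
      (S.smooth_i.comp contMDiff_snd)))
  exact h1.congr fun z => by rw [← S.i_smul, S.r_i]

variable (E₂) in
omit S hact in
theorem contMDiff_smul_right [hN : ContMDiffSMul 𝓘(ℝ, E₂) (𝓡 k) ∞ H' N] (b : H') :
    ContMDiff (𝓡 k) (𝓡 k) ∞ (fun y : N => b • y) :=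
  hN.contMDiff_smul.comp (contMDiff_const.prodMk contMDiff_id)

omit S hact in
theorem contMDiff_orbit_right [hN : ContMDiffSMul 𝓘(ℝ, E₂) (𝓡 k) ∞ H' N] (y : N) :
    ContMDiff 𝓘(ℝ, E₂) (𝓡 k) ∞ (fun b : H' => b • y) :=
  hN.contMDiff_smul.comp (contMDiff_id.prodMk contMDiff_const)

omit [TopologicalSpace H] hact in
/-- The orbit map of `N` is a submersion. -/
theorem mfderiv_orbit_surjective [ContMDiffSMul 𝓘(ℝ, E₂) (𝓡 k) ∞ H' N] [FiniteDimensional ℝ E₂]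
    [SecondCountableTopology H'] [LieGroup 𝓘(ℝ, E₂) ∞ H'] [IsManifold (𝓡 k) ∞ N] (b : H') :
    Function.Surjective (mfderiv 𝓘(ℝ, E₂) (𝓡 k) (fun b : H' => b • y₀) b) := by
  refine mfderiv_surjective_of_equivariant (ι := id) (β := fun b (y : N) => b • y)
    (fun a => contMDiff_mul_left) (contMDiff_orbit_right y₀) S.transitive contMDiff_id
    (fun y => ?_) (contMDiff_smul_right E₂) (fun a z => inv_smul_smul a z)
    (fun a b => mul_smul a b y₀) b
  rw [mfderiv_id]
  exact Function.injective_id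

/-- The product map is smooth: near each point it is `(x, y) ↦ σ y • ι x`, where `σ` is a smooth
local right inverse of the orbit map `H' → N`. -/
theorem contMDiff_product_map [ContMDiffSMul 𝓘(ℝ, E₂) (𝓡 k) ∞ H' N] [FiniteDimensional ℝ E₂]
    [SecondCountableTopology H'] [LieGroup 𝓘(ℝ, E₂) ∞ H'] [IsManifold (𝓡 k) ∞ N] {Φ : C × N → M}
    (hΦ : ∀ (x : C) (b : H') (y : N), b • y₀ = y → Φ (x, y) = ((1, b) : H × H') • ι x) :
    ContMDiff (𝓘(ℝ, E₀).prod (𝓡 k)) 𝓘(ℝ, E) ∞ Φ := by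
  rintro ⟨x, y⟩
  obtain ⟨b, rfl⟩ := S.transitive y
  obtain ⟨σ, hσ, -, hσ'⟩ := exists_local_section (contMDiff_orbit_right (E₂ := E₂) y₀ b)
    (S.mfderiv_orbit_surjective b)
  have h1 : ContMDiffAt (𝓘(ℝ, E₀).prod (𝓡 k)) 𝓘(ℝ, E) ∞
      (fun z : C × N => ((1, σ z.2) : H × H') • ι z.1) (x, b • y₀) :=
    hact.contMDiff_smul.contMDiffAt.comp _
      ((contMDiffAt_const.prodMk (ContMDiffAt.comp (x, b • y₀) hσ contMDiffAt_snd)).prodMk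
        (S.smooth_ι.contMDiffAt.comp _ contMDiffAt_fst))
  refine h1.congr_of_eventuallyEq ?_
  filter_upwards [continuous_snd.continuousAt.eventually hσ'] with z hz
  exact hΦ z.1 _ z.2 hz

/-- The two factors of the product map are orthogonal if they are at `p`: the group carries one
point to all others. -/
theorem form_product_eq_zero [IsManifold 𝓘(ℝ, E) ∞ M]
    [ContMDiffSMul 𝓘(ℝ, E₂) (𝓡 k) ∞ H' N] [FiniteDimensional ℝ E₂]
    [SecondCountableTopology H'] [LieGroup 𝓘(ℝ, E₂) ∞ H'] [IsManifold (𝓡 k) ∞ N]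
    (h : LightlikeMetric E M) (hisom : h.IsIsometricAction (H × H'))
    (horth : ∀ (u : E₀) (w : E₂), (h.form p : E →L[ℝ] E →L[ℝ] ℝ)
      ((mfderiv 𝓘(ℝ, E₀) 𝓘(ℝ, E) ι (π 1) : E₀ →L[ℝ] E) u)
      ((mfderiv 𝓘(ℝ, E₂) 𝓘(ℝ, E) (fun b : H' => ((1, b) : H × H') • p) 1 : E₂ →L[ℝ] E) w) = 0)
    (a : H) (b : H') (u : E₀) (w : EuclideanSpace ℝ (Fin k)) :
    (h.form ((a, b) • p) : E →L[ℝ] E →L[ℝ] ℝ)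
      ((mfderiv 𝓘(ℝ, E) 𝓘(ℝ, E) (fun m : M => ((1, b) : H × H') • m) (ι (π a)) : E →L[ℝ] E)
        ((mfderiv 𝓘(ℝ, E₀) 𝓘(ℝ, E) ι (π a) : E₀ →L[ℝ] E) u))
      ((mfderiv 𝓘(ℝ, E) 𝓘(ℝ, E) (fun m : M => ((a, 1) : H × H') • m) (i (b • y₀)) : E →L[ℝ] E)
        ((mfderiv (𝓡 k) 𝓘(ℝ, E) i (b • y₀) : EuclideanSpace ℝ (Fin k) →L[ℝ] E) w)) = 0 := by
  have hA : ∀ g : H × H', ContMDiff 𝓘(ℝ, E) 𝓘(ℝ, E) ∞ (fun x : M => g • x) :=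
    contMDiff_prod_smul E₁ E₂
  -- `u` is the image of a vector at `π 1` under the action of `a` on `C`
  let α : H → C → C := fun a x => f (((a, 1) : H × H') • ι x)
  have hα : ∀ a, ContMDiff 𝓘(ℝ, E₀) 𝓘(ℝ, E₀) ∞ (α a) := fun a =>
    S.smooth_f.comp ((hA _).comp S.smooth_ι)
  have hια : ∀ a x, ι (α a x) = ((a, 1) : H × H') • ι x := S.ι_f_smul
  have hαα : ∀ x, α a (α a⁻¹ x) = x := fun x => by
    change f (((a, 1) : H × H') • ι (α a⁻¹ x)) = x
    rw [hια, smul_smul, Prod.mk_mul_mk, mul_inv_cancel, one_mul, ← Prod.one_eq_mk, one_smul, S.f_ι]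
  have hα1 : α a⁻¹ (π a) = π 1 := by
    change f (((a⁻¹, 1) : H × H') • ι (π a)) = π 1
    rw [S.ι_π, smul_smul, Prod.mk_mul_mk, inv_mul_cancel, one_mul, ← Prod.one_eq_mk, one_smul,
      ← S.ι_π_one, S.f_ι]
  obtain ⟨u', rfl⟩ : ∃ u' : E₀, (mfderiv 𝓘(ℝ, E₀) 𝓘(ℝ, E₀) (α a) (π 1) : E₀ →L[ℝ] E₀) u' = u :=
    ⟨_, (mfderiv_apply_of_comp (hα a) (hα a⁻¹) (fun _ => rfl) hα1 u).symm.trans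
      (mfderiv_apply_of_eq_id hαα (π a) u)⟩
  have hα2 : α a (π 1) = π a := by rw [← hα1, hαα]
  -- `w` is the image of a vector at `y₀`, which is tangent to the orbit map of `H'`
  obtain ⟨w', rfl⟩ : ∃ w' : EuclideanSpace ℝ (Fin k), (mfderiv (𝓡 k) (𝓡 k) (fun y : N => b • y) y₀ :
      EuclideanSpace ℝ (Fin k) →L[ℝ] EuclideanSpace ℝ (Fin k)) w' = w :=
    ⟨_, (mfderiv_apply_of_comp (contMDiff_smul_right E₂ b) (contMDiff_smul_right E₂ b⁻¹)
      (fun _ => rfl) (inv_smul_smul b y₀) w).symm.trans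
      (mfderiv_apply_of_eq_id (fun y => smul_inv_smul b y) (b • y₀) w)⟩
  obtain ⟨q, rfl⟩ := S.mfderiv_orbit_surjective (E₂ := E₂) 1 w'
  have e1 : (mfderiv 𝓘(ℝ, E₀) 𝓘(ℝ, E) ι (π a) : E₀ →L[ℝ] E)
      ((mfderiv 𝓘(ℝ, E₀) 𝓘(ℝ, E₀) (α a) (π 1) : E₀ →L[ℝ] E₀) u') =
      (mfderiv 𝓘(ℝ, E) 𝓘(ℝ, E) (fun m : M => ((a, 1) : H × H') • m) p : E →L[ℝ] E)
        ((mfderiv 𝓘(ℝ, E₀) 𝓘(ℝ, E) ι (π 1) : E₀ →L[ℝ] E) u') :=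
    (mfderiv_apply_of_comp S.smooth_ι (hα a) (fun _ => rfl) hα2 u').symm.trans
      (mfderiv_apply_of_comp (hA _) S.smooth_ι (fun x => (hια a x).symm) S.ι_π_one u')
  have e2 : ∀ z : E, (mfderiv 𝓘(ℝ, E) 𝓘(ℝ, E) (fun m : M => ((1, b) : H × H') • m) (ι (π a)) :
      E →L[ℝ] E)
      ((mfderiv 𝓘(ℝ, E) 𝓘(ℝ, E) (fun m : M => ((a, 1) : H × H') • m) p : E →L[ℝ] E) z) =
      (mfderiv 𝓘(ℝ, E) 𝓘(ℝ, E) (fun m : M => ((a, b) : H × H') • m) p : E →L[ℝ] E) z := fun z =>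
    (mfderiv_apply_of_comp (hA _) (hA _) (fun m => by rw [smul_smul]; simp) (S.ι_π a).symm z).symm
  have e3 : ∀ z : EuclideanSpace ℝ (Fin k),
      (mfderiv (𝓡 k) 𝓘(ℝ, E) i (b • y₀) : EuclideanSpace ℝ (Fin k) →L[ℝ] E)
        ((mfderiv (𝓡 k) (𝓡 k) (fun y : N => b • y) y₀ :
          EuclideanSpace ℝ (Fin k) →L[ℝ] EuclideanSpace ℝ (Fin k)) z) =
      (mfderiv 𝓘(ℝ, E) 𝓘(ℝ, E) (fun m : M => ((1, b) : H × H') • m) p : E →L[ℝ] E)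
        ((mfderiv (𝓡 k) 𝓘(ℝ, E) i y₀ : EuclideanSpace ℝ (Fin k) →L[ℝ] E) z) := fun z =>
    (mfderiv_apply_of_comp S.smooth_i (contMDiff_smul_right E₂ b) (fun _ => rfl) rfl z).symm.trans
      (mfderiv_apply_of_comp (hA _) S.smooth_i (fun x => (S.i_smul b x).symm) S.i_base z)
  have hab : ∀ m : M, ((a, 1) : H × H') • ((1, b) : H × H') • m = (a, b) • m := fun m => by
    rw [smul_smul, Prod.mk_mul_mk, mul_one, one_mul]
  have hib : ((1, b) : H × H') • p = i (b • y₀) := by rw [S.i_smul, S.i_base]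
  have e4 : ∀ z : E, (mfderiv 𝓘(ℝ, E) 𝓘(ℝ, E) (fun m : M => ((a, 1) : H × H') • m) (i (b • y₀)) :
      E →L[ℝ] E)
      ((mfderiv 𝓘(ℝ, E) 𝓘(ℝ, E) (fun m : M => ((1, b) : H × H') • m) p : E →L[ℝ] E) z) =
      (mfderiv 𝓘(ℝ, E) 𝓘(ℝ, E) (fun m : M => ((a, b) : H × H') • m) p : E →L[ℝ] E) z := fun z =>
    (mfderiv_apply_of_comp (hA (a, 1)) (hA (1, b)) hab hib z).symm
  have e5 : (mfderiv (𝓡 k) 𝓘(ℝ, E) i y₀ : EuclideanSpace ℝ (Fin k) →L[ℝ] E)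
      ((mfderiv 𝓘(ℝ, E₂) (𝓡 k) (fun b : H' => b • y₀) 1 : E₂ →L[ℝ] EuclideanSpace ℝ (Fin k)) q) =
      (mfderiv 𝓘(ℝ, E₂) 𝓘(ℝ, E) (fun b : H' => ((1, b) : H × H') • p) 1 : E₂ →L[ℝ] E) q :=
    (mfderiv_apply_of_comp S.smooth_i (contMDiff_orbit_right (E₂ := E₂) y₀)
      (fun b => by rw [S.i_smul, S.i_base]) (one_smul H' y₀) q).symm
  have e6 := (congrArg (mfderiv 𝓘(ℝ, E) 𝓘(ℝ, E) (fun m : M => ((1, b) : H × H') • m) (ι (π a)) :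
    E →L[ℝ] E) e1).trans (e2 _)
  have e7 := (congrArg (mfderiv 𝓘(ℝ, E) 𝓘(ℝ, E) (fun m : M => ((a, 1) : H × H') • m) (i (b • y₀)) :
    E →L[ℝ] E) (e3 _)).trans ((e4 _).trans (congrArg (mfderiv 𝓘(ℝ, E) 𝓘(ℝ, E)
      (fun m : M => ((a, b) : H × H') • m) p : E →L[ℝ] E) e5))
  exact (congrArg₂ (fun x y : E => (h.form ((a, b) • p) : E →L[ℝ] E →L[ℝ] ℝ) x y) e6 e7).trans
    ((hisom (a, b) p _ _).trans (horth u' q))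

/-- The `H'`-orbit of `p` is Riemannian if the tangent space of the `H`-orbit contains the
one-dimensional kernel of the metric. -/
theorem pullback_ne_zero [IsManifold 𝓘(ℝ, E) ∞ M]
    (h : LightlikeMetric E M) (hisom : h.IsIsometricAction (H × H')) {u : E₀} (hu : u ≠ 0)
    (hnull : (h.form p : E →L[ℝ] E →L[ℝ] ℝ)
      ((mfderiv 𝓘(ℝ, E₀) 𝓘(ℝ, E) ι (π 1) : E₀ →L[ℝ] E) u)
      ((mfderiv 𝓘(ℝ, E₀) 𝓘(ℝ, E) ι (π 1) : E₀ →L[ℝ] E) u) = 0) (y : N)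
    (v : EuclideanSpace ℝ (Fin k)) (hv : v ≠ 0) :
    (h.pullback i y : EuclideanSpace ℝ (Fin k) →L[ℝ] EuclideanSpace ℝ (Fin k) →L[ℝ] ℝ) v v ≠ 0 := by
  have hA : ∀ g : H × H', ContMDiff 𝓘(ℝ, E) 𝓘(ℝ, E) ∞ (fun x : M => g • x) :=
    contMDiff_prod_smul E₁ E₂
  intro h0
  obtain ⟨b, rfl⟩ := S.transitive y
  have hib : ((1, b) : H × H') • p = i (b • y₀) := by rw [S.i_smul, S.i_base]
  let z : E := (mfderiv 𝓘(ℝ, E₀) 𝓘(ℝ, E) ι (π 1) : E₀ →L[ℝ] E) u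
  let v₀ : E := (mfderiv 𝓘(ℝ, E) 𝓘(ℝ, E) (fun m : M => ((1, b) : H × H') • m) p : E →L[ℝ] E) z
  have hv₀ : (h.form (i (b • y₀)) : E →L[ℝ] E →L[ℝ] ℝ) v₀ v₀ = 0 :=
    (h.form_congr hib v₀ v₀).symm.trans ((hisom (1, b) p z z).trans hnull)
  let Df : E →L[ℝ] E₀ := mfderiv 𝓘(ℝ, E) 𝓘(ℝ, E₀) f (i (b • y₀))
  have hf₀ : Df v₀ = u := by
    have h1 := mfderiv_apply_of_comp S.smooth_f (hA (1, b)) (K := f) (fun m => S.f_smul b m) hib z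
    have h2 := mfderiv_apply_of_comp S.smooth_f S.smooth_ι (fun _ => rfl) S.ι_π_one u
    exact h1.symm.trans (h2.symm.trans (mfderiv_apply_of_eq_id S.f_ι (π 1) u))
  have hv₀0 : v₀ ≠ 0 := by
    intro h1
    rw [h1, map_zero] at hf₀
    exact hu hf₀.symm
  let w : E := (mfderiv (𝓡 k) 𝓘(ℝ, E) i (b • y₀) : EuclideanSpace ℝ (Fin k) →L[ℝ] E) v
  have hfw : Df w = 0 := by
    refine (mfderiv_apply_of_comp S.smooth_f S.smooth_i (K := fun _ => π 1) S.f_i rfl v).symm.trans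
        ?_
    rw [mfderiv_const]
    rfl
  obtain ⟨t, ht⟩ := exists_smul_eq_of_null (F := E) (B := h.form (i (b • y₀)))
      (h.symm (i (b • y₀))) (h.nonneg (i (b • y₀)))
    (h.finrank_ker (i (b • y₀))) hv₀ (w := w) h0 hv₀0
  rw [← ht, map_smul, hf₀] at hfw
  have ht0 : t = 0 := (smul_eq_zero.1 hfw).resolve_right hu
  have hw0 : w = 0 := by rw [← ht, ht0, zero_smul]
  let Dr : E →L[ℝ] EuclideanSpace ℝ (Fin k) := mfderiv 𝓘(ℝ, E) (𝓡 k) r (i (b • y₀))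
  have h3 : Dr w = v := (mfderiv_apply_of_comp S.smooth_r S.smooth_i (fun _ => rfl) rfl
      v).symm.trans
    (mfderiv_apply_of_eq_id S.r_i (b • y₀) v)
  rw [hw0, map_zero] at h3
  exact hv h3.symm

end OrbitSplitting

/-! ### The splitting theorem -/

section SplittingTheorem

variable {E : Type*} [NormedAddCommGroup E] [NormedSpace ℝ E] [FiniteDimensional ℝ E]
  {M : Type u} [TopologicalSpace M] [T2Space M] [SecondCountableTopology M] [ChartedSpace E M]
  [IsManifold 𝓘(ℝ, E) ∞ M]
  {E₁ : Type*} [NormedAddCommGroup E₁] [NormedSpace ℝ E₁] [FiniteDimensional ℝ E₁]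
  {H : Type*} [Group H] [TopologicalSpace H] [SecondCountableTopology H]
  [ChartedSpace E₁ H] [LieGroup 𝓘(ℝ, E₁) ∞ H]
  {E₂ : Type*} [NormedAddCommGroup E₂] [NormedSpace ℝ E₂] [FiniteDimensional ℝ E₂]
  {H' : Type*} [Group H'] [TopologicalSpace H'] [SecondCountableTopology H']
  [ChartedSpace E₂ H'] [LieGroup 𝓘(ℝ, E₂) ∞ H']
  [MulAction (H × H') M]
  [hact : ContMDiffSMul (𝓘(ℝ, E₁).prod 𝓘(ℝ, E₂)) 𝓘(ℝ, E) ∞ (H × H') M]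
  {E₀ : Type*} [NormedAddCommGroup E₀] [NormedSpace ℝ E₀]
  {C : Type*} [TopologicalSpace C] [ChartedSpace E₀ C]

include hact in
omit [FiniteDimensional ℝ E] [T2Space M] [SecondCountableTopology M] [FiniteDimensional ℝ E₁]
  [SecondCountableTopology H] [LieGroup 𝓘(ℝ, E₁) ∞ H] in
/-- The product map is an isometry. -/
theorem OrbitSplitting.form_product_apply {k : ℕ} {N : Type*} [TopologicalSpace N]
    [ChartedSpace (EuclideanSpace ℝ (Fin k)) N] [IsManifold (𝓡 k) ∞ N] [MulAction H' N]
    [ContMDiffSMul 𝓘(ℝ, E₂) (𝓡 k) ∞ H' N] {p : M}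
    {ι : C → M} {π : H → C} {f : M → C} {y₀ : N} {i : N → M} {r : M → N}
    (S : OrbitSplitting E (H' := H') p E₀ ι π f k y₀ i r)
    {h : LightlikeMetric E M} (hisom : h.IsIsometricAction (H × H'))
    {c : ∀ x : C, TangentSpace 𝓘(ℝ, E₀) x → TangentSpace 𝓘(ℝ, E₀) x → ℝ}
    (hc : ∀ (x : C) (v w : TangentSpace 𝓘(ℝ, E₀) x),
      h.form (ι x) (mfderiv 𝓘(ℝ, E₀) 𝓘(ℝ, E) ι x v) (mfderiv 𝓘(ℝ, E₀) 𝓘(ℝ, E) ι x w) = c x v w)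
    (horth : ∀ (u : E₀) (w : E₂), (h.form p : E →L[ℝ] E →L[ℝ] ℝ)
      ((mfderiv 𝓘(ℝ, E₀) 𝓘(ℝ, E) ι (π 1) : E₀ →L[ℝ] E) u)
      ((mfderiv 𝓘(ℝ, E₂) 𝓘(ℝ, E) (fun b : H' => ((1, b) : H × H') • p) 1 : E₂ →L[ℝ] E) w) = 0)
    {Φ : C × N → M} (hΦ : ContMDiff (𝓘(ℝ, E₀).prod (𝓡 k)) 𝓘(ℝ, E) ∞ Φ)
    (hΦ1 : ∀ (a : H) (y : N), Φ (π a, y) = ((a, 1) : H × H') • i y)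
    (hΦ2 : ∀ (x : C) (b : H') (y : N), b • y₀ = y → Φ (x, y) = ((1, b) : H × H') • ι x)
    (z : C × N) (v w : E₀ × EuclideanSpace ℝ (Fin k)) :
    (h.form (Φ z) : E →L[ℝ] E →L[ℝ] ℝ)
      ((mfderiv (𝓘(ℝ, E₀).prod (𝓡 k)) 𝓘(ℝ, E) Φ z : E₀ × EuclideanSpace ℝ (Fin k) →L[ℝ] E) v)
      ((mfderiv (𝓘(ℝ, E₀).prod (𝓡 k)) 𝓘(ℝ, E) Φ z : E₀ × EuclideanSpace ℝ (Fin k) →L[ℝ] E) w) =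
      c z.1 v.1 w.1 + (h.pullback i z.2 : EuclideanSpace ℝ (Fin k) →L[ℝ]
        EuclideanSpace ℝ (Fin k) →L[ℝ] ℝ) v.2 w.2 := by
  have hA : ∀ g : H × H', ContMDiff 𝓘(ℝ, E) 𝓘(ℝ, E) ∞ (fun x : M => g • x) :=
    contMDiff_prod_smul E₁ E₂
  obtain ⟨x, y⟩ := z
  obtain ⟨a, rfl⟩ := S.surjective x
  obtain ⟨b, rfl⟩ := S.transitive y
  have hx : Φ (π a, b • y₀) = ((1, b) : H × H') • ι (π a) := hΦ2 _ _ _ rfl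
  have hy : Φ (π a, b • y₀) = ((a, 1) : H × H') • i (b • y₀) := hΦ1 _ _
  have hab : Φ (π a, b • y₀) = (a, b) • p := by
    rw [hx, S.ι_π, smul_smul, Prod.mk_mul_mk, mul_one, one_mul]
  let T₁ : E →L[ℝ] E := mfderiv 𝓘(ℝ, E) 𝓘(ℝ, E) (fun m : M => ((1, b) : H × H') • m) (ι (π a))
  let T₂ : E →L[ℝ] E :=
    mfderiv 𝓘(ℝ, E) 𝓘(ℝ, E) (fun m : M => ((a, 1) : H × H') • m) (i (b • y₀))
  let D₁ : E₀ →L[ℝ] E := mfderiv 𝓘(ℝ, E₀) 𝓘(ℝ, E) ι (π a)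
  let D₂ : EuclideanSpace ℝ (Fin k) →L[ℝ] E := mfderiv (𝓡 k) 𝓘(ℝ, E) i (b • y₀)
  have hD : ∀ v : E₀ × EuclideanSpace ℝ (Fin k),
      (mfderiv (𝓘(ℝ, E₀).prod (𝓡 k)) 𝓘(ℝ, E) Φ (π a, b • y₀) :
        E₀ × EuclideanSpace ℝ (Fin k) →L[ℝ] E) v = T₁ (D₁ v.1) + T₂ (D₂ v.2) := by
    intro v
    have h1 := mfderiv_prod_eq_add_apply (v := v)
      ((hΦ.contMDiffAt (x := (π a, b • y₀))).mdifferentiableAt (by simp))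
    have h2 : (fun x : C => Φ (x, b • y₀)) = fun x => ((1, b) : H × H') • ι x :=
      funext fun x => hΦ2 x b _ rfl
    have h3 : (fun y : N => Φ (π a, y)) = fun y => ((a, 1) : H × H') • i y :=
      funext fun y => hΦ1 a y
    refine h1.trans (congrArg₂ (fun x y : E => x + y) ?_ ?_)
    · change (mfderiv 𝓘(ℝ, E₀) 𝓘(ℝ, E) (fun x : C => Φ (x, b • y₀)) (π a) : E₀ →L[ℝ] E) v.1 = _
      rw [h2]
      exact mfderiv_apply_of_comp (hA _) S.smooth_ι (fun _ => rfl) rfl v.1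
    · change (mfderiv (𝓡 k) 𝓘(ℝ, E) (fun y : N => Φ (π a, y)) (b • y₀) :
        EuclideanSpace ℝ (Fin k) →L[ℝ] E) v.2 = _
      rw [h3]
      exact mfderiv_apply_of_comp (hA _) S.smooth_i (fun _ => rfl) rfl v.2
  let B : E →L[ℝ] E →L[ℝ] ℝ := h.form (Φ (π a, b • y₀))
  have hcross : ∀ (v : E₀) (w : EuclideanSpace ℝ (Fin k)), B (T₁ (D₁ v)) (T₂ (D₂ w)) = 0 :=
    fun v w => (h.form_congr hab _ _).trans
      (S.form_product_eq_zero (E₁ := E₁) h hisom horth a b v w)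
  have hcross' : ∀ (v : E₀) (w : EuclideanSpace ℝ (Fin k)), B (T₂ (D₂ w)) (T₁ (D₁ v)) = 0 :=
    fun v w => (h.symm _ _ _).trans (hcross v w)
  have h11 : ∀ v w : E₀, B (T₁ (D₁ v)) (T₁ (D₁ w)) = c (π a) v w := fun v w =>
    (h.form_congr hx _ _).trans ((hisom (1, b) (ι (π a)) _ _).trans (hc _ v w))
  have h22 : ∀ v w : EuclideanSpace ℝ (Fin k), B (T₂ (D₂ v)) (T₂ (D₂ w)) =
      (h.pullback i (b • y₀) : EuclideanSpace ℝ (Fin k) →L[ℝ]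
        EuclideanSpace ℝ (Fin k) →L[ℝ] ℝ) v w := fun v w =>
    (h.form_congr hy _ _).trans (hisom (a, 1) (i (b • y₀)) _ _)
  refine (congrArg₂ (fun x y : E => B x y) (hD v) (hD w)).trans ?_
  simp only [map_add, add_apply, hcross, hcross', h11, h22, add_zero, zero_add]

include hact in
omit [FiniteDimensional ℝ E] [T2Space M] [SecondCountableTopology M] [FiniteDimensional ℝ E₁]
  [SecondCountableTopology H] [LieGroup 𝓘(ℝ, E₁) ∞ H] in
/-- An orbit splitting that is orthogonal at `p` and for which the `H`-orbit contains the null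
direction is a splitting of the metric. -/
theorem OrbitSplitting.isProductWithHomogeneous {k : ℕ} {N : Type u} [TopologicalSpace N]
    [T2Space N] [SecondCountableTopology N]
    [ChartedSpace (EuclideanSpace ℝ (Fin k)) N] [IsManifold (𝓡 k) ∞ N] [MulAction H' N] {p : M}
    {ι : C → M} {π : H → C} {f : M → C} {y₀ : N} {i : N → M} {r : M → N}
    (S : OrbitSplitting E (H' := H') p E₀ ι π f k y₀ i r)
    (htrans : MulAction.IsPretransitive (H × H') M)
    {h : LightlikeMetric E M} (hisom : h.IsIsometricAction (H × H'))
    {c : ∀ x : C, TangentSpace 𝓘(ℝ, E₀) x → TangentSpace 𝓘(ℝ, E₀) x → ℝ}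
    (hc : ∀ (x : C) (v w : TangentSpace 𝓘(ℝ, E₀) x),
      h.form (ι x) (mfderiv 𝓘(ℝ, E₀) 𝓘(ℝ, E) ι x v) (mfderiv 𝓘(ℝ, E₀) 𝓘(ℝ, E) ι x w) = c x v w)
    (horth : ∀ (u : E₀) (w : E₂), (h.form p : E →L[ℝ] E →L[ℝ] ℝ)
      ((mfderiv 𝓘(ℝ, E₀) 𝓘(ℝ, E) ι (π 1) : E₀ →L[ℝ] E) u)
      ((mfderiv 𝓘(ℝ, E₂) 𝓘(ℝ, E) (fun b : H' => ((1, b) : H × H') • p) 1 : E₂ →L[ℝ] E) w) = 0)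
    {u : E₀} (hu : u ≠ 0) (hnull : (h.form p : E →L[ℝ] E →L[ℝ] ℝ)
      ((mfderiv 𝓘(ℝ, E₀) 𝓘(ℝ, E) ι (π 1) : E₀ →L[ℝ] E) u)
      ((mfderiv 𝓘(ℝ, E₀) 𝓘(ℝ, E) ι (π 1) : E₀ →L[ℝ] E) u) = 0) :
    IsProductWithHomogeneous h c E₂ H' := by
  have hA : ∀ g : H × H', ContMDiff 𝓘(ℝ, E) 𝓘(ℝ, E) ∞ (fun x : M => g • x) :=
    contMDiff_prod_smul E₁ E₂
  have hN : ContMDiffSMul 𝓘(ℝ, E₂) (𝓡 k) ∞ H' N := S.contMDiffSMul E₁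
  obtain ⟨Φ, hΦsymm, hΦ1, hΦ2⟩ := S.exists_product_map htrans
  have hΦ : ContMDiff (𝓘(ℝ, E₀).prod (𝓡 k)) 𝓘(ℝ, E) ∞ Φ :=
    S.contMDiff_product_map (E₁ := E₁) (E₂ := E₂) hΦ2
  let Ψ : (C × N) ≃ₘ^∞⟮𝓘(ℝ, E₀).prod (𝓡 k), 𝓘(ℝ, E)⟯ M :=
    { Φ with
      contMDiff_toFun := hΦ
      contMDiff_invFun := (S.smooth_f.prodMk S.smooth_r).congr hΦsymm }
  have hpos := S.pullback_ne_zero (E₁ := E₁) (E₂ := E₂) h hisom hu hnull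
  refine ⟨k, N, inferInstance, inferInstance, inferInstance, inferInstance, inferInstance,
    h.riemannianPullback S.smooth_i hpos, inferInstance, Ψ, hN,
    ⟨fun y y' => ?_⟩, ?_, ?_⟩
  · obtain ⟨b, rfl⟩ := S.transitive y
    obtain ⟨b', rfl⟩ := S.transitive y'
    exact ⟨b' * b⁻¹, by rw [smul_smul, inv_mul_cancel_right]⟩
  · intro b y v w
    have e : ∀ v : EuclideanSpace ℝ (Fin k),
        (mfderiv (𝓡 k) 𝓘(ℝ, E) i (b • y) : EuclideanSpace ℝ (Fin k) →L[ℝ] E)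
        ((mfderiv (𝓡 k) (𝓡 k) (fun y : N => b • y) y :
          EuclideanSpace ℝ (Fin k) →L[ℝ] EuclideanSpace ℝ (Fin k)) v) =
      (mfderiv 𝓘(ℝ, E) 𝓘(ℝ, E) (fun m : M => ((1, b) : H × H') • m) (i y) : E →L[ℝ] E)
        ((mfderiv (𝓡 k) 𝓘(ℝ, E) i y : EuclideanSpace ℝ (Fin k) →L[ℝ] E) v) := fun v =>
      (mfderiv_apply_of_comp S.smooth_i (OrbitSplitting.contMDiff_smul_right E₂ b)
        (fun _ => rfl) rfl v).symm.trans
        (mfderiv_apply_of_comp (hA _) S.smooth_i (fun x => (S.i_smul b x).symm) rfl v)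
    exact (congrArg₂ (fun x y' : E => (h.form (i (b • y)) : E →L[ℝ] E →L[ℝ] ℝ) x y') (e v)
      (e w)).trans ((h.form_congr (S.i_smul b y) _ _).trans (hisom (1, b) (i y) _ _))
  · exact fun z v w => S.form_product_apply (E₁ := E₁) (E₂ := E₂) hisom hc horth hΦ hΦ1 hΦ2 z v w

/-- Splitting theorem: a homogeneous lightlike manifold of `H × H'` is the metric product of
`C` and the `H'`-orbit of `p` if the `H`-orbit of `p` is isometric to `C`, contains a null
direction and is orthogonal to the `H'`-orbit, and if the `H`-component of every element of the
stabilizer of `p` fixes `p`. -/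
theorem isProductWithHomogeneous_of_orbit (htrans : MulAction.IsPretransitive (H × H') M)
    {h : LightlikeMetric E M} (hisom : h.IsIsometricAction (H × H')) {p : M}
    {ι : C → M} {π : H → C} (hι : ContMDiff 𝓘(ℝ, E₀) 𝓘(ℝ, E) ∞ ι)
    (hιinj : Function.Injective ι)
    (hπ : ContMDiff 𝓘(ℝ, E₁) 𝓘(ℝ, E₀) ∞ π) (hπsurj : Function.Surjective π)
    (hιπ : ∀ a, ι (π a) = ((a, 1) : H × H') • p)
    {c : ∀ x : C, TangentSpace 𝓘(ℝ, E₀) x → TangentSpace 𝓘(ℝ, E₀) x → ℝ}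
    (hc : ∀ (x : C) (v w : TangentSpace 𝓘(ℝ, E₀) x),
      h.form (ι x) (mfderiv 𝓘(ℝ, E₀) 𝓘(ℝ, E) ι x v) (mfderiv 𝓘(ℝ, E₀) 𝓘(ℝ, E) ι x w) = c x v w)
    (hstab : ∀ (a : H) (b : H'), (a, b) • p = p → ((a, 1) : H × H') • p = p)
    (horth : ∀ (u : E₀) (w : E₂), (h.form p : E →L[ℝ] E →L[ℝ] ℝ)
      ((mfderiv 𝓘(ℝ, E₀) 𝓘(ℝ, E) ι (π 1) : E₀ →L[ℝ] E) u)
      ((mfderiv 𝓘(ℝ, E₂) 𝓘(ℝ, E) (fun b : H' => ((1, b) : H × H') • p) 1 : E₂ →L[ℝ] E) w) = 0)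
    {u : E₀} (hu : u ≠ 0) (hnull : (h.form p : E →L[ℝ] E →L[ℝ] ℝ)
      ((mfderiv 𝓘(ℝ, E₀) 𝓘(ℝ, E) ι (π 1) : E₀ →L[ℝ] E) u)
      ((mfderiv 𝓘(ℝ, E₀) 𝓘(ℝ, E) ι (π 1) : E₀ →L[ℝ] E) u) = 0) :
    IsProductWithHomogeneous h c E₂ H' := by
  have hA : ∀ g : H × H', ContMDiff 𝓘(ℝ, E) 𝓘(ℝ, E) ∞ (fun x : M => g • x) :=
    contMDiff_prod_smul E₁ E₂
  obtain ⟨f, ρ, hf, hρ, hfρ⟩ := exists_orbit_projections (E := E) (E₁ := E₁) (E₂ := E₂) htrans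
      hιinj hπ hιπ
    hstab
  have hex : ∀ m : M, ∃ (a : H) (b : H'), (a, b) • p = m := fun m => by
    obtain ⟨⟨a, b⟩, hab⟩ := htrans.exists_smul_eq p m
    exact ⟨a, b, hab⟩
  have hρA : ∀ (a : H) (m : M), ρ (((a, 1) : H × H') • m) = ρ m := by
    intro a m
    obtain ⟨a', b', rfl⟩ := hex m
    rw [smul_smul, Prod.mk_mul_mk, (hfρ _ _).2, (hfρ _ _).2, one_mul]
  have hρB : ∀ (b : H') (m : M), ρ (((1, b) : H × H') • m) = ((1, b) : H × H') • ρ m := by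
    intro b m
    obtain ⟨a', b', rfl⟩ := hex m
    rw [smul_smul, Prod.mk_mul_mk, (hfρ _ _).2, (hfρ _ _).2, smul_smul, Prod.mk_mul_mk, one_mul]
  have hidem : ∀ m, ρ (ρ m) = ρ m := by
    intro m
    obtain ⟨a', b', rfl⟩ := hex m
    rw [(hfρ _ _).2, (hfρ _ _).2]
  have hρp : ρ p = p := by
    have := (hfρ 1 1).2
    rwa [← Prod.one_eq_mk, one_smul] at this
  have hfix : ∀ m, ρ m = m → ∃ b : H', ((1, b) : H × H') • p = m := by
    intro m hm
    obtain ⟨a', b', rfl⟩ := hex m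
    exact ⟨b', by rw [← (hfρ _ _).2, hm]⟩
  have hle : ∀ (b : H') (m : M), Module.finrank ℝ (LinearMap.range
      (mfderiv 𝓘(ℝ, E) 𝓘(ℝ, E) ρ m).toLinearMap) ≤ Module.finrank ℝ (LinearMap.range
      (mfderiv 𝓘(ℝ, E) 𝓘(ℝ, E) ρ (((1, b) : H × H') • m)).toLinearMap) := fun b m =>
    finrank_range_mfderiv_le_of_equivariant hρ (hA (1, b)) (hA (1, b)) (hA (1, b)⁻¹)
      (fun y => inv_smul_smul _ y) (hρB b) m
  have hrank : ∀ m, ρ m = m → Module.finrank ℝ (LinearMap.range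
      (mfderiv 𝓘(ℝ, E) 𝓘(ℝ, E) ρ m).toLinearMap) = Module.finrank ℝ (LinearMap.range
      (mfderiv 𝓘(ℝ, E) 𝓘(ℝ, E) ρ p).toLinearMap) := by
    intro m hm
    obtain ⟨b, rfl⟩ := hfix m hm
    refine le_antisymm ?_ (hle b p)
    have := hle b⁻¹ (((1, b) : H × H') • p)
    rwa [smul_smul, Prod.mk_mul_mk, one_mul, inv_mul_cancel, ← Prod.one_eq_mk, one_smul] at this
  obtain ⟨cs, hman, hi, hr⟩ := exists_chartedSpace_fixed hρ hidem hrank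
  let act : MulAction H' {x // ρ x = x} :=
    { smul := fun b y => ⟨((1, b) : H × H') • (y : M), by rw [hρB, y.2]⟩
      one_smul := fun y => Subtype.ext (one_smul (H × H') (y : M))
      mul_smul := fun b b' y => Subtype.ext <| by
        change ((1, b * b') : H × H') • (y : M) = ((1, b) : H × H') • ((1, b') : H × H') • (y : M)
        rw [smul_smul, Prod.mk_mul_mk, one_mul] }
  have hSec : SecondCountableTopology {x // ρ x = x} :=
    TopologicalSpace.Subtype.secondCountableTopology {x | ρ x = x}
  have S : OrbitSplitting E (H' := H') p E₀ ι π f _ (⟨p, hρp⟩ : {x // ρ x = x}) Subtype.val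
      (fun m => ⟨ρ m, hidem m⟩) :=
    { smooth_ι := hι
      smooth_f := hf
      smooth_i := hi
      smooth_r := hr
      surjective := hπsurj
      ι_π := hιπ
      f_ι := fun x => by
        obtain ⟨a, rfl⟩ := hπsurj x
        rw [hιπ, (hfρ a 1).1]
      f_smul := fun b m => by
        obtain ⟨a', b', rfl⟩ := hex m
        rw [smul_smul, Prod.mk_mul_mk, (hfρ _ _).1, (hfρ _ _).1, one_mul]
      r_i := fun y => Subtype.ext y.2
      r_smul := fun a m => Subtype.ext (hρA a m)
      i_smul := fun b y => rfl
      i_base := rfl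
      transitive := fun y => by
        obtain ⟨b, hb⟩ := hfix y y.2
        exact ⟨b, Subtype.ext hb⟩ }
  exact S.isProductWithHomogeneous (E₁ := E₁) htrans hisom hc horth hu hnull

end SplittingTheorem

/-! ### The exponential map of a finite-index subgroup of the Lorentz group -/

/-- An immersion has a smooth local left inverse. -/
theorem Manifold.IsImmersionAt.exists_left_inverse {E : Type*} [NormedAddCommGroup E]
    [NormedSpace ℝ E]
    {X : Type*} [TopologicalSpace X] [ChartedSpace E X]
    {F : Type*} [NormedAddCommGroup F] [NormedSpace ℝ F]
    {Y : Type*} [TopologicalSpace Y] [ChartedSpace F Y] {f : X → Y} {x : X}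
    (h : IsImmersionAt 𝓘(ℝ, E) 𝓘(ℝ, F) ∞ f x) :
    ∃ r : Y → X, ContMDiffAt 𝓘(ℝ, F) 𝓘(ℝ, E) ∞ r (f x) ∧ ∀ᶠ y in 𝓝 x, r (f y) = y := by
  let φ := h.domChart.extend 𝓘(ℝ, E)
  let ψ := h.codChart.extend 𝓘(ℝ, F)
  have hφs : φ.source = h.domChart.source := h.domChart.extend_source
  have hx : x ∈ φ.source := by rw [hφs]; exact h.mem_domChart_source
  have key : ∀ y ∈ φ.source, (h.equiv.symm (ψ (f y))).1 = φ y := by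
    intro y hy
    have h1 := h.writtenInCharts (φ.map_source hy)
    have h2 : ψ (f y) = h.equiv (φ y, 0) := by
      have h3 : ψ (f (φ.symm (φ y))) = h.equiv (φ y, 0) := h1
      rwa [φ.left_inv hy] at h3
    rw [h2, ContinuousLinearEquiv.symm_apply_apply]
  refine ⟨fun z => φ.symm (h.equiv.symm (ψ z)).1, ?_, ?_⟩
  · have h1 : ContMDiffAt 𝓘(ℝ, F) 𝓘(ℝ, F) ∞ ψ (f x) :=
      contMDiffAt_of_mem_maximalAtlas h.codChart_mem_maximalAtlas h.mem_codChart_source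
    have h2 : ContMDiffAt 𝓘(ℝ, F) 𝓘(ℝ, E) ∞ (fun w => (h.equiv.symm w).1) (ψ (f x)) :=
      ((contDiff_fst.comp h.equiv.symm.contDiff).contMDiff).contMDiffAt
    have h3 : ContMDiffAt 𝓘(ℝ, E) 𝓘(ℝ, E) ∞ φ.symm (h.equiv.symm (ψ (f x))).1 := by
      rw [key x hx]
      refine (contMDiffOn_extend_symm h.domChart_mem_maximalAtlas).contMDiffAt ?_
      have h4 : (𝓘(ℝ, E) : E → E) '' h.domChart.target = h.domChart.target := by simp
      rw [h4]
      exact h.domChart.open_target.mem_nhds (h.domChart.map_source h.mem_domChart_source)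
    exact h3.comp (f x) (h2.comp (f x) h1)
  · have hU : φ.source ∈ 𝓝 x := by
      rw [hφs]; exact h.domChart.open_source.mem_nhds h.mem_domChart_source
    filter_upwards [hU] with y hy
    rw [key y hy, φ.left_inv hy]

theorem Manifold.IsImmersionAt.mfderiv_injective {E : Type*} [NormedAddCommGroup E]
    [NormedSpace ℝ E]
    {X : Type*} [TopologicalSpace X] [ChartedSpace E X]
    {F : Type*} [NormedAddCommGroup F] [NormedSpace ℝ F]
    {Y : Type*} [TopologicalSpace Y] [ChartedSpace F Y] {f : X → Y} {x : X}
    (h : IsImmersionAt 𝓘(ℝ, E) 𝓘(ℝ, F) ∞ f x) :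
    Function.Injective (mfderiv 𝓘(ℝ, E) 𝓘(ℝ, F) f x) := by
  obtain ⟨r, hr, hrf⟩ := h.exists_left_inverse
  have h1 := mfderiv_comp x (hr.mdifferentiableAt (by simp))
      (h.contMDiffAt.mdifferentiableAt (by simp))
  have h2 : mfderiv 𝓘(ℝ, E) 𝓘(ℝ, E) (r ∘ f) x = mfderiv 𝓘(ℝ, E) 𝓘(ℝ, E) id x :=
    Filter.EventuallyEq.mfderiv_eq hrf
  rw [mfderiv_id] at h2
  have h3 : ∀ v : E, (mfderiv 𝓘(ℝ, F) 𝓘(ℝ, E) r (f x) : F →L[ℝ] E)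
      ((mfderiv 𝓘(ℝ, E) 𝓘(ℝ, F) f x : E →L[ℝ] F) v) = v := fun v =>
    congrArg (fun l : E →L[ℝ] E => l v) (h1.symm.trans h2)
  exact Function.LeftInverse.injective h3

/-- A map `ε` into a manifold is a smooth submersion at `0` if its composition with an embedding
`φ` in a vector space is smooth and has a derivative at `0` whose range contains that of the
derivative of `φ`. -/
theorem Manifold.IsSmoothEmbedding.contMDiff_and_surjective_of_comp
    {A : Type*} [NormedAddCommGroup A] [NormedSpace ℝ A]
    {E : Type*} [NormedAddCommGroup E] [NormedSpace ℝ E]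
    {X : Type*} [TopologicalSpace X] [ChartedSpace E X]
    {W : Type*} [NormedAddCommGroup W] [NormedSpace ℝ W] {φ : X → W}
    (hφ : IsSmoothEmbedding 𝓘(ℝ, E) 𝓘(ℝ, W) ∞ φ) {ε : A → X} {ψ : A → W} (hψ : ContDiff ℝ ∞ ψ)
    (hε : ∀ x, φ (ε x) = ψ x) {D : A →L[ℝ] W} (hD : HasFDerivAt ψ D 0)
    (hrange : ∀ w : E, ∃ x, D x = (mfderiv 𝓘(ℝ, E) 𝓘(ℝ, W) φ (ε 0) : E →L[ℝ] W) w) :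
    ContMDiff 𝓘(ℝ, A) 𝓘(ℝ, E) ∞ ε ∧ Function.Surjective (mfderiv 𝓘(ℝ, A) 𝓘(ℝ, E) ε 0) := by
  have hcomp : φ ∘ ε = ψ := funext hε
  have hsm : ContMDiff 𝓘(ℝ, A) 𝓘(ℝ, E) ∞ ε := by
    refine (ContMDiff.iff_comp_isImmersion hφ.isImmersion).2 ⟨?_, ?_⟩
    · rw [hφ.isEmbedding.continuous_iff, hcomp]
      exact hψ.continuous
    · rw [hcomp]
      exact hψ.contMDiff
  refine ⟨hsm, fun w => ?_⟩
  obtain ⟨x, hx⟩ := hrange w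
  refine ⟨x, (hφ.isImmersion.isImmersionAt (ε 0)).mfderiv_injective ?_⟩
  refine (mfderiv_apply_of_comp hφ.contMDiff hsm hε rfl x).symm.trans (Eq.trans ?_ hx)
  rw [mfderiv_eq_fderiv, hD.fderiv]
  rfl

section LieExp

variable {d : ℕ}

/-- A subgroup of finite index in `O(1,d)` contains the exponentials of `𝔬(1,d)`: these have roots
of all orders. -/
theorem expEquiv_mem_of_isFiniteRelIndex
    {K : Subgroup (MinkowskiSpace d ≃L[ℝ] MinkowskiSpace d)}
    (hK : K.IsFiniteRelIndex (lorentzGroup d)) {X : MinkowskiSpace d →L[ℝ] MinkowskiSpace d}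
    (hX : X ∈ lorentzAlgebra d) : expEquiv X ∈ K := by
  set n := (K.relIndex (lorentzGroup d)).factorial with hn
  have hpow : ∀ (Y : MinkowskiSpace d →L[ℝ] MinkowskiSpace d) (m : ℕ),
      expEquiv ((m : ℝ) • Y) = expEquiv Y ^ m := by
    intro Y m
    induction m with
    | zero => rw [Nat.cast_zero, zero_smul_endomorphism, expEquiv_zero, pow_zero]
    | succ m ih => rw [Nat.cast_succ, expEquiv_add_smul, ih, one_smul_endomorphism, pow_succ]
  have h1 : expEquiv ((n : ℝ)⁻¹ • X) ∈ lorentzGroup d :=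
    expEquiv_mem ((lorentzAlgebra d).smul_mem _ hX)
  have h2 := (Subgroup.pow_mem_of_relIndex_ne_zero_of_dvd hK.relIndex_ne_zero h1 (n := n)
    fun m hm hle => Nat.dvd_factorial hm hle).1
  have h3 : (n : ℝ) ≠ 0 := Nat.cast_ne_zero.2 (Nat.factorial_ne_zero _)
  rwa [← hpow, smul_smul_endomorphism, mul_inv_cancel₀ h3, one_smul_endomorphism] at h2

/-- The derivative at the neutral element of a smooth family of Lorentz transformations is in
`𝔬(1,d)`. -/
theorem mfderiv_mem_lorentzAlgebra {E : Type*} [NormedAddCommGroup E] [NormedSpace ℝ E]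
    {X : Type*} [TopologicalSpace X] [ChartedSpace E X]
    {φ : X → MinkowskiSpace d →L[ℝ] MinkowskiSpace d} {a : X}
    (hφ : ContMDiffAt 𝓘(ℝ, E) 𝓘(ℝ, MinkowskiSpace d →L[ℝ] MinkowskiSpace d) ∞ φ a)
    (hpres : ∀ b x y, minkowskiForm d (φ b x) (φ b y) = minkowskiForm d x y) (ha : φ a = 1)
    (w : E) :
    (mfderiv 𝓘(ℝ, E) 𝓘(ℝ, MinkowskiSpace d →L[ℝ] MinkowskiSpace d) φ a :
      E →L[ℝ] MinkowskiSpace d →L[ℝ] MinkowskiSpace d) w ∈ lorentzAlgebra d := by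
  set D : E →L[ℝ] MinkowskiSpace d →L[ℝ] MinkowskiSpace d :=
    mfderiv 𝓘(ℝ, E) 𝓘(ℝ, MinkowskiSpace d →L[ℝ] MinkowskiSpace d) φ a with hD
  let ψ := extChartAt 𝓘(ℝ, E) a
  have h1 : HasFDerivWithinAt (fun z => φ (ψ.symm z)) D (Set.range 𝓘(ℝ, E)) (ψ a) :=
    (hφ.mdifferentiableAt (by simp)).hasMFDerivAt.2
  rw [modelWithCornersSelf_coe, Set.range_id, hasFDerivWithinAt_univ] at h1
  have hφ0 : φ (ψ.symm (ψ a)) = 1 := by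
    rw [ψ.left_inv (mem_extChartAt_source a), ha]
  have h2 : HasDerivAt (fun t : ℝ => ψ a + t • w) w 0 := by
    simpa using ((hasDerivAt_id (0 : ℝ)).smul_const w).const_add (ψ a)
  have h3 : HasDerivAt (fun t : ℝ => φ (ψ.symm (ψ a + t • w))) (D w) 0 := by
    have h1' : HasFDerivAt (fun z => φ (ψ.symm z)) D (ψ a + (0 : ℝ) • w) := by simpa using h1
    exact h1'.comp_hasDerivAt (0 : ℝ) h2
  intro x y
  have h4 : ∀ z, HasDerivAt (fun t : ℝ => φ (ψ.symm (ψ a + t • w)) z) (D w z) 0 := fun z =>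
    (h3.clm_apply (hasDerivAt_const 0 z)).congr_deriv (by simp)
  have h5 := hasDerivAt_minkowskiForm (h4 x) (h4 y)
  have h6 : (fun t : ℝ => minkowskiForm d (φ (ψ.symm (ψ a + t • w)) x)
      (φ (ψ.symm (ψ a + t • w)) y)) = fun _ => minkowskiForm d x y := funext fun t => hpres _ x y
  rw [h6] at h5
  have h7 := h5.unique (hasDerivAt_const 0 _)
  simp only [zero_smul, add_zero, hφ0] at h7
  exact h7

/-- The inclusion of `𝔬(1,d)` in the endomorphisms. -/
noncomputable def lorentzAlgebraInclusion (d : ℕ) :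
    lorentzAlgebra d →L[ℝ] MinkowskiSpace d →L[ℝ] MinkowskiSpace d := (lorentzAlgebra d).subtypeL

theorem contDiff_exp_lorentzAlgebra :
    ContDiff ℝ ∞ (fun X : lorentzAlgebra d => NormedSpace.exp (lorentzAlgebraInclusion d X)) := by
  have h1 : ContDiff ℝ ∞
      (NormedSpace.exp : (MinkowskiSpace d →L[ℝ] MinkowskiSpace d) →
        MinkowskiSpace d →L[ℝ] MinkowskiSpace d) := by
    rw [contDiff_iff_contDiffAt]
    exact fun X => (NormedSpace.exp_analytic X).contDiffAt
  exact h1.comp (ContinuousLinearMap.contDiff (𝕜 := ℝ) (E := lorentzAlgebra d)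
    (F := MinkowskiSpace d →L[ℝ] MinkowskiSpace d) (lorentzAlgebraInclusion d))

theorem hasFDerivAt_exp_lorentzAlgebra :
    HasFDerivAt (fun X : lorentzAlgebra d => NormedSpace.exp (lorentzAlgebraInclusion d X))
      (lorentzAlgebraInclusion d) 0 := by
  have h1 : HasFDerivAt (NormedSpace.exp : (MinkowskiSpace d →L[ℝ] MinkowskiSpace d) →
        MinkowskiSpace d →L[ℝ] MinkowskiSpace d)
      (1 : (MinkowskiSpace d →L[ℝ] MinkowskiSpace d) →L[ℝ]
        MinkowskiSpace d →L[ℝ] MinkowskiSpace d) (lorentzAlgebraInclusion d 0) := by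
    exact hasFDerivAt_exp_zero
  exact h1.comp (0 : lorentzAlgebra d) (ContinuousLinearMap.hasFDerivAt (𝕜 := ℝ)
    (E := lorentzAlgebra d) (F := MinkowskiSpace d →L[ℝ] MinkowskiSpace d)
    (lorentzAlgebraInclusion d))

/-- The exponential map of a Lie group `H` isomorphic to a subgroup of finite index of `O(1,d)`. -/
theorem exists_lieExp {E : Type*} [NormedAddCommGroup E] [NormedSpace ℝ E]
    {H : Type*} [Group H] [TopologicalSpace H] [ChartedSpace E H]
    {K : Subgroup (MinkowskiSpace d ≃L[ℝ] MinkowskiSpace d)} (hK : K ≤ lorentzGroup d)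
    (hKfin : K.IsFiniteRelIndex (lorentzGroup d)) {e : H ≃* K}
    (he : IsLieGroupIsoOnto (E := E) e) :
    ∃ ε : lorentzAlgebra d → H, ContMDiff 𝓘(ℝ, lorentzAlgebra d) 𝓘(ℝ, E) ∞ ε ∧
      (∀ X, (e (ε X) : MinkowskiSpace d ≃L[ℝ] MinkowskiSpace d) = expEquiv X.1) ∧
      Function.Surjective (mfderiv 𝓘(ℝ, lorentzAlgebra d) 𝓘(ℝ, E) ε 0) := by
  let ε : lorentzAlgebra d → H := fun X =>
    e.symm ⟨expEquiv X.1, expEquiv_mem_of_isFiniteRelIndex hKfin X.2⟩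
  have hε : ∀ X, (e (ε X) : MinkowskiSpace d ≃L[ℝ] MinkowskiSpace d) = expEquiv X.1 := fun X => by
    simp [ε]
  let φ : H → MinkowskiSpace d →L[ℝ] MinkowskiSpace d := fun a =>
    ((e a : MinkowskiSpace d ≃L[ℝ] MinkowskiSpace d) : MinkowskiSpace d →L[ℝ] MinkowskiSpace d)
  have hφε : ∀ X, φ (ε X) = NormedSpace.exp (lorentzAlgebraInclusion d X) := fun X => by
    change ((e (ε X) : MinkowskiSpace d ≃L[ℝ] MinkowskiSpace d) : MinkowskiSpace d →L[ℝ]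
        MinkowskiSpace d) = _
    rw [hε]; rfl
  have hε0 : φ (ε 0) = 1 := (hφε 0).trans NormedSpace.exp_zero
  have h := he.contMDiff_and_surjective_of_comp contDiff_exp_lorentzAlgebra hφε
    hasFDerivAt_exp_lorentzAlgebra fun w => ⟨⟨_, mfderiv_mem_lorentzAlgebra (he.contMDiff (ε 0))
      (fun b x y => hK (e b).2 x y) hε0 w⟩, rfl⟩
  exact ⟨ε, h.1, hε, h.2⟩

end LieExp

/-! ### Orbits and stabilizers of the Lorentz factor -/

section LorentzOrbit

variable {d : ℕ}
  {E : Type*} [NormedAddCommGroup E] [NormedSpace ℝ E]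
  {M : Type*} [TopologicalSpace M] [ChartedSpace E M]
  {E₁ : Type*} [NormedAddCommGroup E₁] [NormedSpace ℝ E₁]
  {H : Type*} [Group H] [TopologicalSpace H] [ChartedSpace E₁ H]
  {E₂ : Type*} [NormedAddCommGroup E₂] [NormedSpace ℝ E₂]
  {H' : Type*} [Group H'] [TopologicalSpace H'] [ChartedSpace E₂ H']
  [MulAction (H × H') M]
  {K : Subgroup (MinkowskiSpace d ≃L[ℝ] MinkowskiSpace d)} {e : H ≃* K}
  {ε : lorentzAlgebra d → H}

/-- `ε` is the exponential map of `H`, a group identified by `e` with a group of Lorentz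
transformations. -/
structure IsLieExp (E₁ : Type*) [NormedAddCommGroup E₁] [NormedSpace ℝ E₁]
    {H : Type*} [Group H] [TopologicalSpace H] [ChartedSpace E₁ H]
    {K : Subgroup (MinkowskiSpace d ≃L[ℝ] MinkowskiSpace d)} (e : H ≃* K)
    (ε : lorentzAlgebra d → H) : Prop where
  contMDiff : ContMDiff 𝓘(ℝ, lorentzAlgebra d) 𝓘(ℝ, E₁) ∞ ε
  coe_apply (X : lorentzAlgebra d) :
    (e (ε X) : MinkowskiSpace d ≃L[ℝ] MinkowskiSpace d) = expEquiv X.1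
  surjective : Function.Surjective (mfderiv 𝓘(ℝ, lorentzAlgebra d) 𝓘(ℝ, E₁) ε 0)

namespace IsLieExp

omit [TopologicalSpace H] in
theorem injective_coe (e : H ≃* K) {a b : H}
    (h : (e a : MinkowskiSpace d ≃L[ℝ] MinkowskiSpace d) = e b) : a = b :=
  e.injective (Subtype.ext h)

theorem map_zero (hε : IsLieExp E₁ e ε) : ε 0 = 1 :=
  injective_coe e (by rw [hε.coe_apply, _root_.map_one]; exact expEquiv_zero)

theorem map_add_smul (hε : IsLieExp E₁ e ε) (s t : ℝ) (X : lorentzAlgebra d) :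
    ε ((s + t) • X) = ε (s • X) * ε (t • X) :=
  injective_coe e <| by
    rw [map_mul, Subgroup.coe_mul, hε.coe_apply, hε.coe_apply, hε.coe_apply]
    exact expEquiv_add_smul s t X.1

theorem conj (hε : IsLieExp E₁ e ε) {a : H} {X Y : lorentzAlgebra d}
    (h : ∀ z, Y.1 ((e a : MinkowskiSpace d ≃L[ℝ] MinkowskiSpace d) z) =
      (e a : MinkowskiSpace d ≃L[ℝ] MinkowskiSpace d) (X.1 z)) (t : ℝ) :
    ε (t • Y) = a * ε (t • X) * a⁻¹ :=
  injective_coe e <| by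
    rw [map_mul, map_mul, map_inv, Subgroup.coe_mul, Subgroup.coe_mul, Subgroup.coe_inv,
      hε.coe_apply, hε.coe_apply]
    refine conj_expEquiv _ fun z => ?_
    change t • Y.1 _ = (e a : MinkowskiSpace d ≃L[ℝ] MinkowskiSpace d) (t • X.1 z)
    rw [h, map_smul]

variable [hact : ContMDiffSMul (𝓘(ℝ, E₁).prod 𝓘(ℝ, E₂)) 𝓘(ℝ, E) ∞ (H × H') M]

variable (E) in
/-- The derivative at the neutral element of the orbit map of `p`, on the Lie algebra of `H`. -/
noncomputable def orbitDeriv (ε : lorentzAlgebra d → H) (H' : Type*) [Group H']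
    [MulAction (H × H') M] (p : M) : lorentzAlgebra d →L[ℝ] E :=
  mfderiv 𝓘(ℝ, lorentzAlgebra d) 𝓘(ℝ, E) (fun X => ((ε X, 1) : H × H') • p) 0

include hact in
theorem contMDiff_orbit (hε : IsLieExp E₁ e ε) (p : M) :
    ContMDiff 𝓘(ℝ, lorentzAlgebra d) 𝓘(ℝ, E) ∞ (fun X => ((ε X, 1) : H × H') • p) :=
  hact.contMDiff_smul.comp ((hε.contMDiff.prodMk contMDiff_const).prodMk contMDiff_const)

omit hact in
theorem contMDiff_line (X : lorentzAlgebra d) :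
    ContMDiff 𝓘(ℝ, ℝ) 𝓘(ℝ, lorentzAlgebra d) ∞ (fun t : ℝ => t • X) :=
  (ContinuousLinearMap.contDiff (𝕜 := ℝ) (E := ℝ) (F := lorentzAlgebra d)
    ((1 : ℝ →L[ℝ] ℝ).smulRight X)).contMDiff

include hact in
theorem contMDiff_curve (hε : IsLieExp E₁ e ε) (p : M) (X : lorentzAlgebra d) :
    ContMDiff 𝓘(ℝ, ℝ) 𝓘(ℝ, E) ∞ (fun t : ℝ => ((ε (t • X), 1) : H × H') • p) :=
  (hε.contMDiff_orbit (E₂ := E₂) p).comp (contMDiff_line X)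

include hact in
theorem mfderiv_curve (hε : IsLieExp E₁ e ε) (p : M) (X : lorentzAlgebra d) (v : ℝ) :
    (mfderiv 𝓘(ℝ, ℝ) 𝓘(ℝ, E) (fun t : ℝ => ((ε (t • X), 1) : H × H') • p) 0 : ℝ →L[ℝ] E) v =
      orbitDeriv E ε H' p (v • X) := by
  have h1 : HasFDerivAt (fun t : ℝ => t • X) ((1 : ℝ →L[ℝ] ℝ).smulRight X) 0 :=
    ContinuousLinearMap.hasFDerivAt (𝕜 := ℝ) (E := ℝ) (F := lorentzAlgebra d)
      ((1 : ℝ →L[ℝ] ℝ).smulRight X)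
  refine (mfderiv_apply_of_comp (hε.contMDiff_orbit (E := E) (E₂ := E₂) (H' := H') p)
      (contMDiff_line X)
    (fun _ => rfl) (zero_smul ℝ X) v).trans ?_
  rw [mfderiv_eq_fderiv, h1.fderiv]
  rfl

include hact in
/-- A vector of the Lie algebra whose fundamental vector field vanishes at `p` generates a
one-parameter group that fixes `p`. -/
theorem smul_eq_of_orbitDeriv_eq_zero [T2Space M] [IsManifold 𝓘(ℝ, E) ∞ M]
    (hε : IsLieExp E₁ e ε) {p : M} {X : lorentzAlgebra d} (hX : orbitDeriv E ε H' p X = 0) :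
    ((ε X, 1) : H × H') • p = p := by
  let γ : ℝ → M := fun t => ((ε (t • X), 1) : H × H') • p
  have hγ : ContMDiff 𝓘(ℝ, ℝ) 𝓘(ℝ, E) ∞ γ := hε.contMDiff_curve (E₂ := E₂) p X
  have h0 : ∀ v : ℝ, (mfderiv 𝓘(ℝ, ℝ) 𝓘(ℝ, E) γ 0 : ℝ →L[ℝ] E) v = 0 := fun v => by
    refine (hε.mfderiv_curve (E₂ := E₂) p X v).trans ?_
    rw [map_smul, hX]
    exact smul_zero (A := E) v
  have h1 : ∀ s, mfderiv 𝓘(ℝ, ℝ) 𝓘(ℝ, E) γ s = 0 := by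
    intro s
    -- `γ t` is the translate of `γ (t - s)` by a group element
    have hsub : ContMDiff 𝓘(ℝ, ℝ) 𝓘(ℝ, ℝ) ∞ (fun t : ℝ => t - s) :=
      (contDiff_id.sub contDiff_const).contMDiff
    have hA := contMDiff_prod_smul (E := E) (M := M) E₁ E₂ ((ε (s • X), 1) : H × H')
    have h2 : ∀ t, ((ε (s • X), 1) : H × H') • γ (t - s) = γ t := fun t => by
      change ((ε (s • X), 1) : H × H') • ((ε ((t - s) • X), 1) : H × H') • p =
        ((ε (t • X), 1) : H × H') • p
      rw [smul_smul, Prod.mk_mul_mk, ← hε.map_add_smul, one_mul, add_sub_cancel]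
    refine ContinuousLinearMap.ext fun v => ?_
    have h3 := mfderiv_apply_of_comp (hA.comp hγ) hsub h2 (sub_self s) v
    have h4 := fun w : ℝ => mfderiv_apply_of_comp (x := (0 : ℝ)) hA hγ (fun _ => rfl) rfl w
    exact h3.trans ((h4 _).trans ((congrArg _ (h0 _)).trans (_root_.map_zero _)))
  have h5 := eq_of_mfderiv_eq_zero hγ h1 1 0
  simp only [γ, one_smul, zero_smul, hε.map_zero, ← Prod.one_eq_mk] at h5
  exact h5

include hact in
/-- The derivative of the orbit map is equivariant under the stabilizer. -/
theorem orbitDeriv_conj (hε : IsLieExp E₁ e ε) {p : M} {a : H} {b : H'} (hab : (a, b) • p = p)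
    {X Y : lorentzAlgebra d} (h : ∀ z, Y.1 ((e a : MinkowskiSpace d ≃L[ℝ] MinkowskiSpace d) z) =
      (e a : MinkowskiSpace d ≃L[ℝ] MinkowskiSpace d) (X.1 z)) :
    orbitDeriv E ε H' p Y = (mfderiv 𝓘(ℝ, E) 𝓘(ℝ, E) (fun m : M => (a, b) • m) p : E →L[ℝ] E)
      (orbitDeriv E ε H' p X) := by
  have h1 : ∀ t : ℝ, (a, b) • ((ε (t • X), 1) : H × H') • p = ((ε (t • Y), 1) : H × H') • p := by
    intro t
    rw [hε.conj h t]
    conv_rhs => rw [← hab]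
    rw [smul_smul, smul_smul, Prod.mk_mul_mk, Prod.mk_mul_mk, inv_mul_cancel_right, one_mul,
      mul_one]
  have h2 := mfderiv_apply_of_comp (contMDiff_prod_smul (E := E) E₁ E₂ (a, b))
    (hε.contMDiff_curve (E := E) (E₂ := E₂) (H' := H') p X) h1 (x := 0) (y := p)
    (by rw [zero_smul, hε.map_zero, ← Prod.one_eq_mk, one_smul]) (1 : ℝ)
  have h3 := hε.mfderiv_curve (E := E) (E₂ := E₂) (H' := H') p X 1
  have h4 := hε.mfderiv_curve (E := E) (E₂ := E₂) (H' := H') p Y 1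
  rw [one_smul] at h3 h4
  exact h4.symm.trans (h2.trans (congrArg _ h3))

section Orbit

variable {E₀ : Type*} [NormedAddCommGroup E₀] [NormedSpace ℝ E₀]
  {C : Type*} [TopologicalSpace C] [ChartedSpace E₀ C] {ι : C → M} {π : H → C} {p : M}

omit [TopologicalSpace H'] in
/-- The orbit map of the Lie algebra factors through the immersion `ι` of the orbit. -/
theorem orbitDeriv_eq (hε : IsLieExp E₁ e ε) (hι : ContMDiff 𝓘(ℝ, E₀) 𝓘(ℝ, E) ∞ ι)
    (hπ : ContMDiff 𝓘(ℝ, E₁) 𝓘(ℝ, E₀) ∞ π) (hιπ : ∀ a, ι (π a) = ((a, 1) : H × H') • p)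
    (X : lorentzAlgebra d) :
    orbitDeriv E ε H' p X = (mfderiv 𝓘(ℝ, E₀) 𝓘(ℝ, E) ι (π 1) : E₀ →L[ℝ] E)
      ((mfderiv 𝓘(ℝ, E₁) 𝓘(ℝ, E₀) π 1 : E₁ →L[ℝ] E₀)
        ((mfderiv 𝓘(ℝ, lorentzAlgebra d) 𝓘(ℝ, E₁) ε 0 : lorentzAlgebra d →L[ℝ] E₁) X)) :=
  (mfderiv_apply_of_comp (hι.comp hπ) hε.contMDiff (fun X => hιπ (ε X)) hε.map_zero X).trans
    (mfderiv_apply_of_comp hι hπ (fun _ => rfl) rfl _)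

omit [TopologicalSpace H'] in
/-- The infinitesimal action at `p` maps onto the tangent space of the orbit. -/
theorem range_orbitDeriv (hε : IsLieExp E₁ e ε) (hι : ContMDiff 𝓘(ℝ, E₀) 𝓘(ℝ, E) ∞ ι)
    (hπ : ContMDiff 𝓘(ℝ, E₁) 𝓘(ℝ, E₀) ∞ π) (hιπ : ∀ a, ι (π a) = ((a, 1) : H × H') • p)
    (hπs : ∀ a, Function.Surjective (mfderiv 𝓘(ℝ, E₁) 𝓘(ℝ, E₀) π a)) :
    LinearMap.range (orbitDeriv E ε H' p).toLinearMap =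
      LinearMap.range (mfderiv 𝓘(ℝ, E₀) 𝓘(ℝ, E) ι (π 1) : E₀ →L[ℝ] E).toLinearMap := by
  ext v
  constructor
  · rintro ⟨X, rfl⟩
    exact ⟨_, (hε.orbitDeriv_eq hι hπ hιπ X).symm⟩
  · rintro ⟨u, rfl⟩
    obtain ⟨w, rfl⟩ := hπs 1 u
    have hs := hε.surjective
    rw [hε.map_zero] at hs
    obtain ⟨X, rfl⟩ := hs w
    exact ⟨X, hε.orbitDeriv_eq hι hπ hιπ X⟩

omit [TopologicalSpace M] [TopologicalSpace H'] in
/-- The group generated by exponentials is transitive on the orbit if the orbit is connected: its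
orbits are open. -/
theorem exists_mem_expGroup_smul_eq [FiniteDimensional ℝ E₀] [ContMDiffMul 𝓘(ℝ, E₁) ∞ H]
    [PreconnectedSpace C] (hε : IsLieExp E₁ e ε)
    (hιinj : Function.Injective ι) (hπ : ContMDiff 𝓘(ℝ, E₁) 𝓘(ℝ, E₀) ∞ π)
    (hπsurj : Function.Surjective π) (hιπ : ∀ a, ι (π a) = ((a, 1) : H × H') • p)
    (hπs : ∀ a, Function.Surjective (mfderiv 𝓘(ℝ, E₁) 𝓘(ℝ, E₀) π a)) (a : H) :
    ∃ g : H, (e g : MinkowskiSpace d ≃L[ℝ] MinkowskiSpace d) ∈ expGroup d ∧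
      ((a, 1) : H × H') • p = ((g, 1) : H × H') • p := by
  let Γ : Subgroup H := ((expGroup d).comap K.subtype).comap e.toMonoidHom
  have hΓ : ∀ g, g ∈ Γ ↔ (e g : MinkowskiSpace d ≃L[ℝ] MinkowskiSpace d) ∈ expGroup d :=
    fun g => Iff.rfl
  let U : H → Set C := fun b => {x | ∃ g ∈ Γ, π (g * b) = x}
  have hπeq : ∀ g a b : H, π a = π b → π (g * a) = π (g * b) := by
    intro g a b hab
    apply hιinj
    have h1 : ∀ a, ι (π (g * a)) = ((g, 1) : H × H') • ι (π a) := fun a => by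
      rw [hιπ, hιπ, smul_smul, Prod.mk_mul_mk, mul_one]
    rw [h1, h1, hab]
  have hopen : ∀ b, IsOpen (U b) := by
    intro b
    rw [isOpen_iff_mem_nhds]
    rintro _ ⟨g, hg, rfl⟩
    let F : lorentzAlgebra d → C := fun X => π (ε X * (g * b))
    have hR : ContMDiff 𝓘(ℝ, E₁) 𝓘(ℝ, E₁) ∞ (fun a : H => a * (g * b)) := contMDiff_mul_right
    have hR' : ContMDiff 𝓘(ℝ, E₁) 𝓘(ℝ, E₁) ∞ (fun a : H => a * (g * b)⁻¹) := contMDiff_mul_right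
    have hRε : ContMDiff 𝓘(ℝ, lorentzAlgebra d) 𝓘(ℝ, E₁) ∞ (fun X => ε X * (g * b)) :=
      hR.comp hε.contMDiff
    have hF : ContMDiff 𝓘(ℝ, lorentzAlgebra d) 𝓘(ℝ, E₀) ∞ F := hπ.comp hRε
    have hF0 : F 0 = π (g * b) := by simp only [F, hε.map_zero, one_mul]
    have hs : Function.Surjective (mfderiv 𝓘(ℝ, lorentzAlgebra d) 𝓘(ℝ, E₀) F 0) := by
      intro u
      obtain ⟨w, rfl⟩ := hπs (g * b) u
      have hid := fun w : E₁ => (mfderiv_apply_of_comp hR hR'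
        (fun a => inv_mul_cancel_right a (g * b)) (mul_inv_cancel (g * b)) w).symm.trans
        (mfderiv_apply_of_eq_id (fun _ => rfl) (g * b) w)
      have hεs := hε.surjective
      rw [hε.map_zero] at hεs
      obtain ⟨X, hX⟩ := hεs ((mfderiv 𝓘(ℝ, E₁) 𝓘(ℝ, E₁) (fun a : H => a * (g * b)⁻¹) (g * b) :
        E₁ →L[ℝ] E₁) w)
      refine ⟨X, ?_⟩
      refine (mfderiv_apply_of_comp (y := g * b) hπ hRε (fun _ => rfl)
        (by rw [hε.map_zero, one_mul]) X).trans
        (congrArg (mfderiv 𝓘(ℝ, E₁) 𝓘(ℝ, E₀) π (g * b) : E₁ →L[ℝ] E₀) ?_)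
      refine (mfderiv_apply_of_comp hR hε.contMDiff (fun _ => rfl) hε.map_zero X).trans ?_
      exact (congrArg (mfderiv 𝓘(ℝ, E₁) 𝓘(ℝ, E₁) (fun a : H => a * (g * b)) 1 : E₁ →L[ℝ] E₁)
        hX).trans (hid w)
    have h1 := image_mem_nhds_of_mfderiv_surjective hF.contMDiffAt hs
    rw [hF0] at h1
    refine Filter.mem_of_superset h1 ?_
    rintro _ ⟨X, rfl⟩
    refine ⟨ε X * g, Γ.mul_mem ?_ hg, by rw [mul_assoc]⟩
    rw [hΓ, hε.coe_apply]
    exact expEquiv_mem_expGroup X.2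
  have hclosed : IsClosed (U 1) := by
    rw [← isOpen_compl_iff, isOpen_iff_mem_nhds]
    intro x hx
    obtain ⟨b, rfl⟩ := hπsurj x
    refine Filter.mem_of_superset ((hopen b).mem_nhds ⟨1, Γ.one_mem, by rw [one_mul]⟩) ?_
    rintro _ ⟨g, hg, rfl⟩ ⟨g', hg', h⟩
    refine hx ⟨g⁻¹ * g', Γ.mul_mem (Γ.inv_mem hg) hg', ?_⟩
    have := hπeq g⁻¹ _ _ h
    rwa [inv_mul_cancel_left, ← mul_assoc] at this
  have huniv : U 1 = Set.univ :=
    IsClopen.eq_univ ⟨hclosed, hopen 1⟩ ⟨π 1, 1, Γ.one_mem, by rw [one_mul]⟩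
  have hmem : π a ∈ U 1 := huniv ▸ Set.mem_univ _
  obtain ⟨g, hg, h⟩ := hmem
  refine ⟨g, hg, ?_⟩
  rw [← hιπ, ← hιπ, ← h, mul_one]

end Orbit

end IsLieExp

end LorentzOrbit

section Stabilizer

variable {d : ℕ} {M H H' : Type*} [Group H] [Group H'] [MulAction (H × H') M]
  {K : Subgroup (MinkowskiSpace d ≃L[ℝ] MinkowskiSpace d)} {e : H ≃* K}

/-- The Lorentz transformations that are components of elements of the stabilizer of `p`. -/
def stabilizerImage (e : H ≃* K) (H' : Type*) [Group H'] [MulAction (H × H') M] (p : M) :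
    Subgroup (MinkowskiSpace d ≃L[ℝ] MinkowskiSpace d) :=
  ((MulAction.stabilizer (H × H') p).map (MonoidHom.fst H H')).map
    (K.subtype.comp e.toMonoidHom)

/-- The Lorentz transformations that fix `p`. -/
def stabilizerLeft (e : H ≃* K) (H' : Type*) [Group H'] [MulAction (H × H') M] (p : M) :
    Subgroup (MinkowskiSpace d ≃L[ℝ] MinkowskiSpace d) :=
  ((MulAction.stabilizer (H × H') p).comap (MonoidHom.inl H H')).map
    (K.subtype.comp e.toMonoidHom)

theorem mem_stabilizerImage {p : M} {g : MinkowskiSpace d ≃L[ℝ] MinkowskiSpace d} :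
    g ∈ stabilizerImage e H' p ↔ ∃ (a : H) (b : H'), (a, b) • p = p ∧ e a = g := by
  constructor
  · rintro ⟨_, ⟨⟨a, b⟩, hab, rfl⟩, rfl⟩
    exact ⟨a, b, hab, rfl⟩
  · rintro ⟨a, b, hab, rfl⟩
    exact ⟨a, ⟨(a, b), hab, rfl⟩, rfl⟩

theorem mem_stabilizerLeft {p : M} {g : MinkowskiSpace d ≃L[ℝ] MinkowskiSpace d} :
    g ∈ stabilizerLeft e H' p ↔ ∃ a : H, ((a, 1) : H × H') • p = p ∧ e a = g := by
  constructor
  · rintro ⟨a, ha, rfl⟩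
    exact ⟨a, ha, rfl⟩
  · rintro ⟨a, ha, rfl⟩
    exact ⟨a, ha, rfl⟩

theorem coe_mem_stabilizerLeft {p : M} {a : H} :
    (e a : MinkowskiSpace d ≃L[ℝ] MinkowskiSpace d) ∈ stabilizerLeft e H' p ↔
      ((a, 1) : H × H') • p = p := by
  rw [mem_stabilizerLeft]
  refine ⟨?_, fun h => ⟨a, h, rfl⟩⟩
  rintro ⟨a', ha', h⟩
  rwa [← IsLieExp.injective_coe e h]

theorem stabilizerLeft_le_image (p : M) : stabilizerLeft e H' p ≤ stabilizerImage e H' p := by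
  intro g hg
  obtain ⟨a, ha, rfl⟩ := mem_stabilizerLeft.1 hg
  exact mem_stabilizerImage.2 ⟨a, 1, ha, rfl⟩

theorem stabilizerImage_le (hK : K ≤ lorentzGroup d) (p : M) :
    stabilizerImage e H' p ≤ lorentzGroup d := by
  intro g hg
  obtain ⟨a, b, -, rfl⟩ := mem_stabilizerImage.1 hg
  exact hK (e a).2

/-- The `H`-component of an element of the stabilizer of `p` fixes `p` if this holds for
components that are products of exponentials, provided that those are transitive on the
`H`-orbit of `p`. -/
theorem smul_eq_of_stabilizer {p : M}
    (htr : ∀ a : H, ∃ g : H, (e g : MinkowskiSpace d ≃L[ℝ] MinkowskiSpace d) ∈ expGroup d ∧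
      ((a, 1) : H × H') • p = ((g, 1) : H × H') • p)
    (hS : ∀ g ∈ stabilizerImage e H' p, g ∈ expGroup d → g ∈ stabilizerLeft e H' p)
    (a : H) (b : H') (hab : (a, b) • p = p) : ((a, 1) : H × H') • p = p := by
  obtain ⟨g, hg, hag⟩ := htr a
  have h1 : ((a⁻¹ * g, 1) : H × H') • p = p := by
    have : ((a⁻¹ * g, 1) : H × H') = ((a, 1) : H × H')⁻¹ * (g, 1) := by simp
    rw [this, mul_smul, ← hag, inv_smul_smul]
  have h2 : (g, b) • p = p := by
    have : ((g, b) : H × H') = (a, b) * (a⁻¹ * g, 1) := by simp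
    rw [this, mul_smul, h1, hab]
  rw [hag]
  exact coe_mem_stabilizerLeft.1 (hS _ (mem_stabilizerImage.2 ⟨g, b, h2, rfl⟩) hg)

end Stabilizer

/-! ### Homotheties of the lightcone -/

namespace LightCone

variable {d : ℕ}

theorem contDiff_spacePart : ContDiff ℝ ∞ (spacePart (d := d)) := by
  rw [contDiff_euclidean]
  intro i
  simp only [spacePart]
  fun_prop

/-- A map into the lightcone is smooth if it is smooth as a map into Minkowski space. -/
theorem contMDiff_of_incl {E : Type*} [NormedAddCommGroup E] [NormedSpace ℝ E]
    {X : Type*} [TopologicalSpace X] [ChartedSpace E X] [IsManifold 𝓘(ℝ, E) ∞ X]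
    {f : X → LightCone d}
    (hf : ContMDiff 𝓘(ℝ, E) 𝓘(ℝ, MinkowskiSpace d) ∞ (fun x => (f x).incl)) :
    ContMDiff 𝓘(ℝ, E) (𝓡 d) ∞ f := by
  rw [contMDiff_iff_target]
  refine ⟨continuous_induced_rng.2 hf.continuous, fun y => ?_⟩
  exact ((contDiff_spacePart (d := d)).contMDiff.comp hf).contMDiffOn

/-- The homothety `x ↦ t x` of the lightcone. -/
noncomputable def scale (t : ℝ) (ht : 0 < t) (x : LightCone d) : LightCone d where
  incl := t • x.incl
  isotropic := by rw [minkowskiForm_smul_left, minkowskiForm_smul_right, x.isotropic]; simp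
  pos := by
    have := mul_pos ht x.pos
    simpa using this

theorem contMDiff_scale (t : ℝ) (ht : 0 < t) : ContMDiff (𝓡 d) (𝓡 d) ∞ (scale (d := d) t ht) :=
  contMDiff_of_incl <|
    (contDiff_const_smul (𝕜 := ℝ) (F := MinkowskiSpace d) t).contMDiff.comp contMDiff_incl

theorem scale_scale {s t : ℝ} (hs : 0 < s) (ht : 0 < t) (hst : s * t = 1) (x : LightCone d) :
    scale s hs (scale t ht x) = x := by
  ext1
  change s • t • x.incl = x.incl
  rw [smul_smul, hst, one_smul]

theorem mfderiv_incl_scale (t : ℝ) (ht : 0 < t) (x : LightCone d) (v : EuclideanSpace ℝ (Fin d)) :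
    (mfderiv (𝓡 d) 𝓘(ℝ, MinkowskiSpace d) incl (scale t ht x) :
      EuclideanSpace ℝ (Fin d) →L[ℝ] MinkowskiSpace d)
      ((mfderiv (𝓡 d) (𝓡 d) (scale t ht) x :
        EuclideanSpace ℝ (Fin d) →L[ℝ] EuclideanSpace ℝ (Fin d)) v) =
      t • (mfderiv (𝓡 d) 𝓘(ℝ, MinkowskiSpace d) incl x :
        EuclideanSpace ℝ (Fin d) →L[ℝ] MinkowskiSpace d) v := by
  let T : MinkowskiSpace d →L[ℝ] MinkowskiSpace d := t • ContinuousLinearMap.id ℝ _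
  have hT : ContMDiff 𝓘(ℝ, MinkowskiSpace d) 𝓘(ℝ, MinkowskiSpace d) ∞ T := T.contDiff.contMDiff
  refine (mfderiv_apply_of_comp contMDiff_incl (contMDiff_scale t ht) (fun _ => rfl) rfl
    v).symm.trans ?_
  refine (mfderiv_apply_of_comp hT contMDiff_incl (fun x => rfl) rfl v).trans ?_
  rw [mfderiv_eq_fderiv, T.fderiv]
  rfl

theorem minkowskiForm_smul_smul (t : ℝ) (v w : MinkowskiSpace d) :
    minkowskiForm d (t • v) (t • w) = t ^ 2 * minkowskiForm d v w := by
  rw [minkowskiForm_smul_left, minkowskiForm_smul_right, ← mul_assoc, ← sq]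

/-- The homothety by `t` multiplies the tensor of the lightcone by `t²`. -/
theorem metric_scale (t : ℝ) (ht : 0 < t) (x : LightCone d) (v w : EuclideanSpace ℝ (Fin d)) :
    metric d (scale t ht x)
      ((mfderiv (𝓡 d) (𝓡 d) (scale t ht) x :
        EuclideanSpace ℝ (Fin d) →L[ℝ] EuclideanSpace ℝ (Fin d)) v)
      ((mfderiv (𝓡 d) (𝓡 d) (scale t ht) x :
        EuclideanSpace ℝ (Fin d) →L[ℝ] EuclideanSpace ℝ (Fin d)) w) = t ^ 2 * metric d x v w := by
  refine (congrArg₂ (minkowskiForm d) (mfderiv_incl_scale t ht x v)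
    (mfderiv_incl_scale t ht x w)).trans ?_
  exact minkowskiForm_smul_smul t _ _

/-- The generator of the homotheties is a null vector field without zeros on the lightcone. -/
theorem exists_radial (x : LightCone d) :
    ∃ u : EuclideanSpace ℝ (Fin d), u ≠ 0 ∧ metric d x u u = 0 := by
  let γ : ℝ → LightCone d := fun t => scale (Real.exp t) (Real.exp_pos t) x
  have h1 : HasDerivAt (fun t : ℝ => Real.exp t • x.incl) x.incl 0 := by
    simpa using (Real.hasDerivAt_exp 0).smul_const x.incl
  have hγ : ContMDiff 𝓘(ℝ, ℝ) (𝓡 d) ∞ γ := by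
    refine contMDiff_of_incl ?_
    exact (Real.contDiff_exp.smul contDiff_const).contMDiff
  have hγ0 : γ 0 = x := by
    ext1
    change Real.exp 0 • x.incl = x.incl
    rw [Real.exp_zero, one_smul]
  let u : EuclideanSpace ℝ (Fin d) :=
    (mfderiv 𝓘(ℝ, ℝ) (𝓡 d) γ 0 : ℝ →L[ℝ] EuclideanSpace ℝ (Fin d)) 1
  let D : EuclideanSpace ℝ (Fin d) →L[ℝ] MinkowskiSpace d :=
    mfderiv (𝓡 d) 𝓘(ℝ, MinkowskiSpace d) incl x
  have hu : D u = x.incl := by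
    refine (mfderiv_apply_of_comp contMDiff_incl hγ (fun _ => rfl) hγ0 (1 : ℝ)).symm.trans ?_
    change (mfderiv 𝓘(ℝ, ℝ) 𝓘(ℝ, MinkowskiSpace d) (fun t : ℝ => Real.exp t • x.incl) 0 :
      ℝ →L[ℝ] MinkowskiSpace d) 1 = _
    rw [mfderiv_eq_fderiv, h1.hasFDerivAt.fderiv]
    exact one_smul ℝ x.incl
  refine ⟨u, fun h0 => ?_, (congrArg₂ (minkowskiForm d) hu hu).trans x.isotropic⟩
  rw [h0, map_zero] at hu
  have := x.pos
  rw [← hu] at this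
  exact lt_irrefl _ this

/-- The lightcone is connected in dimension at least two: it is parametrized by `ℝ^d ∖ {0}`. -/
theorem preconnectedSpace (hd : 2 ≤ d) : PreconnectedSpace (LightCone d) := by
  have hrank : 1 < Module.rank ℝ (EuclideanSpace ℝ (Fin d)) := by
    rw [← Module.finrank_eq_rank, finrank_euclideanSpace, Fintype.card_fin]
    exact_mod_cast hd
  have hconn : IsPreconnected ({0}ᶜ : Set (EuclideanSpace ℝ (Fin d))) :=
    (isConnected_compl_singleton_of_one_lt_rank hrank 0).isPreconnected
  refine ⟨?_⟩
  rcases isEmpty_or_nonempty (LightCone d) with h | ⟨⟨p⟩⟩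
  · rw [Set.univ_eq_empty_iff.2 h]
    exact isPreconnected_empty
  · have h1 := hconn.image (chart p).symm (chart p).continuousOn_invFun
    have h2 : (chart p).symm '' {0}ᶜ = Set.univ := (chart p).symm.image_source_eq_target
    rwa [h2] at h1

end LightCone

/-! ### Orbits with one null direction -/

theorem finrank_ker_add_of_range_eq {V F F₀ : Type*} [AddCommGroup V] [Module ℝ V]
    [FiniteDimensional ℝ V] [AddCommGroup F] [Module ℝ F] [AddCommGroup F₀] [Module ℝ F₀]
    {L : V →ₗ[ℝ] F} {D : F₀ →ₗ[ℝ] F} (hD : Function.Injective D)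
    (h : LinearMap.range L = LinearMap.range D) :
    Module.finrank ℝ (LinearMap.ker L) + Module.finrank ℝ F₀ = Module.finrank ℝ V := by
  rw [← LinearMap.finrank_range_of_inj hD, ← h, add_comm, LinearMap.finrank_range_add_finrank_ker]

theorem finrank_comap_of_le_range {V F : Type*} [AddCommGroup V] [Module ℝ V]
    [FiniteDimensional ℝ V] [AddCommGroup F] [Module ℝ F] {L : V →ₗ[ℝ] F} {q : Submodule ℝ F}
    (h : q ≤ LinearMap.range L) :
    Module.finrank ℝ (q.comap L) = Module.finrank ℝ (LinearMap.ker L) + Module.finrank ℝ q := by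
  have hle : LinearMap.ker L ≤ q.comap L := fun X hX => by
    rw [Submodule.mem_comap, LinearMap.mem_ker.1 hX]
    exact q.zero_mem
  have h1 := (L.domRestrict (q.comap L)).finrank_range_add_finrank_ker
  rw [LinearMap.range_domRestrict, Submodule.map_comap_eq_of_le h, LinearMap.ker_domRestrict,
    (Submodule.comapSubtypeEquivOfLe hle).finrank_eq] at h1
  rw [← h1, add_comm]

section LorentzFactor

variable {d : ℕ}
  {E : Type*} [NormedAddCommGroup E] [NormedSpace ℝ E] [FiniteDimensional ℝ E]
  {M : Type*} [TopologicalSpace M] [T2Space M] [ChartedSpace E M] [IsManifold 𝓘(ℝ, E) ∞ M]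
  {h : LightlikeMetric E M}
  {E₁ : Type*} [NormedAddCommGroup E₁] [NormedSpace ℝ E₁] [FiniteDimensional ℝ E₁]
  {H : Type*} [Group H] [TopologicalSpace H] [SecondCountableTopology H]
  [ChartedSpace E₁ H] [LieGroup 𝓘(ℝ, E₁) ∞ H]
  {K : Subgroup (MinkowskiSpace d ≃L[ℝ] MinkowskiSpace d)} {e : H ≃* K}
  {ε : lorentzAlgebra d → H}
  {E₂ : Type*} [NormedAddCommGroup E₂] [NormedSpace ℝ E₂]
  {H' : Type*} [Group H'] [TopologicalSpace H'] [ChartedSpace E₂ H']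
  [MulAction (H × H') M]
  [hact : ContMDiffSMul (𝓘(ℝ, E₁).prod 𝓘(ℝ, E₂)) 𝓘(ℝ, E) ∞ (H × H') M]
  {E₀ : Type*} [NormedAddCommGroup E₀] [NormedSpace ℝ E₀] [FiniteDimensional ℝ E₀]
  {C : Type*} [TopologicalSpace C] [ChartedSpace E₀ C] [IsManifold 𝓘(ℝ, E₀) ∞ C]
  {ι : C → M} {π : H → C} {p : M}

include hact in
omit [T2Space M] [IsManifold 𝓘(ℝ, E) ∞ M] in
/-- The projection of the group to an immersed orbit is a submersion. -/
theorem mfderiv_surjective_of_orbit (hι : ContMDiff 𝓘(ℝ, E₀) 𝓘(ℝ, E) ∞ ι)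
    (hinj : ∀ x, Function.Injective (mfderiv 𝓘(ℝ, E₀) 𝓘(ℝ, E) ι x))
    (hπ : ContMDiff 𝓘(ℝ, E₁) 𝓘(ℝ, E₀) ∞ π) (hπsurj : Function.Surjective π)
    (hιπ : ∀ a, ι (π a) = ((a, 1) : H × H') • p) (a : H) :
    Function.Surjective (mfderiv 𝓘(ℝ, E₁) 𝓘(ℝ, E₀) π a) := by
  have : IsManifold 𝓘(ℝ, E₁) ∞ H := LieGroup.toContMDiffMul.toIsManifold
  refine mfderiv_surjective_of_equivariant (β := fun (a : H) (m : M) => ((a, 1) : H × H') • m)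
    (fun a => contMDiff_mul_left) hπ hπsurj hι hinj
    (fun a => contMDiff_prod_smul E₁ E₂ ((a, 1) : H × H')) (fun a z => ?_) (fun a b => ?_) a
  · rw [smul_smul, Prod.mk_mul_mk, inv_mul_cancel, one_mul, ← Prod.one_eq_mk, one_smul]
  · rw [hιπ, hιπ, smul_smul, Prod.mk_mul_mk, one_mul]

omit [FiniteDimensional ℝ E] [T2Space M] in
/-- An element that fixes `p` acts isometrically on the tangent space at `p`. -/
theorem LightlikeMetric.IsIsometricAction.form_of_smul_eq {G : Type*} [Group G] [MulAction G M]
    (hisom : h.IsIsometricAction G) {g : G} (hg : g • p = p) (v w : E) :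
    (h.form p : E →L[ℝ] E →L[ℝ] ℝ)
      ((mfderiv 𝓘(ℝ, E) 𝓘(ℝ, E) (fun m : M => g • m) p : E →L[ℝ] E) v)
      ((mfderiv 𝓘(ℝ, E) 𝓘(ℝ, E) (fun m : M => g • m) p : E →L[ℝ] E) w) =
      (h.form p : E →L[ℝ] E →L[ℝ] ℝ) v w :=
  (h.form_congr hg.symm _ _).trans (hisom g p v w)

include hact in
omit [FiniteDimensional ℝ E] [T2Space M] [FiniteDimensional ℝ E₁] [SecondCountableTopology H]
  [LieGroup 𝓘(ℝ, E₁) ∞ H] in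
/-- The tensor induced on the Lie algebra of `H` by the action at `p` is invariant under conjugation
by the `H`-components of the stabilizer of `p`. -/
theorem form_orbitDeriv_conj (hε : IsLieExp E₁ e ε) (hisom : h.IsIsometricAction (H × H'))
    {a : H} {b : H'} (hab : (a, b) • p = p) {X Y : lorentzAlgebra d}
    (hXY : ∀ z, Y.1 ((e a : MinkowskiSpace d ≃L[ℝ] MinkowskiSpace d) z) =
      (e a : MinkowskiSpace d ≃L[ℝ] MinkowskiSpace d) (X.1 z)) :
    (h.form p : E →L[ℝ] E →L[ℝ] ℝ) (IsLieExp.orbitDeriv E ε H' p Y)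
        (IsLieExp.orbitDeriv E ε H' p Y) =
      (h.form p : E →L[ℝ] E →L[ℝ] ℝ) (IsLieExp.orbitDeriv E ε H' p X)
        (IsLieExp.orbitDeriv E ε H' p X) := by
  rw [hε.orbitDeriv_conj (E := E) (E₂ := E₂) hab hXY]
  exact hisom.form_of_smul_eq hab _ _

include hact in
omit [FiniteDimensional ℝ E] [T2Space M] [IsManifold 𝓘(ℝ, E) ∞ M] [FiniteDimensional ℝ E₁]
  [SecondCountableTopology H] [LieGroup 𝓘(ℝ, E₁) ∞ H] in
/-- The derivative at `p` of an element of `H` that fixes `p` is trivial on the tangent space of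
the `H'`-orbit, because `H` and `H'` commute. -/
theorem mfderiv_smul_left_eq {a : H} (ha : ((a, 1) : H × H') • p = p) (w : E₂) :
    (mfderiv 𝓘(ℝ, E) 𝓘(ℝ, E) (fun m : M => ((a, 1) : H × H') • m) p : E →L[ℝ] E)
      ((mfderiv 𝓘(ℝ, E₂) 𝓘(ℝ, E) (fun b : H' => ((1, b) : H × H') • p) 1 : E₂ →L[ℝ] E) w) =
    (mfderiv 𝓘(ℝ, E₂) 𝓘(ℝ, E) (fun b : H' => ((1, b) : H × H') • p) 1 : E₂ →L[ℝ] E) w := by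
  have hO : ContMDiff 𝓘(ℝ, E₂) 𝓘(ℝ, E) ∞ (fun b : H' => ((1, b) : H × H') • p) :=
    hact.contMDiff_smul.comp ((contMDiff_const.prodMk contMDiff_id).prodMk contMDiff_const)
  refine (mfderiv_apply_of_comp (contMDiff_prod_smul (E := E) (M := M) E₁ E₂ ((a, 1) : H × H')) hO
    (fun b => ?_) ?_ w).symm
  · conv_rhs => rw [← ha]
    rw [smul_smul, smul_smul, Prod.mk_mul_mk, Prod.mk_mul_mk, mul_one, one_mul, one_mul, mul_one]
  · rw [← Prod.one_eq_mk, one_smul]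

include hact in
/-- If the `H`-orbit of `p` is modelled on `C` and carries exactly one null direction, the
`H`-components of the stabilizer of `p` fix `p` and the orbits of the two factors are orthogonal
at `p`. -/
theorem stabilizer_and_orthogonal_of_null_direction (hd : 2 ≤ d) (hK : K ≤ lorentzGroup d)
    (hε : IsLieExp E₁ e ε) (hisom : h.IsIsometricAction (H × H')) [PreconnectedSpace C]
    (hd₀ : Module.finrank ℝ E₀ = d)
    (hA : d = 2 → ∃ A ∈ K, LinearMap.det (A : MinkowskiSpace d →ₗ[ℝ] MinkowskiSpace d) *
        A (timeVector d) 0 < 0)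
    (hι : ContMDiff 𝓘(ℝ, E₀) 𝓘(ℝ, E) ∞ ι) (hιinj : Function.Injective ι)
    (hinj : ∀ x, Function.Injective (mfderiv 𝓘(ℝ, E₀) 𝓘(ℝ, E) ι x))
    (hπ : ContMDiff 𝓘(ℝ, E₁) 𝓘(ℝ, E₀) ∞ π) (hπsurj : Function.Surjective π)
    (hιπ : ∀ a, ι (π a) = ((a, 1) : H × H') • p)
    {u : E₀} (hu : u ≠ 0) (hnull : (h.form p : E →L[ℝ] E →L[ℝ] ℝ)
      ((mfderiv 𝓘(ℝ, E₀) 𝓘(ℝ, E) ι (π 1) : E₀ →L[ℝ] E) u)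
      ((mfderiv 𝓘(ℝ, E₀) 𝓘(ℝ, E) ι (π 1) : E₀ →L[ℝ] E) u) = 0) :
    (∀ (a : H) (b : H'), (a, b) • p = p → ((a, 1) : H × H') • p = p) ∧
    ∀ (v : E₀) (w : E₂), (h.form p : E →L[ℝ] E →L[ℝ] ℝ)
      ((mfderiv 𝓘(ℝ, E₀) 𝓘(ℝ, E) ι (π 1) : E₀ →L[ℝ] E) v)
      ((mfderiv 𝓘(ℝ, E₂) 𝓘(ℝ, E) (fun b : H' => ((1, b) : H × H') • p) 1 : E₂ →L[ℝ] E) w) = 0 := by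
  let D : E₀ →L[ℝ] E := mfderiv 𝓘(ℝ, E₀) 𝓘(ℝ, E) ι (π 1)
  have hDinj : Function.Injective D := hinj (π 1)
  let B : E →L[ℝ] E →L[ℝ] ℝ := h.form p
  let B' : E →ₗ[ℝ] E →ₗ[ℝ] ℝ := (ContinuousLinearMap.coeLM ℝ).comp B.toLinearMap
  have hsymm : ∀ v w, B v w = B w v := h.symm p
  have hpos : ∀ v, 0 ≤ B v v := h.nonneg p
  have hself : ∀ y, B y y = 0 → ∀ x, B x y = 0 := fun y => form_eq_zero_of_null hsymm hpos
  obtain ⟨L, hL⟩ : ∃ L : lorentzAlgebra d →ₗ[ℝ] E, ∀ X, L X = IsLieExp.orbitDeriv E ε H' p X :=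
    ⟨(IsLieExp.orbitDeriv E ε H' p).toLinearMap, fun _ => rfl⟩
  have hπs := mfderiv_surjective_of_orbit (E₂ := E₂) hι hinj hπ hπsurj hιπ
  have hrange : LinearMap.range L = LinearMap.range D.toLinearMap := by
    refine Eq.trans ?_ (hε.range_orbitDeriv hι hπ hιπ hπs)
    exact congrArg LinearMap.range (LinearMap.ext hL)
  have htr := hε.exists_mem_expGroup_smul_eq hιinj hπ hπsurj hιπ hπs
  have hdim : Module.finrank ℝ (LinearMap.ker L) + d =
      Module.finrank ℝ (lorentzAlgebra d) := by
    have h1 := finrank_ker_add_of_range_eq (V := lorentzAlgebra d) (L := L) hDinj hrange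
    rwa [hd₀] at h1
  have hqfin : Module.finrank ℝ (LinearMap.ker B.toLinearMap) = 1 := h.finrank_ker p
  have hker : ∀ y, y ∈ LinearMap.ker B.toLinearMap ↔ B y y = 0 := by
    intro y
    constructor
    · intro hy
      have h1 : B y = 0 := hy
      rw [h1]
      rfl
    · intro hy
      refine ContinuousLinearMap.ext fun x => ?_
      exact (hsymm y x).trans (hself y hy x)
  have hqle : LinearMap.ker B.toLinearMap ≤ LinearMap.range L := by
    intro y hy
    rw [hrange]
    have hDu : D u ≠ 0 := fun h0 => hu (hDinj (h0.trans (_root_.map_zero D).symm))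
    obtain ⟨t, rfl⟩ := exists_smul_eq_of_null hsymm hpos hqfin hnull ((hker y).1 hy) hDu
    exact ⟨t • u, map_smul D t u⟩
  have key := stabilizer_of_lightcone hd (L := L) (B := B') hsymm hpos
    (stabilizerLeft_le_image (e := e) (H' := H') p) (stabilizerImage_le hK p)
    (fun X hX => by
      rw [← hε.coe_apply]
      exact coe_mem_stabilizerLeft.2 (hε.smul_eq_of_orbitDeriv_eq_zero (E₂ := E₂)
          ((hL X).symm.trans hX)))
    (by
      intro g hg X Y hXY
      obtain ⟨a, b, hab, rfl⟩ := mem_stabilizerImage.1 hg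
      change B (L Y) (L Y) = B (L X) (L X)
      rw [hL, hL]
      exact form_orbitDeriv_conj (E₂ := E₂) hε hisom hab hXY)
    hdim (k := (LinearMap.ker B.toLinearMap).comap L) (fun X => hker (L X))
    (by rw [finrank_comap_of_le_range (V := lorentzAlgebra d) hqle, hqfin, ← hdim]; omega)
  refine ⟨smul_eq_of_stabilizer htr key.1, fun v w => ?_⟩
  let q : E := (mfderiv 𝓘(ℝ, E₂) 𝓘(ℝ, E) (fun b : H' => ((1, b) : H × H') • p) 1 : E₂ →L[ℝ] E) w
  have hl := key.2 ((B q).toLinearMap.comp L)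
    (fun X hX => hself (L X) ((hker _).1 hX) q)
    (by
      intro g hg X Y hXY
      obtain ⟨a, ha, rfl⟩ := mem_stabilizerLeft.1 hg
      have h1 := hε.orbitDeriv_conj (E := E) (E₂ := E₂) ha hXY
      rw [← hL, ← hL] at h1
      have h2 := mfderiv_smul_left_eq (E := E) (E₁ := E₁) ha w
      change B q (L Y) = B q (L X)
      refine (congrArg₂ (fun x y : E => B x y) h2.symm h1).trans ?_
      exact hisom.form_of_smul_eq ha q (L X))
    (by
      intro hd2
      obtain ⟨A, hAK, hdet⟩ := hA hd2
      obtain ⟨a, ha⟩ := e.surjective ⟨A, hAK⟩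
      have haA : (e a : MinkowskiSpace d ≃L[ℝ] MinkowskiSpace d) = A := congrArg Subtype.val ha
      obtain ⟨g, hg, hag⟩ := htr a
      refine ⟨A, hK hAK, hdet, _, hg, ?_⟩
      have h1 : (e g : MinkowskiSpace d ≃L[ℝ] MinkowskiSpace d)⁻¹ * A = (e (g⁻¹ * a) : _) := by
        rw [map_mul, map_inv, Subgroup.coe_mul, Subgroup.coe_inv, haA]
      rw [h1, coe_mem_stabilizerLeft]
      have h2 : ((g⁻¹ * a, 1) : H × H') = ((g, 1) : H × H')⁻¹ * (a, 1) := by simp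
      rw [h2, mul_smul, hag, inv_smul_smul])
  have hv : D v ∈ LinearMap.range L := hrange ▸ ⟨v, rfl⟩
  obtain ⟨X, hX⟩ := hv
  refine (congrArg (fun x : E => B x q) hX).symm.trans ((hsymm _ _).trans ?_)
  exact LinearMap.congr_fun hl X

end LorentzFactor

/-! ### One-dimensional orbits -/

section CircleOrbit

variable {E : Type*} [NormedAddCommGroup E] [NormedSpace ℝ E] [FiniteDimensional ℝ E]
  {M : Type*} [TopologicalSpace M] [T2Space M] [ChartedSpace E M] [IsManifold 𝓘(ℝ, E) ∞ M]
  {E₁ : Type*} [NormedAddCommGroup E₁] [NormedSpace ℝ E₁] [FiniteDimensional ℝ E₁]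
  {H : Type*} [Group H] [TopologicalSpace H] [SecondCountableTopology H]
  [ChartedSpace E₁ H] [LieGroup 𝓘(ℝ, E₁) ∞ H]
  {K : Subgroup (MinkowskiSpace 2 ≃L[ℝ] MinkowskiSpace 2)} {e : H ≃* K}
  {ε : lorentzAlgebra 2 → H}
  {E₂ : Type*} [NormedAddCommGroup E₂] [NormedSpace ℝ E₂]
  {H' : Type*} [Group H'] [TopologicalSpace H'] [ChartedSpace E₂ H']
  [MulAction (H × H') M]
  [hact : ContMDiffSMul (𝓘(ℝ, E₁).prod 𝓘(ℝ, E₂)) 𝓘(ℝ, E) ∞ (H × H') M]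
  {E₀ : Type*} [NormedAddCommGroup E₀] [NormedSpace ℝ E₀] [FiniteDimensional ℝ E₀]
  {C : Type*} [TopologicalSpace C] [ChartedSpace E₀ C] [IsManifold 𝓘(ℝ, E₀) ∞ C]
  {ι : C → M} {π : H → C} {p : M}

include hact in
/-- If the `H`-orbit of `p` is a connected curve, the `H`-components of the stabilizer of `p`
fix `p`. -/
theorem smul_eq_of_stabilizer_of_curve (hK : K ≤ lorentzGroup 2) (hε : IsLieExp E₁ e ε)
    [PreconnectedSpace C] (hd₀ : Module.finrank ℝ E₀ = 1)
    (hι : ContMDiff 𝓘(ℝ, E₀) 𝓘(ℝ, E) ∞ ι) (hιinj : Function.Injective ι)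
    (hinj : ∀ x, Function.Injective (mfderiv 𝓘(ℝ, E₀) 𝓘(ℝ, E) ι x))
    (hπ : ContMDiff 𝓘(ℝ, E₁) 𝓘(ℝ, E₀) ∞ π) (hπsurj : Function.Surjective π)
    (hιπ : ∀ a, ι (π a) = ((a, 1) : H × H') • p) (a : H) (b : H') (hab : (a, b) • p = p) :
    ((a, 1) : H × H') • p = p := by
  let D : E₀ →L[ℝ] E := mfderiv 𝓘(ℝ, E₀) 𝓘(ℝ, E) ι (π 1)
  have hDinj : Function.Injective D := hinj (π 1)
  obtain ⟨L, hL⟩ : ∃ L : lorentzAlgebra 2 →ₗ[ℝ] E, ∀ X, L X = IsLieExp.orbitDeriv E ε H' p X :=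
    ⟨(IsLieExp.orbitDeriv E ε H' p).toLinearMap, fun _ => rfl⟩
  have hπs := mfderiv_surjective_of_orbit (E₂ := E₂) hι hinj hπ hπsurj hιπ
  have hrange : LinearMap.range L = LinearMap.range D.toLinearMap := by
    refine Eq.trans ?_ (hε.range_orbitDeriv hι hπ hιπ hπs)
    exact congrArg LinearMap.range (LinearMap.ext hL)
  have htr := hε.exists_mem_expGroup_smul_eq hιinj hπ hπsurj hιπ hπs
  have hdim : Module.finrank ℝ (LinearMap.ker L) + 1 =
      Module.finrank ℝ (lorentzAlgebra 2) := by
    have h1 := finrank_ker_add_of_range_eq (V := lorentzAlgebra 2) (L := L) hDinj hrange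
    rwa [hd₀] at h1
  refine smul_eq_of_stabilizer htr (stabilizer_of_circle (L := L)
    (stabilizerLeft_le_image (e := e) (H' := H') p) (stabilizerImage_le hK p)
    (fun X hX => ?_) ?_ hdim) a b hab
  · rw [← hε.coe_apply]
    exact coe_mem_stabilizerLeft.2 (hε.smul_eq_of_orbitDeriv_eq_zero (E₂ := E₂)
        ((hL X).symm.trans hX))
  · intro g hg X Y hXY hX
    rw [hL] at hX ⊢
    obtain ⟨a, b, hab, rfl⟩ := mem_stabilizerImage.1 hg
    exact (hε.orbitDeriv_conj (E := E) (E₂ := E₂) hab hXY).trans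
      ((congrArg _ hX).trans (_root_.map_zero _))

end CircleOrbit

/-! ### The product decomposition -/

section Product

variable {d : ℕ}
  {E : Type*} [NormedAddCommGroup E] [NormedSpace ℝ E] [FiniteDimensional ℝ E]
  {M : Type*} [TopologicalSpace M] [T2Space M] [SecondCountableTopology M] [ChartedSpace E M]
  [IsManifold 𝓘(ℝ, E) ∞ M] {h : LightlikeMetric E M}
  {E₁ : Type*} [NormedAddCommGroup E₁] [NormedSpace ℝ E₁] [FiniteDimensional ℝ E₁]
  {H : Type*} [Group H] [TopologicalSpace H] [SecondCountableTopology H]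
  [ChartedSpace E₁ H] [LieGroup 𝓘(ℝ, E₁) ∞ H]
  {E₂ : Type*} [NormedAddCommGroup E₂] [NormedSpace ℝ E₂] [FiniteDimensional ℝ E₂]
  {H' : Type*} [Group H'] [TopologicalSpace H'] [SecondCountableTopology H']
  [ChartedSpace E₂ H'] [LieGroup 𝓘(ℝ, E₂) ∞ H']
  [MulAction (H × H') M]
  [hact : ContMDiffSMul (𝓘(ℝ, E₁).prod 𝓘(ℝ, E₂)) 𝓘(ℝ, E) ∞ (H × H') M] {p : M}

omit [FiniteDimensional ℝ E] [T2Space M] [SecondCountableTopology M] [FiniteDimensional ℝ E₁]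
  [SecondCountableTopology H] [LieGroup 𝓘(ℝ, E₁) ∞ H] [TopologicalSpace H']
  [SecondCountableTopology H'] in
/-- An orbit homothetic to the lightcone is isometric to it, because the lightcone has
homotheties of every ratio. -/
theorem exists_isometric_of_homothetic_lightCone
    (horbit : OrbitHomotheticTo h E₁ (fun (a : H) (x : M) => ((a, 1) : H × H') • x) p
      (LightCone.metric d)) :
    ∃ (ι : LightCone d → M) (π : H → LightCone d),
      ContMDiff (𝓡 d) 𝓘(ℝ, E) ∞ ι ∧ Function.Injective ι ∧
      (∀ x, Function.Injective (mfderiv (𝓡 d) 𝓘(ℝ, E) ι x)) ∧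
      ContMDiff 𝓘(ℝ, E₁) (𝓡 d) ∞ π ∧ Function.Surjective π ∧
      (∀ a, ι (π a) = ((a, 1) : H × H') • p) ∧
      ∀ (x : LightCone d) (v w : TangentSpace (𝓡 d) x),
        h.form (ι x) (mfderiv (𝓡 d) 𝓘(ℝ, E) ι x v) (mfderiv (𝓡 d) 𝓘(ℝ, E) ι x w) =
          LightCone.metric d x v w := by
  obtain ⟨ι, π, r, hr, hι, hιinj, hinj, hπ, hπsurj, hιπ, hform⟩ := horbit
  -- the homothety by `t` has ratio `t ^ 2`
  let s : ℝ := √r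
  let t : ℝ := s⁻¹
  have hs : 0 < s := Real.sqrt_pos.2 hr
  have ht : 0 < t := inv_pos.2 hs
  have hst : s * t = 1 := mul_inv_cancel₀ hs.ne'
  have hts : t * s = 1 := inv_mul_cancel₀ hs.ne'
  have hrt : r * t ^ 2 = 1 := by
    have : r = s ^ 2 := (Real.sq_sqrt hr.le).symm
    rw [this, ← mul_pow, hst, one_pow]
  have hσ := LightCone.contMDiff_scale (d := d) t ht
  have hσ' := LightCone.contMDiff_scale (d := d) s hs
  have hσinj : ∀ x : LightCone d, Function.Injective (mfderiv (𝓡 d) (𝓡 d)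
      (LightCone.scale t ht) x : EuclideanSpace ℝ (Fin d) →L[ℝ] EuclideanSpace ℝ (Fin d)) := by
    intro x
    refine Function.LeftInverse.injective (g := (mfderiv (𝓡 d) (𝓡 d) (LightCone.scale s hs)
      (LightCone.scale t ht x) : EuclideanSpace ℝ (Fin d) →L[ℝ] EuclideanSpace ℝ (Fin d)))
      fun v => ?_
    exact (mfderiv_apply_of_comp hσ' hσ (LightCone.scale_scale hs ht hst) rfl v).symm.trans
      (mfderiv_apply_of_eq_id (E₁ := EuclideanSpace ℝ (Fin d)) (fun _ => rfl) x v)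
  have hD := fun (x : LightCone d) (v : EuclideanSpace ℝ (Fin d)) =>
    mfderiv_apply_of_comp hι hσ (fun _ => rfl) (x := x) rfl v
  refine ⟨fun x => ι (LightCone.scale t ht x), fun a => LightCone.scale s hs (π a),
    hι.comp hσ, ?_, ?_, hσ'.comp hπ, ?_, ?_, ?_⟩
  · exact hιinj.comp (Function.LeftInverse.injective (LightCone.scale_scale hs ht hst))
  · intro x v w hvw
    exact hσinj x (hinj _ ((hD x v).symm.trans (hvw.trans (hD x w))))
  · exact (Function.RightInverse.surjective (LightCone.scale_scale hs ht hst)).comp hπsurj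
  · intro a
    change ι (LightCone.scale t ht (LightCone.scale s hs (π a))) = _
    rw [LightCone.scale_scale ht hs hts, hιπ]
  · intro x v w
    refine (congrArg₂ (fun y z : E => (h.form (ι (LightCone.scale t ht x)) :
      E →L[ℝ] E →L[ℝ] ℝ) y z) (hD x v) (hD x w)).trans ((hform _ _ _).trans ?_)
    refine (congrArg (r * ·) (LightCone.metric_scale t ht x v w)).trans ?_
    rw [← mul_assoc, hrt, one_mul]

include hact in
/-- The null direction required by the splitting theorem is that of the rays of the cone. -/
theorem isProductWithHomogeneous_of_lightCone_orbit (hd : 2 ≤ d)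
    {K : Subgroup (MinkowskiSpace d ≃L[ℝ] MinkowskiSpace d)} {e : H ≃* K}
    {ε : lorentzAlgebra d → H} (hK : K ≤ lorentzGroup d) (hε : IsLieExp E₁ e ε)
    (hisom : h.IsIsometricAction (H × H')) (htrans : MulAction.IsPretransitive (H × H') M)
    (hA : d = 2 → ∃ A ∈ K, LinearMap.det (A : MinkowskiSpace d →ₗ[ℝ] MinkowskiSpace d) *
        A (timeVector d) 0 < 0)
    (horbit : OrbitHomotheticTo h E₁ (fun (a : H) (x : M) => ((a, 1) : H × H') • x) p
      (LightCone.metric d)) :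
    IsProductWithHomogeneous h (LightCone.metric d) E₂ H' := by
  have := LightCone.preconnectedSpace hd
  obtain ⟨ι, π, hι, hιinj, hinj, hπ, hπsurj, hιπ, hform⟩ :=
    exists_isometric_of_homothetic_lightCone horbit
  obtain ⟨u, hu, hnull⟩ := LightCone.exists_radial (π 1)
  have hp : ι (π 1) = p := by rw [hιπ, ← Prod.one_eq_mk, one_smul]
  have hnull' := (h.form_congr hp.symm _ _).trans ((hform (π 1) u u).trans hnull)
  have key := stabilizer_and_orthogonal_of_null_direction (E₂ := E₂) hd hK hε hisom
    (by simp) hA hι hιinj hinj hπ hπsurj hιπ hu hnull'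
  exact isProductWithHomogeneous_of_orbit (E₁ := E₁) htrans hisom hι hιinj hπ hπsurj hιπ hform
    key.1 key.2 hu hnull'

include hact in
/-- The whole tangent line of a null circle is the kernel of `h`, hence orthogonal to everything. -/
theorem isProductWithHomogeneous_of_circle_orbit
    {K : Subgroup (MinkowskiSpace 2 ≃L[ℝ] MinkowskiSpace 2)} {e : H ≃* K}
    {ε : lorentzAlgebra 2 → H} (hK : K ≤ lorentzGroup 2) (hε : IsLieExp E₁ e ε)
    (hisom : h.IsIsometricAction (H × H')) (htrans : MulAction.IsPretransitive (H × H') M)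
    (horbit : OrbitHomotheticTo h E₁ (fun (a : H) (x : M) => ((a, 1) : H × H') • x) p
      circleNullMetric) :
    IsProductWithHomogeneous h circleNullMetric E₂ H' := by
  obtain ⟨ι, π, r, hr, hι, hιinj, hinj, hπ, hπsurj, hιπ, hform⟩ := horbit
  have : IsManifold (𝓡 1) ∞ Circle := IsManifold.of_le (n := ω) le_top
  have hnull : ∀ (x : Circle) (v w : TangentSpace (𝓡 1) x),
      h.form (ι x) (mfderiv (𝓡 1) 𝓘(ℝ, E) ι x v) (mfderiv (𝓡 1) 𝓘(ℝ, E) ι x w) = 0 :=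
    fun x v w => (hform x v w).trans (mul_zero r)
  have hp : ι (π 1) = p := (hιπ 1).trans (one_smul (H × H') p)
  have hnull' : ∀ v w : EuclideanSpace ℝ (Fin 1), (h.form p : E →L[ℝ] E →L[ℝ] ℝ)
      ((mfderiv (𝓡 1) 𝓘(ℝ, E) ι (π 1) : EuclideanSpace ℝ (Fin 1) →L[ℝ] E) v)
      ((mfderiv (𝓡 1) 𝓘(ℝ, E) ι (π 1) : EuclideanSpace ℝ (Fin 1) →L[ℝ] E) w) = 0 :=
    fun v w => (h.form_congr hp.symm _ _).trans (hnull _ v w)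
  obtain ⟨u, hu⟩ := exists_ne (0 : EuclideanSpace ℝ (Fin 1))
  let B : E →L[ℝ] E →L[ℝ] ℝ := h.form p
  have hsymm : ∀ v w, B v w = B w v := h.symm p
  exact isProductWithHomogeneous_of_orbit (E₁ := E₁) htrans hisom hι hιinj hπ hπsurj hιπ hnull
    (smul_eq_of_stabilizer_of_curve (E := E) (E₂ := E₂) hK hε (by simp) hι hιinj hinj hπ
      hπsurj hιπ)
    (fun v w => (hsymm _ _).trans (form_eq_zero_of_null hsymm (h.nonneg p) (hnull' v v) _))
    hu (hnull' u u)

end Product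

theorem mainTheorem8
    -- the lightlike manifold `(M, h)`
    {E : Type*} [NormedAddCommGroup E] [NormedSpace ℝ E] [FiniteDimensional ℝ E]
    {M : Type*} [TopologicalSpace M] [T2Space M] [SecondCountableTopology M]
    [ChartedSpace E M] [IsManifold 𝓘(ℝ, E) ∞ M]
    (h : LightlikeMetric E M)
    -- the Lie group `H`, isomorphic to `O(1,d)` or to a subgroup `K` of finite index in it
    {E₁ : Type*} [NormedAddCommGroup E₁] [NormedSpace ℝ E₁] [FiniteDimensional ℝ E₁]
    {H : Type*} [Group H] [TopologicalSpace H] [T2Space H] [SecondCountableTopology H]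
    [ChartedSpace E₁ H] [LieGroup 𝓘(ℝ, E₁) ∞ H]
    (d : ℕ) (hd : 2 ≤ d)
    (K : Subgroup (MinkowskiSpace d ≃L[ℝ] MinkowskiSpace d)) (hK : K ≤ lorentzGroup d)
    (hKfin : K.IsFiniteRelIndex (lorentzGroup d))
    (e : H ≃* K) (he : IsLieGroupIsoOnto (E := E₁) e)
    -- the semisimple Lie group `H'`
    {E₂ : Type*} [NormedAddCommGroup E₂] [NormedSpace ℝ E₂] [FiniteDimensional ℝ E₂]
    {H' : Type*} [Group H'] [TopologicalSpace H'] [T2Space H'] [SecondCountableTopology H']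
    [ChartedSpace E₂ H'] [LieGroup 𝓘(ℝ, E₂) ∞ H']
    (hH' : IsSemisimpleLieGroup E₂ H')
    -- the action of `G = H × H'` on `M`
    [MulAction (H × H') M]
    [ContMDiffSMul (𝓘(ℝ, E₁).prod 𝓘(ℝ, E₂)) 𝓘(ℝ, E) ∞ (H × H') M]
    (hisom : h.IsIsometricAction (H × H'))
    (hfaithful : IsLocallyFaithful (H × H') M)
    (htrans : MulAction.IsPretransitive (H × H') M)
    (hnonproper : IsNonProper (H × H') M)
    (p : M) :
    -- some `H`-orbit is homothetic to `Co^d`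
    ((d = 2 → ∃ A ∈ K, LinearMap.det (A : MinkowskiSpace d →ₗ[ℝ] MinkowskiSpace d) *
        A (timeVector d) 0 < 0) →
      OrbitHomotheticTo h E₁ (fun (a : H) (x : M) => ((a, 1) : H × H') • x) p
        (LightCone.metric d) →
      IsProductWithHomogeneous h (LightCone.metric d) E₂ H') ∧
    -- `d = 2` and some `H`-orbit is homothetic to `Co^1`
    (d = 2 →
      OrbitHomotheticTo h E₁ (fun (a : H) (x : M) => ((a, 1) : H × H') • x) p
        circleNullMetric →
      IsProductWithHomogeneous h circleNullMetric E₂ H') := by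
  obtain ⟨ε, hε₁, hε₂, hε₃⟩ := exists_lieExp hK hKfin he
  refine ⟨fun hA horbit => isProductWithHomogeneous_of_lightCone_orbit hd hK ⟨hε₁, hε₂, hε₃⟩
    hisom htrans hA horbit, fun hd2 horbit => ?_⟩
  subst hd2
  exact isProductWithHomogeneous_of_circle_orbit hK ⟨hε₁, hε₂, hε₃⟩ hisom htrans horbit
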